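/- **Setting.** Let $F$ be a compact metric space with a finitely ramified cell structure: countably many distinct compact connected cells $F_\alpha\subset F$ ($\alpha\in\mathcal A$), each with a finite vertex set $V_\alpha\subset F_\alpha$, $|V_\alpha|\ge 2$, such that $F_\alpha=\bigcup_{j=1}^kF_{\alpha_j}$ implies $V_\alpha\subset\bigcup_j V_{\alpha_j}$; $\mathcal A$ is the disjoint union of finite sets $\mathcal A_n$, $n\ge0$, with $\mathcal A_0=\{0\}$ and $F_0=F$; every $n$-cell (i.e. $F_\alpha$ with $\alpha\in\mathcal A_n$) is a union of $(n+1)$-cells; $F_\alpha\cap F_{\alpha'}=V_\alpha\cap V_{\alpha'}$ for distinct $\alpha,\alpha'\in\mathcal A_n$; and the intersection of any infinite strictly decreasing sequence of cells is one point. Write $V_n=\bigcup_{\alpha\in\mathcal A_n}V_\alpha$ (so $V_0$ is the vertex set of $F_0=F$), $V_*=\bigcup_\alpha V_\alpha$, $m=|V_0|$. Let $(\mathcal E,\mathrm{Dom}\,\mathcal E)$ be a resistance form on $V_*$ in the sense of Kigami. For finite $U\subset V_*$ let $\mathcal E_U(f,f)=\inf\{\mathcal E(g,g):g\in\mathrm{Dom}\,\mathcal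 E,\ g|_U=f\}$ be its trace, and write $\mathcal E_{V_n}(f,f)=\frac12\sum_{x,y\in V_n}c_{n,x,y}(f(x)-f(y))^2$. Assume that $\mathcal E$ respects the cell structure: $c_{n,x,y}=0$ for distinct $x,y\in V_n$ that lie in no common $V_\alpha$ with $\alpha\in\mathcal A_n$. The restriction of $\mathcal E$ to a cell is $\mathcal E_\alpha(f,f)=\lim_{k\to\infty}\frac12\sum_{x,y\in V_k\cap F_\alpha}c_{k,x,y}(f(x)-f(y))^2$, and $D_\alpha$ is the matrix of the quadratic form $u\mapsto\inf\{\mathcal E_\alpha(g,g):g\in\mathrm{Dom}\,\mathcal E,\ g|_{V_\alpha}=u\}$ on $\ell(V_\alpha)$. A function in $\mathrm{Dom}\,\mathcal E$ is harmonic if it minimizes the energy for its values on $V_0$. Assume that every harmonic function extends continuously to $F$, and that (WN) holds: the functions in $\mathrm{Dom}\,\mathcal E$ that, for some $n$, coincide on each $n$-cell with a harmonic function are $\mathcal E$-dense in $\mathrm{Dom}\,\mathcal E$. For $i\in V_0$ let $h^{(i)}$ be the harmonic function with boundary values $h^{(i)}(v)=\delta_{iv}$, $v\in V_0$, and let $\psi=(h^{(i)})_{i\in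 V_0}:F\to\mathbb R^m=\ell(V_0)$. Assume (HC): $\psi$ is a homeomorphism onto its image. Let $h_1,\dots,h_{m-1}$ be harmonic functions with $\mathcal E(h_i,h_j)=\delta_{ij}$, and let $\nu=\nu_{h_1}+\dots+\nu_{h_{m-1}}$, where $\nu_h$ is the non-atomic Borel measure on $F$ such that $\nu_h(F_\alpha)=\langle h|_{V_\alpha},D_\alpha h|_{V_\alpha}\rangle$ for all $\alpha$. Let $M_\alpha:\ell(V_0)\to\ell(V_\alpha)$ map boundary values to the values on $V_\alpha$ of their harmonic extension, put $Z_\alpha=M_\alpha^*D_\alpha M_\alpha/\nu(F_\alpha)$ if $\nu(F_\alpha)\ne0$ ($Z_\alpha=0$ otherwise), $Z_n(x)=Z_\alpha$ for $x\in F_\alpha\setminus V_\alpha$, $\alpha\in\mathcal A_n$, and $Z(x)=\lim_nZ_n(x)$. A function $G\in L^2(\nu)$ is called the version of $g\in\mathrm{Dom}\,\mathcal E$ if there are continuous $u_k$ on $F$ with $u_k|_{V_*}\in\mathrm{Dom}\,\mathcal E$, $\mathcal E(u_k-g,u_k-g)\to0$, $u_k\to g$ pointwise on $V_*$ and $u_k\to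 G$ in $L^2(\nu)$. One says that $f\in\mathrm{Dom}\,\Delta_\nu$ and $\Delta_\nu f=w$ if $f\in\mathrm{Dom}\,\mathcal E$, $w\in L^2(\nu)$ and, for every $g\in\mathrm{Dom}\,\mathcal E$ vanishing on $V_0$, $g$ has a version and $\mathcal E(f,g)=-\int_F G\,w\,d\nu$ for every version $G$ of $g$. **Theorem.** Under these assumptions the measure $\nu$ exists and is unique, the limit $Z(x)$ exists for $\nu$-almost every $x$, and: 1. for every $f\in C^2(\mathbb R^m)$ the function $f\circ\psi$ (the restriction of $f$ to $F$, when $F$ is identified with $\psi(F)$), considered on $V_*$, belongs to $\mathrm{Dom}\,\Delta_\nu$; 2. for every such $f$, $\Delta_\nu(f\circ\psi)$ is determined $\nu$-almost everywhere, and for $\nu$-almost every $x$ $$\Delta_\nu(f\circ\psi)(x)=\mathrm{Tr}\bigl(Z(x)\,D^2f(\psi(x))\bigr),$$ where $D^2f$ is the matrix of second partial derivatives of $f$; 3. such functions are $\mathcal E$-dense in $\mathrm{Dom}\,\Delta_\nu$: for every $u\in\mathrm{Dom}\,\Delta_\nu$ and $\varepsilon>0$ there is $f\in C^2(\mathbb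 R^m)$ with $\mathcal E(u-f\circ\psi,u-f\circ\psi)<\varepsilon$. -/

import Mathlib

open MeasureTheory Filter Topology

/-- A resistance form on a set `X`: a linear space `dom` of real functions on `X` together with a
nonnegative symmetric bilinear form on it.  Only the values `form u v` with `u v ∈ dom` have a
meaning. -/
structure ResistanceForm (X : Type*) where
  dom : Submodule ℝ (X → ℝ)
  form : (X → ℝ) → (X → ℝ) → ℝ
  add_left : ∀ u ∈ dom, ∀ v ∈ dom, ∀ w ∈ dom, form (u + v) w = form u w + form v w
  smul_left : ∀ (c : ℝ), ∀ u ∈ dom, ∀ v ∈ dom, form (c • u) v = c * form u v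
  symm : ∀ u ∈ dom, ∀ v ∈ dom, form u v = form v u
  nonneg : ∀ u ∈ dom, 0 ≤ form u u
  const_mem : ∀ c : ℝ, (fun _ => c) ∈ dom
  eq_zero_iff : ∀ u ∈ dom, form u u = 0 ↔ ∃ c : ℝ, u = fun _ => c
  /-- The quotient of `dom` by the constants is a Hilbert space. -/
  complete : ∀ u : ℕ → X → ℝ, (∀ n, u n ∈ dom) →
    (∀ ε > 0, ∃ N, ∀ m ≥ N, ∀ n ≥ N, form (u m - u n) (u m - u n) < ε) →
    ∃ v ∈ dom, Tendsto (fun n => form (u n - v) (u n - v)) atTop (𝓝 0)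
  /-- Every function on a finite set is the restriction of a function of finite energy. -/
  exists_extension : ∀ (V : Finset X) (w : X → ℝ), ∃ u ∈ dom, ∀ x ∈ V, u x = w x
  /-- The effective resistance between any two points is finite. -/
  resistance_bdd : ∀ p q : X,
    BddAbove {r : ℝ | ∃ u ∈ dom, 0 < form u u ∧ r = (u p - u q) ^ 2 / form u u}
  /-- The Markov property. -/
  markov : ∀ u ∈ dom, (fun x => min (max (u x) 0) 1) ∈ dom ∧
    form (fun x => min (max (u x) 0) 1) (fun x => min (max (u x) 0) 1) ≤ form u u

namespace ResistanceForm

/-- The trace of a resistance form on the set `U`, evaluated (as a quadratic form) at `w|_U`. -/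
noncomputable def trace {X : Type*} (E : ResistanceForm X) (U : Finset X) (w : X → ℝ) : ℝ :=
  sInf {e : ℝ | ∃ g ∈ E.dom, (∀ x ∈ U, g x = w x) ∧ e = E.form g g}

open scoped Classical in
/-- The conductance `c_{U,x,y}` between two distinct points `x`, `y` of `U`, so that the trace
on `U` of the form is `f ↦ (1/2) ∑_{x,y ∈ U} c_{U,x,y} (f x - f y)²`. -/
noncomputable def conductance {X : Type*} (E : ResistanceForm X) (U : Finset X) (x y : X) : ℝ :=
  (E.trace U (Pi.single x 1) + E.trace U (Pi.single y 1)
    - E.trace U (Pi.single x 1 + Pi.single y 1)) / 2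

end ResistanceForm

/-- A finitely ramified cell structure on the compact metric space `F`, with index set `A`: cells
`cell α`, their finite vertex boundaries `vert α`, and the filtration `lvl`. -/
structure FinitelyRamified (F : Type*) [MetricSpace F] [CompactSpace F] (A : Type*) where
  countable : Countable A
  cell : A → Set F
  cell_injective : Function.Injective cell
  cell_compact : ∀ α, IsCompact (cell α)
  cell_connected : ∀ α, IsConnected (cell α)
  vert : A → Finset F
  vert_subset : ∀ α, (vert α : Set F) ⊆ cell α
  two_le_card_vert : ∀ α, 2 ≤ (vert α).card
  vert_subset_union : ∀ (α : A) (s : Finset A), cell α = ⋃ β ∈ s, cell β →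
    (vert α : Set F) ⊆ ⋃ β ∈ s, (vert β : Set F)
  lvl : ℕ → Finset A
  root : A
  lvl_zero : lvl 0 = {root}
  cell_root : cell root = Set.univ
  lvl_disjoint : ∀ n m, n ≠ m → Disjoint (lvl n) (lvl m)
  lvl_exhaust : ∀ α, ∃ n, α ∈ lvl n
  subdivide : ∀ n, ∀ α ∈ lvl n, ∃ s ⊆ lvl (n + 1), cell α = ⋃ β ∈ s, cell β
  inter : ∀ n, ∀ α ∈ lvl n, ∀ β ∈ lvl n, α ≠ β →
    cell α ∩ cell β = (vert α : Set F) ∩ (vert β : Set F)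
  shrink : ∀ a : ℕ → A, (∀ n, cell (a (n + 1)) ⊂ cell (a n)) → ∃ x, ⋂ n, cell (a n) = {x}

namespace FinitelyRamified

section

variable {F : Type*} [MetricSpace F] [CompactSpace F] {A : Type*}

/-- The set `V_*` of all vertices. -/
def Vstar (S : FinitelyRamified F A) : Set F := ⋃ α, (S.vert α : Set F)

open scoped Classical in
/-- The vertex boundary of a cell as a finite subset of `V_*`. -/
noncomputable def V (S : FinitelyRamified F A) (α : A) : Finset S.Vstar :=
  (S.vert α).subtype (· ∈ S.Vstar)

open scoped Classical in
/-- The set `V_n` of the vertices of all `n`-cells. -/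
noncomputable def Vlvl (S : FinitelyRamified F A) (n : ℕ) : Finset S.Vstar :=
  (S.lvl n).biUnion S.V

/-- The vertex boundary `V_0` of `F`. -/
noncomputable abbrev V0 (S : FinitelyRamified F A) : Finset S.Vstar := S.V S.root

/-- The restriction to `V_*` of a function on `F`. -/
def res (S : FinitelyRamified F A) (U : F → ℝ) : S.Vstar → ℝ := fun x => U x

/-- The form respects the cell structure: the trace on `V_n` is a sum of forms on the vertex
sets of the `n`-cells, that is, it has no conductance between two vertices that do not belong to a
common `n`-cell. -/
def IsLocal (S : FinitelyRamified F A) (E : ResistanceForm S.Vstar) : Prop :=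
  ∀ n, ∀ x ∈ S.Vlvl n, ∀ y ∈ S.Vlvl n, x ≠ y →
    (¬ ∃ α ∈ S.lvl n, x ∈ S.V α ∧ y ∈ S.V α) → E.conductance (S.Vlvl n) x y = 0

open scoped Classical in
/-- The restriction `𝓔_α` of the form to the cell `F_α` (as a quadratic form): the part of
`𝓔(f,f) = lim_m (1/2) ∑_{x,y ∈ V_m} c_{m,x,y} (f x - f y)²` carried by the edges inside `F_α`. -/
noncomputable def cellEnergy (S : FinitelyRamified F A) (E : ResistanceForm S.Vstar) (α : A)
    (f : S.Vstar → ℝ) : ℝ :=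
  limUnder atTop fun m : ℕ =>
    (∑ x ∈ (S.Vlvl m).filter (fun x : S.Vstar => (x : F) ∈ S.cell α),
      ∑ y ∈ (S.Vlvl m).filter (fun y : S.Vstar => (y : F) ∈ S.cell α),
        E.conductance (S.Vlvl m) x y * (f x - f y) ^ 2) / 2

/-- The trace of `𝓔_α` on the vertex boundary `V_α` (as a quadratic form), evaluated at
`w|_{V_α}`. -/
noncomputable def cellTrace (S : FinitelyRamified F A) (E : ResistanceForm S.Vstar) (α : A)
    (w : S.Vstar → ℝ) : ℝ :=
  sInf {e : ℝ | ∃ g ∈ E.dom, (∀ x ∈ S.V α, g x = w x) ∧ e = S.cellEnergy E α g}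

/-- Harmonic functions minimize the energy for given values on `V_0`. -/
def IsHarmonic (S : FinitelyRamified F A) (E : ResistanceForm S.Vstar)
    (u : S.Vstar → ℝ) : Prop :=
  u ∈ E.dom ∧ ∀ g ∈ E.dom, (∀ v ∈ S.V0, g v = u v) → E.form u u ≤ E.form g g

/-- All harmonic functions are continuous, that is, they extend continuously to `F`. -/
def HarmonicContinuous (S : FinitelyRamified F A) (E : ResistanceForm S.Vstar) : Prop :=
  ∀ u, S.IsHarmonic E u → ∃ U : F → ℝ, Continuous U ∧ S.res U = u

/-- `n`-piecewise harmonic functions coincide on every `n`-cell with a globally harmonic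
function. -/
def IsPiecewiseHarmonic (S : FinitelyRamified F A) (E : ResistanceForm S.Vstar) (n : ℕ)
    (p : S.Vstar → ℝ) : Prop :=
  p ∈ E.dom ∧ ∀ α ∈ S.lvl n, ∃ h, S.IsHarmonic E h ∧ ∀ x : S.Vstar, (x : F) ∈ S.cell α → p x = h x

/-- Weak nondegeneracy: piecewise harmonic functions are energy-dense in the domain. -/
def WeaklyNondegenerate (S : FinitelyRamified F A) (E : ResistanceForm S.Vstar) : Prop :=
  ∀ u ∈ E.dom, ∀ ε > 0, ∃ n p, S.IsPiecewiseHarmonic E n p ∧ E.form (u - p) (u - p) < ε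

/-- The continuous extension to `F` of the harmonic function with boundary values `b` on `V_0`. -/
noncomputable def harmonicExtension (S : FinitelyRamified F A) (E : ResistanceForm S.Vstar)
    (b : S.V0 → ℝ) : F → ℝ :=
  Classical.epsilon fun U : F → ℝ =>
    Continuous U ∧ S.IsHarmonic E (S.res U) ∧ ∀ v : S.V0, S.res U v = b v

open scoped Classical in
/-- The harmonic coordinate map `ψ : F → ℓ(V_0) = ℝ^m`. -/
noncomputable def coord (S : FinitelyRamified F A) (E : ResistanceForm S.Vstar)
    (x : F) : S.V0 → ℝ :=
  fun i => S.harmonicExtension E (Pi.single i 1) x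

/-- Assumption (HC): the harmonic coordinate map is a homeomorphism onto its image. -/
def HarmonicCoordinates (S : FinitelyRamified F A) (E : ResistanceForm S.Vstar) : Prop :=
  IsEmbedding (S.coord E)

open scoped Classical in
/-- The matrix `D_α` of the trace form of `𝓔_α` on `V_α`, by polarization. -/
noncomputable def cellFormMatrix (S : FinitelyRamified F A) (E : ResistanceForm S.Vstar) (α : A) :
    Matrix (S.V α) (S.V α) ℝ :=
  Matrix.of fun x y =>
    (S.cellTrace E α (Pi.single (x : S.Vstar) 1 + Pi.single (y : S.Vstar) 1)
      - S.cellTrace E α (Pi.single (x : S.Vstar) 1)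
      - S.cellTrace E α (Pi.single (y : S.Vstar) 1)) / 2

/-- The matrix `M_α` of the map `ℓ(V_0) → ℓ(V_α)` that takes boundary values to the values on
`V_α` of their harmonic extension. -/
noncomputable def harmonicMatrix (S : FinitelyRamified F A) (E : ResistanceForm S.Vstar) (α : A) :
    Matrix (S.V α) S.V0 ℝ :=
  Matrix.of fun x i => S.coord E ((x : S.Vstar) : F) i

variable [MeasurableSpace F]

/-- `μ` is the (continuous) energy measure `ν_h` of the harmonic function `h`. -/
def IsEnergyMeasure (S : FinitelyRamified F A) (E : ResistanceForm S.Vstar)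
    (h : S.Vstar → ℝ) (μ : Measure F) : Prop :=
  (∀ x, μ {x} = 0) ∧ ∀ α, μ (S.cell α) = ENNReal.ofReal (S.cellTrace E α h)

/-- `ν` is the Kusuoka measure `ν_{h_1} + ... + ν_{h_k}`. -/
def IsKusuokaMeasure (S : FinitelyRamified F A) (E : ResistanceForm S.Vstar) {k : ℕ}
    (h : Fin k → S.Vstar → ℝ) (ν : Measure F) : Prop :=
  ∃ μ : Fin k → Measure F, (∀ i, S.IsEnergyMeasure E (h i) (μ i)) ∧ ν = ∑ i, μ i

/-- `Z_α = M_αᵀ D_α M_α / ν(F_α)`, which is the zero matrix if `ν(F_α) = 0`. -/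
noncomputable def Zcell (S : FinitelyRamified F A) (E : ResistanceForm S.Vstar) (ν : Measure F)
    (α : A) : Matrix S.V0 S.V0 ℝ :=
  (ν.real (S.cell α))⁻¹ •
    ((S.harmonicMatrix E α).transpose * S.cellFormMatrix E α * S.harmonicMatrix E α)

open scoped Classical in
/-- `Z_n(x) = Z_α` for `x ∈ F_α \ V_α`, `α ∈ A_n` (at most one `α` qualifies); it is set to zero
for `x ∈ V_n`. -/
noncomputable def Zlvl (S : FinitelyRamified F A) (E : ResistanceForm S.Vstar) (ν : Measure F)
    (n : ℕ) (x : F) : Matrix S.V0 S.V0 ℝ :=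
  ∑ α ∈ S.lvl n, if x ∈ S.cell α ∧ x ∉ S.vert α then S.Zcell E ν α else 0

/-- `G` is the version in `L²(ν)` of the function `g` of finite energy on `V_*`: it is an
`L²(ν)`-limit of continuous functions on `F` that have finite energy and converge to `g` in energy
and pointwise on `V_*`.  If `g` extends to a continuous function on `F`, then that function is
such a `G`. -/
def IsVersion (S : FinitelyRamified F A) (E : ResistanceForm S.Vstar) (ν : Measure F)
    (g : S.Vstar → ℝ) (G : F → ℝ) : Prop :=
  MemLp G 2 ν ∧ ∃ u : ℕ → F → ℝ, (∀ n, Continuous (u n)) ∧ (∀ n, S.res (u n) ∈ E.dom) ∧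
    Tendsto (fun n => E.form (S.res (u n) - g) (S.res (u n) - g)) atTop (𝓝 0) ∧
    (∀ x : S.Vstar, Tendsto (fun n => u n x) atTop (𝓝 (g x))) ∧
    Tendsto (fun n => eLpNorm (u n - G) 2 ν) atTop (𝓝 0)

/-- `f` belongs to the domain of the energy measure Laplacian and `Δ_ν f = w`: one has
`𝓔(f,g) = - ∫ g w dν` for all `g` in the domain of the form that vanish on `V_0`. -/
def IsLaplacian (S : FinitelyRamified F A) (E : ResistanceForm S.Vstar) (ν : Measure F)
    (f : S.Vstar → ℝ) (w : F → ℝ) : Prop :=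
  f ∈ E.dom ∧ MemLp w 2 ν ∧ ∀ g ∈ E.dom, (∀ v ∈ S.V0, g v = 0) →
    (∃ G, S.IsVersion E ν g G) ∧
    ∀ G, S.IsVersion E ν g G → E.form f g = - ∫ x, G x * w x ∂ν

end

end FinitelyRamified

open scoped Classical in
/-- The matrix of the second partial derivatives of `f` at `x`. -/
noncomputable def hessianMatrix {ι : Type*} [Fintype ι] (f : (ι → ℝ) → ℝ) (x : ι → ℝ) :
    Matrix ι ι ℝ :=
  Matrix.of fun i j => iteratedFDeriv ℝ 2 f x ![Pi.single i 1, Pi.single j 1]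

set_option linter.unusedSectionVars false

namespace ResistanceForm

section Basic

variable {X : Type*} (E : ResistanceForm X)

lemma add_right {u v w : X → ℝ} (hu : u ∈ E.dom) (hv : v ∈ E.dom) (hw : w ∈ E.dom) :
    E.form u (v + w) = E.form u v + E.form u w := by
  rw [E.symm u hu _ (E.dom.add_mem hv hw), E.add_left v hv w hw u hu, E.symm v hv u hu,
    E.symm w hw u hu]

lemma smul_right (c : ℝ) {u v : X → ℝ} (hu : u ∈ E.dom) (hv : v ∈ E.dom) :
    E.form u (c • v) = c * E.form u v := by
  rw [E.symm u hu _ (E.dom.smul_mem c hv), E.smul_left c v hv u hu, E.symm v hv u hu]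

/-- The form of a resistance form as a bilinear map on its domain. -/
noncomputable def bilin : E.dom →ₗ[ℝ] E.dom →ₗ[ℝ] ℝ :=
  LinearMap.mk₂ ℝ (fun u v => E.form u v)
    (fun u v w => E.add_left u u.2 v v.2 w w.2)
    (fun c u v => E.smul_left c u u.2 v v.2)
    (fun u v w => E.add_right u.2 v.2 w.2)
    (fun c u v => E.smul_right c u.2 v.2)

lemma bilin_apply (u v : E.dom) : E.bilin u v = E.form u v := rfl

lemma sub_left {u v w : X → ℝ} (hu : u ∈ E.dom) (hv : v ∈ E.dom) (hw : w ∈ E.dom) :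
    E.form (u - v) w = E.form u w - E.form v w :=
  congrArg (fun l => l ⟨w, hw⟩) (E.bilin.map_sub ⟨u, hu⟩ ⟨v, hv⟩)

lemma sub_right {u v w : X → ℝ} (hu : u ∈ E.dom) (hv : v ∈ E.dom) (hw : w ∈ E.dom) :
    E.form u (v - w) = E.form u v - E.form u w :=
  (E.bilin ⟨u, hu⟩).map_sub ⟨v, hv⟩ ⟨w, hw⟩

lemma sum_left {ι : Type*} (s : Finset ι) (a : ι → ℝ) (f : ι → X → ℝ) {w : X → ℝ}
    (hf : ∀ i ∈ s, f i ∈ E.dom) (hw : w ∈ E.dom) :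
    E.form (∑ i ∈ s, a i • f i) w = ∑ i ∈ s, a i * E.form (f i) w := by
  classical
  induction s using Finset.induction_on with
  | empty => simpa using E.smul_left 0 w hw w hw
  | insert i s his ih =>
    have h1 : f i ∈ E.dom := hf i (by simp)
    have h2 : ∀ j ∈ s, f j ∈ E.dom := fun j hj => hf j (by simp [hj])
    rw [Finset.sum_insert his, Finset.sum_insert his,
      E.add_left _ (E.dom.smul_mem _ h1) _
        (E.dom.sum_mem fun j hj => E.dom.smul_mem _ (h2 j hj)) _ hw,
      E.smul_left _ _ h1 _ hw, ih h2]

lemma form_add_self {u v : X → ℝ} (hu : u ∈ E.dom) (hv : v ∈ E.dom) :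
    E.form (u + v) (u + v) = E.form u u + 2 * E.form u v + E.form v v := by
  rw [E.add_left u hu v hv _ (E.dom.add_mem hu hv), E.add_right hu hu hv, E.add_right hv hu hv,
    E.symm v hv u hu]
  ring

lemma form_sub_self {u v : X → ℝ} (hu : u ∈ E.dom) (hv : v ∈ E.dom) :
    E.form (u - v) (u - v) = E.form u u - 2 * E.form u v + E.form v v := by
  rw [E.sub_left hu hv (E.dom.sub_mem hu hv), E.sub_right hu hu hv, E.sub_right hv hu hv,
    E.symm v hv u hu]
  ring

lemma form_smul_self (c : ℝ) {u : X → ℝ} (hu : u ∈ E.dom) :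
    E.form (c • u) (c • u) = c ^ 2 * E.form u u := by
  rw [E.smul_left c u hu _ (E.dom.smul_mem c hu), E.smul_right c hu hu]; ring

lemma form_sub_comm {u v : X → ℝ} (hu : u ∈ E.dom) (hv : v ∈ E.dom) :
    E.form (u - v) (u - v) = E.form (v - u) (v - u) := by
  rw [E.form_sub_self hu hv, E.form_sub_self hv hu, E.symm u hu v hv]; ring

lemma cauchy_schwarz {u v : X → ℝ} (hu : u ∈ E.dom) (hv : v ∈ E.dom) :
    E.form u v ^ 2 ≤ E.form u u * E.form v v := by
  have h := LinearMap.BilinForm.apply_mul_apply_le_of_forall_zero_le E.bilin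
    (fun x => E.nonneg x x.2) ⟨u, hu⟩ ⟨v, hv⟩
  simp only [bilin_apply] at h
  rw [E.symm v hv u hu] at h
  rw [sq]; exact h

lemma abs_form_le {u v : X → ℝ} (hu : u ∈ E.dom) (hv : v ∈ E.dom) :
    |E.form u v| ≤ √(E.form u u) * √(E.form v v) := by
  rw [← Real.sqrt_mul (E.nonneg u hu)]
  exact Real.abs_le_sqrt (E.cauchy_schwarz hu hv)

lemma form_add_self_le {u v : X → ℝ} (hu : u ∈ E.dom) (hv : v ∈ E.dom) :
    E.form (u + v) (u + v) ≤ 2 * E.form u u + 2 * E.form v v := by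
  have := E.nonneg _ (E.dom.sub_mem hu hv)
  rw [E.form_sub_self hu hv] at this
  rw [E.form_add_self hu hv]; linarith

lemma form_const (c : ℝ) : E.form (fun _ => c) (fun _ => c) = 0 :=
  (E.eq_zero_iff _ (E.const_mem c)).2 ⟨c, rfl⟩

lemma form_const_right (c : ℝ) {u : X → ℝ} (hu : u ∈ E.dom) : E.form u (fun _ => c) = 0 := by
  have h := E.cauchy_schwarz hu (E.const_mem c)
  rw [E.form_const, mul_zero] at h
  exact pow_eq_zero_iff (n := 2) (by norm_num) |>.1 (le_antisymm h (sq_nonneg _))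

lemma form_sub_const (c : ℝ) {u : X → ℝ} (hu : u ∈ E.dom) :
    E.form (u - fun _ => c) (u - fun _ => c) = E.form u u := by
  rw [E.form_sub_self hu (E.const_mem c), E.form_const, E.form_const_right c hu]; ring

lemma exists_resistance_bound (p q : X) :
    ∃ R : ℝ, 0 ≤ R ∧ ∀ u ∈ E.dom, (u p - u q) ^ 2 ≤ R * E.form u u := by
  obtain ⟨R, hR⟩ := E.resistance_bdd p q
  refine ⟨max R 0, le_max_right _ _, fun u hu => ?_⟩
  rcases (E.nonneg u hu).eq_or_lt with h0 | h0
  · obtain ⟨c, rfl⟩ := (E.eq_zero_iff u hu).1 h0.symm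
    simp [← h0]
  · have := hR ⟨u, hu, h0, rfl⟩
    rw [div_le_iff₀ h0] at this
    exact this.trans (mul_le_mul_of_nonneg_right (le_max_left _ _) h0.le)

/-- Energy convergence of functions with a common value at one point implies pointwise
convergence. -/
lemma tendsto_apply_of_form {u : ℕ → X → ℝ} {v : X → ℝ} (p : X) (hu : ∀ n, u n ∈ E.dom)
    (hv : v ∈ E.dom) (h : Tendsto (fun n => E.form (u n - v) (u n - v)) atTop (𝓝 0)) (x : X)
    (hp : Tendsto (fun n => u n p) atTop (𝓝 (v p))) :
    Tendsto (fun n => u n x) atTop (𝓝 (v x)) := by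
  obtain ⟨R, -, hR⟩ := E.exists_resistance_bound x p
  have h1 : Tendsto (fun n => ((u n - v) x - (u n - v) p) ^ 2) atTop (𝓝 0) := by
    refine squeeze_zero (fun n => sq_nonneg _) (fun n => hR _ (E.dom.sub_mem (hu n) hv)) ?_
    simpa using h.const_mul R
  have h2 : Tendsto (fun n => (u n - v) x - (u n - v) p) atTop (𝓝 0) := by
    have h3 := h1.sqrt
    simp only [Real.sqrt_sq_eq_abs, Real.sqrt_zero] at h3
    exact tendsto_zero_iff_abs_tendsto_zero _ |>.2 h3
  have := (h2.add hp).add_const (v x - v p)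
  simp only [Pi.sub_apply, zero_add] at this
  convert this using 2 <;> ring

lemma tendsto_form_self {u : ℕ → X → ℝ} {v : X → ℝ} (hu : ∀ n, u n ∈ E.dom)
    (hv : v ∈ E.dom) (h : Tendsto (fun n => E.form (u n - v) (u n - v)) atTop (𝓝 0))
    {w : X → ℝ} (hw : w ∈ E.dom) : Tendsto (fun n => E.form w (u n)) atTop (𝓝 (E.form w v)) := by
  rw [← tendsto_sub_nhds_zero_iff]
  refine squeeze_zero_norm (a := fun n => √(E.form w w) * √(E.form (u n - v) (u n - v)))
    (fun n => ?_) ?_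
  · rw [← E.sub_right hw (hu n) hv]
    exact E.abs_form_le hw (E.dom.sub_mem (hu n) hv)
  · simpa using h.sqrt.const_mul (√(E.form w w))

/-- Functions of finite energy that vanish on `U`. -/
def vanishing (U : Finset X) : Submodule ℝ (X → ℝ) where
  carrier := {g | g ∈ E.dom ∧ ∀ x ∈ U, g x = 0}
  add_mem' := fun ha hb => ⟨E.dom.add_mem ha.1 hb.1, fun x hx => by simp [ha.2 x hx, hb.2 x hx]⟩
  zero_mem' := ⟨E.dom.zero_mem, fun _ _ => rfl⟩
  smul_mem' := fun c u hu => ⟨E.dom.smul_mem c hu.1, fun x hx => by simp [hu.2 x hx]⟩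

/-- The space of functions of finite energy that vanish on `U`, without the topology of pointwise
convergence. -/
def VanishingSpace (U : Finset X) : Type _ := E.vanishing U

noncomputable instance (U : Finset X) : AddCommGroup (E.VanishingSpace U) :=
  inferInstanceAs (AddCommGroup (E.vanishing U))

noncomputable instance (U : Finset X) : Module ℝ (E.VanishingSpace U) :=
  inferInstanceAs (Module ℝ (E.vanishing U))

lemma exists_orthogonal_extension {U : Finset X} (hU : U.Nonempty) (w : X → ℝ) :
    ∃ u ∈ E.dom, (∀ x ∈ U, u x = w x) ∧
      ∀ g ∈ E.dom, (∀ x ∈ U, g x = 0) → E.form u g = 0 := by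
  obtain ⟨p, hp⟩ := hU
  let N := E.VanishingSpace U
  let core : InnerProductSpace.Core ℝ N :=
    { inner := fun u v => E.form u.1 v.1
      conj_inner_symm := fun u v => E.symm v.1 v.2.1 u.1 u.2.1
      re_inner_nonneg := fun u => E.nonneg u.1 u.2.1
      add_left := fun u v w => E.add_left u.1 u.2.1 v.1 v.2.1 w.1 w.2.1
      smul_left := fun u v r => E.smul_left r u.1 u.2.1 v.1 v.2.1
      definite := fun u hu => by
        obtain ⟨c, hc⟩ := (E.eq_zero_iff u.1 u.2.1).1 hu
        have h0 := u.2.2 p hp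
        rw [hc] at h0
        refine Subtype.ext (hc.trans (funext fun x => h0)) }
  let : NormedAddCommGroup N := core.toNormedAddCommGroup
  let : InnerProductSpace ℝ N := InnerProductSpace.ofCore core.toCore
  have hnorm : ∀ u : N, ‖u‖ ^ 2 = E.form u.1 u.1 := fun u => by
    rw [← real_inner_self_eq_norm_sq]; rfl
  have : CompleteSpace N := by
    refine Metric.complete_of_cauchySeq_tendsto fun s hs => ?_
    obtain ⟨v, hv, hlim⟩ := E.complete (fun n => (s n).1) (fun n => (s n).2.1) (by
      intro ε hε
      obtain ⟨M, hM⟩ := Metric.cauchySeq_iff.1 hs (√ε) (Real.sqrt_pos.2 hε)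
      refine ⟨M, fun m hm n hn => ?_⟩
      have h1 := hM m hm n hn
      rw [dist_eq_norm] at h1
      have h2 : ‖s m - s n‖ ^ 2 < ε := by
        rw [← Real.sq_sqrt hε.le]
        exact pow_lt_pow_left₀ h1 (norm_nonneg _) two_ne_zero
      rw [hnorm] at h2
      exact h2)
    have hv' : (v - fun _ => v p) ∈ E.dom := E.dom.sub_mem hv (E.const_mem _)
    have hlim' : Tendsto (fun n => E.form ((s n).1 - (v - fun _ => v p))
        ((s n).1 - (v - fun _ => v p))) atTop (𝓝 0) := by
      refine hlim.congr fun n => ?_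
      rw [show ((s n).1 : X → ℝ) - (v - fun _ => v p) = ((s n).1 - v) - fun _ => - v p by
        ext x; simp only [Pi.sub_apply]; ring, E.form_sub_const _ (E.dom.sub_mem (s n).2.1 hv)]
    have hmem : (v - fun _ => v p) ∈ E.vanishing U := by
      refine ⟨hv', fun x hx => ?_⟩
      refine tendsto_nhds_unique
        (E.tendsto_apply_of_form p (fun n => (s n).2.1) hv' hlim' x ?_) ?_
      · simp [(s _).2.2 p hp]
      · simp [(s _).2.2 x hx]
    let v' : N := ⟨_, hmem⟩
    refine ⟨v', ?_⟩
    rw [tendsto_iff_norm_sub_tendsto_zero]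
    have := hlim'.sqrt
    rw [Real.sqrt_zero] at this
    refine this.congr fun n => ?_
    rw [← Real.sqrt_sq (norm_nonneg (s n - v')), hnorm]
    rfl
  obtain ⟨u0, hu0, huw⟩ := E.exists_extension U w
  let φ : N →ₗ[ℝ] ℝ :=
    { toFun := fun g => E.form u0 g.1
      map_add' := fun a b => E.add_right hu0 a.2.1 b.2.1
      map_smul' := fun c a => E.smul_right c hu0 a.2.1 }
  let Φ : N →L[ℝ] ℝ := φ.mkContinuous (√(E.form u0 u0)) fun g => by
    have := E.abs_form_le hu0 g.2.1
    rw [← hnorm, Real.sqrt_sq (norm_nonneg g)] at this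
    exact this
  let n := (InnerProductSpace.toDual ℝ N).symm Φ
  have hn : ∀ g : N, E.form n.1 g.1 = E.form u0 g.1 := fun g =>
    InnerProductSpace.toDual_symm_apply (𝕜 := ℝ) (x := g) (y := Φ)
  refine ⟨u0 - n.1, E.dom.sub_mem hu0 n.2.1, fun x hx => by simp [huw x hx, n.2.2 x hx],
    fun g hg hg0 => ?_⟩
  rw [E.sub_left hu0 n.2.1 hg, hn ⟨g, hg, hg0⟩, sub_self]

open scoped Classical in
/-- The function of minimal energy with the values of `w` on `U`. -/
noncomputable def ext (U : Finset X) (w : X → ℝ) : X → ℝ :=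
  if hU : U.Nonempty then (E.exists_orthogonal_extension hU w).choose else 0

variable {E} {U : Finset X}

lemma ext_mem (U : Finset X) (w : X → ℝ) : E.ext U w ∈ E.dom := by
  unfold ext
  split_ifs with hU
  · exact (E.exists_orthogonal_extension hU w).choose_spec.1
  · exact E.dom.zero_mem

lemma ext_apply (w : X → ℝ) {x : X} (hx : x ∈ U) : E.ext U w x = w x := by
  have hU : U.Nonempty := ⟨x, hx⟩
  simp only [ext, dif_pos hU]
  exact (E.exists_orthogonal_extension hU w).choose_spec.2.1 x hx

lemma ext_orth (w : X → ℝ) {g : X → ℝ} (hg : g ∈ E.dom) (h0 : ∀ x ∈ U, g x = 0) :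
    E.form (E.ext U w) g = 0 := by
  by_cases hU : U.Nonempty
  · simp only [ext, dif_pos hU]
    exact (E.exists_orthogonal_extension hU w).choose_spec.2.2 g hg h0
  · simp only [ext, dif_neg hU]
    simpa using E.smul_left 0 g hg g hg

lemma eq_ext (hU : U.Nonempty) {u w : X → ℝ} (hu : u ∈ E.dom) (huw : ∀ x ∈ U, u x = w x)
    (horth : ∀ g ∈ E.dom, (∀ x ∈ U, g x = 0) → E.form u g = 0) : u = E.ext U w := by
  have hd : u - E.ext U w ∈ E.dom := E.dom.sub_mem hu (ext_mem U w)
  have h0 : ∀ x ∈ U, (u - E.ext U w) x = 0 := fun x hx => by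
    simp [huw x hx, ext_apply w hx]
  have h1 : E.form (u - E.ext U w) (u - E.ext U w) = 0 := by
    rw [E.sub_left hu (ext_mem U w) hd, horth _ hd h0, ext_orth w hd h0, sub_zero]
  obtain ⟨c, hc⟩ := (E.eq_zero_iff _ hd).1 h1
  obtain ⟨p, hp⟩ := hU
  have hc0 : c = 0 := by rw [← h0 p hp, hc]
  ext x
  have := congrFun hc x
  simp only [Pi.sub_apply, hc0] at this
  linarith

lemma ext_congr {w w' : X → ℝ} (h : ∀ x ∈ U, w x = w' x) : E.ext U w = E.ext U w' := by
  by_cases hU : U.Nonempty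
  · exact eq_ext hU (ext_mem U w) (fun x hx => by rw [ext_apply w hx, h x hx])
      fun g hg h0 => ext_orth w hg h0
  · simp [ext, dif_neg hU]

lemma ext_add (u v : X → ℝ) : E.ext U (u + v) = E.ext U u + E.ext U v := by
  by_cases hU : U.Nonempty
  · refine (eq_ext hU (E.dom.add_mem (ext_mem U u) (ext_mem U v))
      (fun x hx => by simp [ext_apply _ hx]) fun g hg h0 => ?_).symm
    rw [E.add_left _ (ext_mem U u) _ (ext_mem U v) _ hg, ext_orth u hg h0, ext_orth v hg h0,
      add_zero]
  · simp [ext, dif_neg hU]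

lemma ext_smul (c : ℝ) (u : X → ℝ) : E.ext U (c • u) = c • E.ext U u := by
  by_cases hU : U.Nonempty
  · refine (eq_ext hU (E.dom.smul_mem c (ext_mem U u))
      (fun x hx => by simp [ext_apply _ hx]) fun g hg h0 => ?_).symm
    rw [E.smul_left _ _ (ext_mem U u) _ hg, ext_orth u hg h0, mul_zero]
  · simp [ext, dif_neg hU]

variable (E U) in
/-- The minimal energy extension as a linear map. -/
noncomputable def extₗ : (X → ℝ) →ₗ[ℝ] (X → ℝ) where
  toFun := E.ext U
  map_add' := ext_add
  map_smul' := ext_smul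

lemma extₗ_apply (u : X → ℝ) : E.extₗ U u = E.ext U u := rfl

lemma ext_sub (u v : X → ℝ) : E.ext U (u - v) = E.ext U u - E.ext U v :=
  (E.extₗ U).map_sub u v

lemma ext_const (hU : U.Nonempty) (c : ℝ) : E.ext U (fun _ => c) = fun _ => c :=
  (eq_ext hU (E.const_mem c) (fun _ _ => rfl) fun g hg _ => by
    rw [E.symm _ (E.const_mem c) g hg, E.form_const_right c hg]).symm

lemma form_ext_right (w : X → ℝ) {g : X → ℝ} (hg : g ∈ E.dom) :
    E.form (E.ext U w) (E.ext U g) = E.form (E.ext U w) g := by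
  have h := ext_orth (E := E) (U := U) w (E.dom.sub_mem (ext_mem U g) hg)
    (fun x hx => by simp [ext_apply g hx])
  rw [E.sub_right (ext_mem U w) (ext_mem U g) hg] at h
  linarith

lemma form_ext_le {w g : X → ℝ} (hg : g ∈ E.dom) (h : ∀ x ∈ U, g x = w x) :
    E.form (E.ext U w) (E.ext U w) ≤ E.form g g := by
  have h1 : g = E.ext U w + (g - E.ext U w) := by abel
  have hd := E.dom.sub_mem hg (ext_mem (E := E) U w)
  have h2 := E.form_add_self (ext_mem (E := E) U w) hd
  rw [← h1, ext_orth w hd (fun x hx => by simp [h x hx, ext_apply w hx])] at h2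
  linarith [E.nonneg _ hd]

lemma form_sub_ext {g : X → ℝ} (hg : g ∈ E.dom) :
    E.form (g - E.ext U g) (g - E.ext U g) = E.form g g - E.form (E.ext U g) (E.ext U g) := by
  rw [E.form_sub_self hg (ext_mem U g), E.symm _ hg _ (ext_mem U g), form_ext_right g hg |>.symm]
  ring

lemma trace_eq (w : X → ℝ) : E.trace U w = E.form (E.ext U w) (E.ext U w) := by
  refine IsLeast.csInf_eq ⟨⟨_, ext_mem U w, fun x hx => ext_apply w hx, rfl⟩, ?_⟩
  rintro e ⟨g, hg, hgw, rfl⟩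
  exact form_ext_le hg hgw

lemma ext_eq_self_iff (hU : U.Nonempty) {u : X → ℝ} :
    E.ext U u = u ↔ u ∈ E.dom ∧ ∀ g ∈ E.dom, (∀ v ∈ U, g v = u v) → E.form u u ≤ E.form g g := by
  constructor
  · intro h
    refine ⟨h ▸ ext_mem U u, fun g hg hgu => ?_⟩
    have := form_ext_le (U := U) hg hgu
    rwa [h] at this
  · rintro ⟨hu, hmin⟩
    have h1 := hmin _ (ext_mem U u) (fun x hx => ext_apply u hx)
    have h2 := form_sub_ext (U := U) hu
    have hd := E.dom.sub_mem hu (ext_mem (E := E) U u)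
    obtain ⟨c, hc⟩ := (E.eq_zero_iff _ hd).1 (le_antisymm (by linarith) (E.nonneg _ hd))
    obtain ⟨p, hp⟩ := hU
    have hc0 : c = 0 := by
      have := congrFun hc p
      simp only [Pi.sub_apply, ext_apply u hp, sub_self] at this
      exact this.symm
    ext x
    have := congrFun hc x
    simp only [Pi.sub_apply, hc0] at this
    linarith

lemma ext_ext_of_subset {U W : Finset X} (hU : U.Nonempty) (hUW : U ⊆ W) (u : X → ℝ) :
    E.ext W (E.ext U u) = E.ext U u := by
  rw [ext_eq_self_iff (hU.mono hUW)]
  refine ⟨ext_mem U u, fun g hg h => form_ext_le hg fun x hx => ?_⟩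
  rw [h x (hUW hx), ext_apply u hx]

end Basic

end ResistanceForm

lemma Finset.sum_mul_sub_mul_sub {X : Type*} (s : Finset X) (q : X → X → ℝ)
    (hsymm : ∀ x ∈ s, ∀ y ∈ s, q x y = q y x) (hrow : ∀ x ∈ s, ∑ y ∈ s, q x y = 0)
    (u v : X → ℝ) :
    ∑ x ∈ s, ∑ y ∈ s, q x y * (u x - u y) * (v x - v y)
      = -2 * ∑ x ∈ s, ∑ y ∈ s, u x * v y * q x y := by
  have h1 : ∑ x ∈ s, ∑ y ∈ s, q x y * (u x * v x) = 0 :=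
    Finset.sum_eq_zero fun x hx => by rw [← Finset.sum_mul, hrow x hx, zero_mul]
  have h2 : ∑ x ∈ s, ∑ y ∈ s, q x y * (u y * v y) = 0 := by
    rw [Finset.sum_comm, ← h1]
    exact Finset.sum_congr rfl fun x hx => Finset.sum_congr rfl fun y hy => by
      rw [hsymm x hx y hy]
  have h3 : ∑ x ∈ s, ∑ y ∈ s, q x y * (u y * v x) = ∑ x ∈ s, ∑ y ∈ s, u x * v y * q x y := by
    rw [Finset.sum_comm]
    exact Finset.sum_congr rfl fun x hx => Finset.sum_congr rfl fun y hy => by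
      rw [hsymm x hx y hy]; ring
  have h4 : ∑ x ∈ s, ∑ y ∈ s, q x y * (u x * v y) = ∑ x ∈ s, ∑ y ∈ s, u x * v y * q x y :=
    Finset.sum_congr rfl fun x hx => Finset.sum_congr rfl fun y hy => by ring
  calc _ = ∑ x ∈ s, ∑ y ∈ s, (q x y * (u x * v x) + q x y * (u y * v y)
        - q x y * (u y * v x) - q x y * (u x * v y)) :=
        Finset.sum_congr rfl fun x _ => Finset.sum_congr rfl fun y _ => by ring
    _ = _ := by
      simp only [Finset.sum_sub_distrib, Finset.sum_add_distrib]
      rw [h1, h2, h3, h4]; ring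

namespace ResistanceForm

section Trace

variable {X : Type*} {E : ResistanceForm X} {U : Finset X}

open scoped Classical in
/-- The indicator function of a point. -/
noncomputable def delta (x : X) : X → ℝ := Pi.single x 1

lemma single_eq_delta {_ : DecidableEq X} (x : X) : Pi.single x (1 : ℝ) = delta x := by
  unfold delta; congr!

lemma delta_self (x : X) : delta x x = 1 := by
  classical exact Pi.single_eq_same x 1

lemma delta_of_ne {x y : X} (h : y ≠ x) : delta x y = 0 := by
  classical exact Pi.single_eq_of_ne h 1

lemma sum_smul_delta (s : Finset X) (u : X → ℝ) {x : X} (hx : x ∈ s) :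
    (∑ y ∈ s, u y • delta y) x = u x := by
  classical
  simp [← single_eq_delta, Finset.sum_apply, Pi.single_apply, hx]

lemma conductance_eq (x y : X) :
    E.conductance U x y = - E.form (E.ext U (delta x)) (E.ext U (delta y)) := by
  simp only [conductance, trace_eq, single_eq_delta]
  rw [ext_add, E.form_add_self (ext_mem _ _) (ext_mem _ _)]
  ring

lemma conductance_comm (x y : X) : E.conductance U x y = E.conductance U y x := by
  rw [conductance_eq, conductance_eq, E.symm _ (ext_mem _ _) _ (ext_mem _ _)]

lemma conductance_nonneg {x y : X} (hx : x ∈ U) (hxy : x ≠ y) :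
    0 ≤ E.conductance U x y := by
  rw [conductance_eq, Left.nonneg_neg_iff]
  set a := E.ext U (delta x) with ha
  set b := E.ext U (delta y) with hb
  have ham : a ∈ E.dom := ext_mem _ _
  have hbm : b ∈ E.dom := ext_mem _ _
  have key : ∀ t : ℝ, 0 < t → 2 * E.form a b ≤ t * E.form b b := by
    intro t ht
    have hd := E.dom.sub_mem ham (E.dom.smul_mem t hbm)
    obtain ⟨h1, h2⟩ := E.markov _ hd
    have h3 : E.form a a ≤ _ := form_ext_le h1 (w := delta x) (fun z hz => by
      simp only [Pi.sub_apply, Pi.smul_apply, smul_eq_mul, ha, hb, ext_apply _ hz]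
      by_cases hzx : z = x
      · subst hzx
        rw [delta_self, delta_of_ne hxy]; simp
      · rw [delta_of_ne hzx]
        by_cases hzy : z = y
        · subst hzy; rw [delta_self]
          simp [ht.le]
        · rw [delta_of_ne hzy]; simp)
    have h4 := h3.trans h2
    rw [E.form_sub_self ham (E.dom.smul_mem t hbm), E.smul_right t ham hbm,
      E.form_smul_self t hbm] at h4
    have : t * (2 * E.form a b) ≤ t * (t * E.form b b) := by nlinarith
    exact le_of_mul_le_mul_left this ht
  by_contra! hpos
  have hb0 := E.nonneg b hbm
  have := key (E.form a b / (E.form b b + 1)) (by positivity)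
  rw [div_mul_eq_mul_div, le_div_iff₀ (by positivity)] at this
  nlinarith

variable (E U) in
/-- The trace form `(1/2) ∑_{x,y ∈ U} c_{U,x,y} (u x - u y) (v x - v y)`. -/
noncomputable def disc (u v : X → ℝ) : ℝ :=
  (∑ x ∈ U, ∑ y ∈ U, E.conductance U x y * (u x - u y) * (v x - v y)) / 2

lemma ext_eq_sum (u : X → ℝ) :
    E.ext U u = ∑ x ∈ U, u x • E.ext U (delta x) := by
  have h : E.ext U u = E.extₗ U (∑ x ∈ U, u x • delta x) := by
    refine ext_congr fun x hx => ?_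
    exact (sum_smul_delta U u hx).symm
  rw [h, map_sum]
  exact Finset.sum_congr rfl fun x _ => (E.extₗ U).map_smul _ _

lemma form_ext_eq_sum (u v : X → ℝ) :
    E.form (E.ext U u) (E.ext U v) = ∑ x ∈ U, ∑ y ∈ U, u x * v y *
      E.form (E.ext U (delta x)) (E.ext U (delta y)) := by
  conv_lhs => rw [ext_eq_sum u]
  rw [E.sum_left _ _ _ (fun _ _ => ext_mem _ _) (ext_mem _ _)]
  refine Finset.sum_congr rfl fun x _ => ?_
  rw [E.symm _ (ext_mem _ _) _ (ext_mem _ _), ext_eq_sum v,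
    E.sum_left _ _ _ (fun _ _ => ext_mem _ _) (ext_mem _ _), Finset.mul_sum]
  refine Finset.sum_congr rfl fun y _ => ?_
  rw [E.symm _ (ext_mem _ _) _ (ext_mem _ _)]; ring

lemma disc_eq (hU : U.Nonempty) (u v : X → ℝ) :
    E.disc U u v = E.form (E.ext U u) (E.ext U v) := by
  rw [disc, Finset.sum_mul_sub_mul_sub U _ (fun x _ y _ => conductance_comm x y),
    form_ext_eq_sum]
  · simp only [conductance_eq, mul_neg, Finset.sum_neg_distrib]
    ring
  · intro x hx
    have h1 : E.form (E.ext U (fun _ => 1)) (E.ext U (delta x)) = 0 := by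
      rw [ext_const hU, E.symm _ (E.const_mem _) _ (ext_mem _ _),
        E.form_const_right _ (ext_mem _ _)]
    rw [ext_eq_sum, E.sum_left _ _ _ (fun _ _ => ext_mem _ _) (ext_mem _ _)] at h1
    simp only [conductance_comm x, conductance_eq, Finset.sum_neg_distrib]
    simp only [one_mul] at h1
    rw [neg_eq_zero]
    exact h1

lemma conductance_mul_nonneg {x y : X} (hx : x ∈ U) {a : ℝ} (ha : 0 ≤ a) (h0 : x = y → a = 0) :
    0 ≤ E.conductance U x y * a := by
  by_cases hxy : x = y
  · simp [h0 hxy]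
  · exact mul_nonneg (conductance_nonneg hx hxy) ha

lemma disc_self_eq_sum (u : X → ℝ) :
    E.disc U u u = (∑ x ∈ U, ∑ y ∈ U, E.conductance U x y * (u x - u y) ^ 2) / 2 := by
  simp only [disc, sq, mul_assoc]

lemma sum_edges_le_sum {W : Finset X} (hW : W ⊆ U) {ι : Type*} (s : Finset ι) {C : ι → ℝ}
    {u : X → ℝ} {v : ι → X → ℝ}
    (h : ∀ x ∈ W, ∀ y ∈ W, (u x - u y) ^ 2 ≤ ∑ i ∈ s, C i * (v i x - v i y) ^ 2) :
    (∑ x ∈ W, ∑ y ∈ W, E.conductance U x y * (u x - u y) ^ 2) / 2 ≤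
      ∑ i ∈ s, C i * ((∑ x ∈ W, ∑ y ∈ W, E.conductance U x y * (v i x - v i y) ^ 2) / 2) := by
  calc (∑ x ∈ W, ∑ y ∈ W, E.conductance U x y * (u x - u y) ^ 2) / 2
      ≤ (∑ x ∈ W, ∑ y ∈ W, E.conductance U x y * ∑ i ∈ s, C i * (v i x - v i y) ^ 2) / 2 := by
        gcongr ?_ / 2
        refine Finset.sum_le_sum fun x hx => Finset.sum_le_sum fun y hy => ?_
        have := conductance_mul_nonneg (E := E) (hW hx) (y := y) (sub_nonneg.2 (h x hx y hy))
          (fun h => by simp [h])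
        rw [mul_sub] at this
        linarith
    _ = _ := by
        simp only [Finset.mul_sum, mul_div_assoc', ← Finset.sum_div]
        congr 1
        rw [Finset.sum_congr rfl fun x _ => Finset.sum_comm, Finset.sum_comm]
        exact Finset.sum_congr rfl fun i _ => Finset.sum_congr rfl fun x _ =>
          Finset.sum_congr rfl fun y _ => by ring

lemma disc_self_le_sum {ι : Type*} (s : Finset ι) {C : ι → ℝ} {u : X → ℝ} {v : ι → X → ℝ}
    (h : ∀ x ∈ U, ∀ y ∈ U, (u x - u y) ^ 2 ≤ ∑ i ∈ s, C i * (v i x - v i y) ^ 2) :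
    E.disc U u u ≤ ∑ i ∈ s, C i * E.disc U (v i) (v i) := by
  simp only [disc_self_eq_sum]
  exact sum_edges_le_sum subset_rfl s h

lemma disc_self_le_form (hU : U.Nonempty) {u : X → ℝ} (hu : u ∈ E.dom) :
    E.disc U u u ≤ E.form u u := by
  rw [disc_eq hU]; exact form_ext_le hu fun _ _ => rfl

/-- An increasing sequence of nonempty finite sets that exhausts `X`. -/
structure Exhausts (U : ℕ → Finset X) : Prop where
  mono : Monotone U
  nonempty : ∀ n, (U n).Nonempty
  exhaust : ∀ x, ∃ n, x ∈ U n

variable {V : ℕ → Finset X}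

lemma disc_mono (hV : Exhausts V) (u : X → ℝ) : Monotone fun k => E.disc (V k) u u := by
  intro j k hjk
  simp only [disc_eq (hV.nonempty _)]
  exact form_ext_le (ext_mem _ _) fun x hx => ext_apply u (hV.mono hjk hx)

lemma mem_dom_of_bounded (hV : Exhausts V) {u : X → ℝ} {C : ℝ}
    (hC : ∀ k, E.disc (V k) u u ≤ C) :
    u ∈ E.dom ∧ Tendsto (fun k => E.form (E.ext (V k) u - u) (E.ext (V k) u - u)) atTop (𝓝 0) := by
  have hbdd : BddAbove (Set.range fun k => E.disc (V k) u u) :=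
    ⟨C, by rintro _ ⟨k, rfl⟩; exact hC k⟩
  have hcauchy := (tendsto_atTop_ciSup (disc_mono hV u) hbdd).cauchySeq
  have hdiff : ∀ j k, j ≤ k → E.form (E.ext (V k) u - E.ext (V j) u)
      (E.ext (V k) u - E.ext (V j) u) = E.disc (V k) u u - E.disc (V j) u u := by
    intro j k hjk
    have h := form_sub_ext (U := V j) (ext_mem (E := E) (V k) u)
    rw [ext_congr (fun x hx => ext_apply u (hV.mono hjk hx))] at h
    rw [h, disc_eq (hV.nonempty _), disc_eq (hV.nonempty _)]
  obtain ⟨v, hv, hlim⟩ := E.complete (fun k => E.ext (V k) u) (fun k => ext_mem _ _) (by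
    intro ε hε
    obtain ⟨N, hN⟩ := Metric.cauchySeq_iff.1 hcauchy ε hε
    refine ⟨N, fun m hm n hn => ?_⟩
    have h1 := hN m hm n hn
    rw [Real.dist_eq] at h1
    rcases le_total n m with h | h
    · rw [hdiff n m h]; exact (le_abs_self _).trans_lt h1
    · rw [E.form_sub_comm (ext_mem _ _) (ext_mem _ _), hdiff m n h]
      rw [abs_sub_comm] at h1; exact (le_abs_self _).trans_lt h1)
  obtain ⟨p, hp⟩ := hV.nonempty 0
  have hv' : (v - fun _ => v p - u p) ∈ E.dom := E.dom.sub_mem hv (E.const_mem _)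
  have hlim' : Tendsto (fun n => E.form (E.ext (V n) u - (v - fun _ => v p - u p))
      (E.ext (V n) u - (v - fun _ => v p - u p))) atTop (𝓝 0) := by
    refine hlim.congr fun n => ?_
    rw [show E.ext (V n) u - (v - fun _ => v p - u p)
        = (E.ext (V n) u - v) - fun _ => - (v p - u p) by
      ext x; simp only [Pi.sub_apply]; ring,
      E.form_sub_const _ (E.dom.sub_mem (ext_mem _ _) hv)]
  have hev : ∀ x, ∀ᶠ n in atTop, E.ext (V n) u x = u x := fun x => by
    obtain ⟨k, hk⟩ := hV.exhaust x
    filter_upwards [eventually_ge_atTop k] with n hn using ext_apply u (hV.mono hn hk)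
  have huv : (v - fun _ => v p - u p) = u := by
    ext x
    refine tendsto_nhds_unique (E.tendsto_apply_of_form p (fun n => ext_mem _ _) hv' hlim' x ?_)
      (tendsto_const_nhds.congr' ((hev x).mono fun n hn => hn.symm))
    refine tendsto_const_nhds.congr' ((hev p).mono fun n hn => ?_)
    simp only [hn, Pi.sub_apply]; ring
  rw [huv] at hv' hlim'
  exact ⟨hv', hlim'⟩

lemma tendsto_form_ext_sub (hV : Exhausts V) {u : X → ℝ} (hu : u ∈ E.dom) :
    Tendsto (fun k => E.form (E.ext (V k) u - u) (E.ext (V k) u - u)) atTop (𝓝 0) :=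
  (mem_dom_of_bounded hV (fun k => disc_self_le_form (hV.nonempty k) hu)).2

lemma tendsto_disc (hV : Exhausts V) {u v : X → ℝ} (hu : u ∈ E.dom) (hv : v ∈ E.dom) :
    Tendsto (fun k => E.disc (V k) u v) atTop (𝓝 (E.form u v)) := by
  have h := E.tendsto_form_self (fun k => ext_mem (V k) u) hu (tendsto_form_ext_sub hV hu) hv
  rw [E.symm _ hv _ hu] at h
  refine h.congr fun k => ?_
  rw [disc_eq (hV.nonempty k), form_ext_right _ hv, E.symm _ hv _ (ext_mem _ _)]

lemma form_le_of_disc_le (hV : Exhausts V) {u : X → ℝ} {C : ℝ}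
    (hC : ∀ k, E.disc (V k) u u ≤ C) : u ∈ E.dom ∧ E.form u u ≤ C := by
  have hu := (mem_dom_of_bounded hV hC).1
  exact ⟨hu, le_of_tendsto' (tendsto_disc hV hu hu) hC⟩

/-- Energy of a function whose increments are controlled by those of functions of finite energy. -/
lemma form_le_sum_of_increments (hV : Exhausts V) {ι : Type*} (s : Finset ι) {C : ι → ℝ}
    (hC : ∀ i ∈ s, 0 ≤ C i) {u : X → ℝ} {v : ι → X → ℝ} (hv : ∀ i ∈ s, v i ∈ E.dom)
    (h : ∀ x y, (u x - u y) ^ 2 ≤ ∑ i ∈ s, C i * (v i x - v i y) ^ 2) :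
    u ∈ E.dom ∧ E.form u u ≤ ∑ i ∈ s, C i * E.form (v i) (v i) :=
  form_le_of_disc_le hV fun k => (disc_self_le_sum s fun x _ y _ => h x y).trans <|
    Finset.sum_le_sum fun i hi => mul_le_mul_of_nonneg_left
      (disc_self_le_form (hV.nonempty k) (hv i hi)) (hC i hi)

lemma form_le_of_increments (hV : Exhausts V) {C : ℝ} (hC : 0 ≤ C) {u v : X → ℝ}
    (hv : v ∈ E.dom) (h : ∀ x y, (u x - u y) ^ 2 ≤ C * (v x - v y) ^ 2) :
    u ∈ E.dom ∧ E.form u u ≤ C * E.form v v := by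
  simpa using form_le_sum_of_increments (E := E) hV (Finset.univ : Finset Unit) (C := fun _ => C)
    (v := fun _ => v) (fun _ _ => hC) (fun _ _ => hv) (by simpa using h)

/-- Truncation of a real number to `[-δ, δ]`. -/
def clamp (δ t : ℝ) : ℝ := max (-δ) (min t δ)

lemma clamp_sub_sq_le (δ s t : ℝ) :
    (clamp δ s - clamp δ t) ^ 2 ≤ (clamp δ s - clamp δ t) * (s - t) := by
  have key : ∀ s t : ℝ, t ≤ s → (clamp δ s - clamp δ t) ^ 2 ≤ (clamp δ s - clamp δ t) * (s - t) := by
    intro s t hst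
    have h1 : 0 ≤ clamp δ s - clamp δ t := by
      unfold clamp
      have := max_le_max_left (-δ) (min_le_min_right δ hst)
      linarith
    have h2 : clamp δ s - clamp δ t ≤ s - t := by
      unfold clamp
      have h3 := max_sub_max_le_max (-δ) (min s δ) (-δ) (min t δ)
      have h4 : min s δ - min t δ ≤ s - t := by
        rcases min_cases s δ with h | h <;> rcases min_cases t δ with h' | h' <;> linarith
      rw [sub_self] at h3
      exact h3.trans (max_le (by linarith) h4)
    rw [sq]
    exact mul_le_mul_of_nonneg_left h2 h1
  rcases le_total t s with h | h
  · exact key s t h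
  · have := key t s h; nlinarith

lemma clamp_sub_sq_le_sq (δ s t : ℝ) : (clamp δ s - clamp δ t) ^ 2 ≤ 1 * (s - t) ^ 2 := by
  have := clamp_sub_sq_le δ s t
  nlinarith [sq_nonneg (clamp δ s - clamp δ t - (s - t))]

lemma abs_clamp_le {δ : ℝ} (hδ : 0 ≤ δ) (t : ℝ) : |clamp δ t| ≤ δ := by
  unfold clamp
  rw [abs_le]
  exact ⟨le_max_left _ _, max_le (by linarith) (min_le_right _ _)⟩

lemma clamp_of_abs_le {δ t : ℝ} (h : |t| ≤ δ) : clamp δ t = t := by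
  rw [abs_le] at h
  unfold clamp
  rw [min_eq_left h.2, max_eq_right h.1]

lemma exists_form_clamp_lt (hV : Exhausts V) {u : X → ℝ} (hu : u ∈ E.dom) (c : ℝ) {ε : ℝ}
    (hε : 0 < ε) : ∃ δ₀ > 0, ∀ δ, 0 < δ → δ ≤ δ₀ →
      (fun x => clamp δ (u x - c)) ∈ E.dom ∧
        E.form (fun x => clamp δ (u x - c)) (fun x => clamp δ (u x - c)) < ε := by
  have h0 : Tendsto (fun k => √(E.form u u) * √(E.form (E.ext (V k) u - u) (E.ext (V k) u - u)))
      atTop (𝓝 0) := by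
    simpa using (tendsto_form_ext_sub hV hu).sqrt.const_mul (√(E.form u u))
  obtain ⟨k, hk⟩ := (h0.eventually (gt_mem_nhds (half_pos hε))).exists
  set M := ∑ x ∈ V k, ∑ y ∈ V k, |E.conductance (V k) x y| * |u x - u y| with hM
  have hM0 : 0 ≤ M := Finset.sum_nonneg fun x _ => Finset.sum_nonneg fun y _ => by positivity
  refine ⟨ε / (2 * (M + 1)), by positivity, fun δ hδ hδM => ?_⟩
  set v : X → ℝ := fun x => clamp δ (u x - c) with hv
  obtain ⟨hvm, hvE⟩ := form_le_of_increments (E := E) hV zero_le_one (u := v) hu fun x y => by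
    have := clamp_sub_sq_le_sq δ (u x - c) (u y - c)
    rwa [sub_sub_sub_cancel_right] at this
  rw [one_mul] at hvE
  refine ⟨hvm, ?_⟩
  have hle : E.form v v ≤ E.form v u := by
    refine le_of_tendsto_of_tendsto' (tendsto_disc hV hvm hvm) (tendsto_disc hV hvm hu) fun j => ?_
    simp only [disc]
    gcongr ?_ / 2
    refine Finset.sum_le_sum fun x hx => Finset.sum_le_sum fun y _ => ?_
    have h1 := clamp_sub_sq_le δ (u x - c) (u y - c)
    rw [sub_sub_sub_cancel_right] at h1
    have := conductance_mul_nonneg (E := E) hx (y := y) (sub_nonneg.2 h1)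
      (fun h => by simp [h])
    simp only [hv]
    nlinarith
  have hsplit : E.form v u = E.form v (E.ext (V k) u) - E.form v (E.ext (V k) u - u) := by
    rw [E.sub_right hvm (ext_mem _ _) hu]; ring
  have h1 : |E.form v (E.ext (V k) u - u)| < ε / 2 := by
    refine (E.abs_form_le hvm (E.dom.sub_mem (ext_mem _ _) hu)).trans_lt (lt_of_le_of_lt ?_ hk)
    gcongr
  have h2 : E.form v (E.ext (V k) u) ≤ δ * M := by
    rw [E.symm _ hvm _ (ext_mem _ _), ← form_ext_right _ hvm, ← disc_eq (hV.nonempty k), disc, hM,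
      Finset.mul_sum, Finset.sum_div]
    refine Finset.sum_le_sum fun x _ => ?_
    rw [Finset.mul_sum, Finset.sum_div]
    refine Finset.sum_le_sum fun y _ => ?_
    have h3 : |v x - v y| ≤ 2 * δ := by
      have := abs_sub (v x) (v y)
      have h4 := abs_clamp_le hδ.le (u x - c)
      have h5 := abs_clamp_le hδ.le (u y - c)
      simp only [hv] at this ⊢
      linarith
    have h6 : E.conductance (V k) x y * (u x - u y) * (v x - v y)
        ≤ |E.conductance (V k) x y| * |u x - u y| * (2 * δ) := by
      refine (le_abs_self _).trans ?_
      rw [abs_mul, abs_mul]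
      gcongr
    linarith
  have h3 : δ * M ≤ ε / 2 := by
    rw [le_div_iff₀ (by positivity)] at hδM
    nlinarith
  have := abs_lt.1 h1
  linarith

end Trace

end ResistanceForm

namespace FinitelyRamified

section Combinatorics

variable {F : Type*} [MetricSpace F] [CompactSpace F] {A : Type*} (S : FinitelyRamified F A)
  {n m k : ℕ} {α β γ : A}

lemma cell_infinite (α : A) : (S.cell α).Infinite := by
  refine (S.cell_connected α).isPreconnected.infinite_of_nontrivial ?_
  obtain ⟨x, hx, y, hy, hxy⟩ := Finset.one_lt_card.1 (S.two_le_card_vert α)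
  exact ⟨x, S.vert_subset α hx, y, S.vert_subset α hy, hxy⟩

variable {S}

lemma inter_finite (hα : α ∈ S.lvl n) (hβ : β ∈ S.lvl n) (h : α ≠ β) :
    (S.cell α ∩ S.cell β).Finite := by
  rw [S.inter n α hα β hβ h]
  exact (S.vert α).finite_toSet.inter_of_left _

lemma eq_of_subset (hα : α ∈ S.lvl n) (hβ : β ∈ S.lvl n) (hγα : S.cell γ ⊆ S.cell α)
    (hγβ : S.cell γ ⊆ S.cell β) : α = β := by
  by_contra h
  exact S.cell_infinite γ ((inter_finite hα hβ h).subset (Set.subset_inter hγα hγβ))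

lemma exists_child (hα : α ∈ S.lvl n) {x : F} (hx : x ∈ S.cell α) :
    ∃ β ∈ S.lvl (n + 1), S.cell β ⊂ S.cell α ∧ x ∈ S.cell β := by
  obtain ⟨s, hs, h⟩ := S.subdivide n α hα
  rw [h] at hx
  obtain ⟨β, hβ, hxβ⟩ := Set.mem_iUnion₂.1 hx
  refine ⟨β, hs hβ, LE.le.ssubset_of_ne ?_ ?_, hxβ⟩
  · rw [h]; exact Set.subset_biUnion_of_mem (u := S.cell) hβ
  · intro he
    have := S.cell_injective he
    subst this
    exact Finset.disjoint_left.1 (S.lvl_disjoint n (n + 1) (by omega)) hα (hs hβ)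

lemma exists_descendant (hα : α ∈ S.lvl n) (hnm : n ≤ m) {x : F} (hx : x ∈ S.cell α) :
    ∃ β ∈ S.lvl m, S.cell β ⊆ S.cell α ∧ x ∈ S.cell β := by
  induction m, hnm using Nat.le_induction with
  | base => exact ⟨α, hα, subset_rfl, hx⟩
  | succ m _ ih =>
    obtain ⟨β, hβ, hβα, hxβ⟩ := ih
    obtain ⟨γ, hγ, hγβ, hxγ⟩ := exists_child hβ hxβ
    exact ⟨γ, hγ, hγβ.subset.trans hβα, hxγ⟩

variable (S) in
lemma root_mem : S.root ∈ S.lvl 0 := by simp [S.lvl_zero]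

variable (S) in
lemma exists_cell (n : ℕ) (x : F) : ∃ α ∈ S.lvl n, x ∈ S.cell α := by
  obtain ⟨β, hβ, -, hx⟩ := exists_descendant S.root_mem (Nat.zero_le n)
    (x := x) (by simp [S.cell_root])
  exact ⟨β, hβ, hx⟩

lemma exists_parent (hβ : β ∈ S.lvl m) (hnm : n ≤ m) :
    ∃ α ∈ S.lvl n, S.cell β ⊆ S.cell α := by
  by_contra! hcon
  refine S.cell_infinite β (Set.Finite.subset (s := ⋃ γ ∈ (S.lvl m : Set A) \ {β},
    S.cell β ∩ S.cell γ) ?_ fun x hx => ?_)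
  · refine ((S.lvl m).finite_toSet.sdiff).biUnion fun γ hγ => inter_finite hβ hγ.1 ?_
    exact fun h => hγ.2 h.symm
  · obtain ⟨α, hα, hxα⟩ := S.exists_cell n x
    obtain ⟨γ, hγ, hγα, hxγ⟩ := exists_descendant hα hnm hxα
    refine Set.mem_iUnion₂.2 ⟨γ, ⟨hγ, ?_⟩, hx, hxγ⟩
    rintro rfl
    exact hcon α hα hγα

lemma exists_between (hα : α ∈ S.lvl n) (hγ : γ ∈ S.lvl k) (h : S.cell γ ⊆ S.cell α)
    (hnm : n ≤ m) (hmk : m ≤ k) :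
    ∃ β ∈ S.lvl m, S.cell γ ⊆ S.cell β ∧ S.cell β ⊆ S.cell α := by
  obtain ⟨β, hβ, hγβ⟩ := exists_parent hγ hmk
  obtain ⟨α', hα', hβα'⟩ := exists_parent hβ hnm
  obtain rfl := eq_of_subset hα hα' h (hγβ.trans hβα')
  exact ⟨β, hβ, hγβ, hβα'⟩

@[simp] lemma mem_V {α : A} {x : S.Vstar} : x ∈ S.V α ↔ (x : F) ∈ S.vert α := by
  classical
  unfold V
  convert Finset.mem_subtype

lemma mem_Vlvl {x : S.Vstar} : x ∈ S.Vlvl n ↔ ∃ α ∈ S.lvl n, (x : F) ∈ S.vert α := by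
  simp [Vlvl]

lemma mem_Vstar {x : F} (hx : x ∈ S.vert α) : x ∈ S.Vstar :=
  Set.mem_iUnion.2 ⟨α, hx⟩

lemma V_subset_Vlvl (hα : α ∈ S.lvl n) : S.V α ⊆ S.Vlvl n := fun _ hx =>
  mem_Vlvl.2 ⟨α, hα, mem_V.1 hx⟩

lemma V_nonempty (α : A) : (S.V α).Nonempty := by
  have ⟨x, hx⟩ := Finset.card_pos.1 (by have := S.two_le_card_vert α; omega : 0 < (S.vert α).card)
  exact ⟨⟨x, mem_Vstar hx⟩, mem_V.2 hx⟩

lemma mem_V_of_mem_cell {x : S.Vstar} (hx : x ∈ S.Vlvl n) (hα : α ∈ S.lvl n)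
    (hxα : (x : F) ∈ S.cell α) : x ∈ S.V α := by
  obtain ⟨β, hβ, hxβ⟩ := mem_Vlvl.1 hx
  by_cases h : α = β
  · subst h; exact mem_V.2 hxβ
  · have : (x : F) ∈ S.cell α ∩ S.cell β := ⟨hxα, S.vert_subset β hxβ⟩
    rw [S.inter n α hα β hβ h] at this
    exact mem_V.2 this.1

lemma mem_Vlvl_of_mem_two {x : F} (hα : α ∈ S.lvl n) (hβ : β ∈ S.lvl n) (h : α ≠ β)
    (hxα : x ∈ S.cell α) (hxβ : x ∈ S.cell β) : x ∈ S.vert α := by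
  have : x ∈ S.cell α ∩ S.cell β := ⟨hxα, hxβ⟩
  rw [S.inter n α hα β hβ h] at this
  exact this.1

variable (S) in
lemma Vlvl_mono : Monotone S.Vlvl := by
  refine monotone_nat_of_le_succ fun n x hx => ?_
  obtain ⟨α, hα, hxα⟩ := mem_Vlvl.1 hx
  obtain ⟨s, hs, h⟩ := S.subdivide n α hα
  obtain ⟨β, hβ, hxβ⟩ := Set.mem_iUnion₂.1 (S.vert_subset_union α s h hxα)
  exact mem_Vlvl.2 ⟨β, hs hβ, hxβ⟩

variable (S) in
lemma V0_eq : S.V0 = S.Vlvl 0 := by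
  ext x; simp [mem_Vlvl, S.lvl_zero]

variable (S) in
lemma exhausts : ResistanceForm.Exhausts S.Vlvl where
  mono := S.Vlvl_mono
  nonempty := fun n => by
    have h := S.Vlvl_mono (Nat.zero_le n)
    rw [← V0_eq] at h
    exact (V_nonempty S.root).mono h
  exhaust := fun x => by
    obtain ⟨α, hα⟩ := Set.mem_iUnion.1 x.2
    obtain ⟨n, hn⟩ := S.lvl_exhaust α
    exact ⟨n, mem_Vlvl.2 ⟨α, hn, hα⟩⟩

lemma V0_subset (n : ℕ) : S.V0 ⊆ S.Vlvl n := S.V0_eq ▸ S.Vlvl_mono (Nat.zero_le n)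

variable (S) in
lemma exists_mesh_lt {ε : ℝ} (hε : 0 < ε) :
    ∃ N, ∀ n ≥ N, ∀ α ∈ S.lvl n, ∀ x ∈ S.cell α, ∀ y ∈ S.cell α, dist x y < ε := by
  let P : A → Prop := fun α => ∃ K, ∀ k ≥ K, ∀ β ∈ S.lvl k, S.cell β ⊆ S.cell α →
    ∀ x ∈ S.cell β, ∀ y ∈ S.cell β, dist x y < ε
  suffices hroot : P S.root by
    obtain ⟨K, hK⟩ := hroot
    exact ⟨K, fun n hn α hα => hK n hn α hα (by simp [S.cell_root])⟩
  by_contra hroot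
  have step : ∀ α : {α // ¬ P α}, ∃ β : {α // ¬ P α}, S.cell β.1 ⊂ S.cell α.1 := by
    rintro ⟨α, hα⟩
    obtain ⟨n, hn⟩ := S.lvl_exhaust α
    by_contra! hcon
    apply hα
    have hch : ∀ β ∈ S.lvl (n + 1), S.cell β ⊂ S.cell α → P β := fun β _ h => by
      by_contra hβ
      exact hcon ⟨β, hβ⟩ h
    choose! K hK using hch
    refine ⟨max (n + 1) ((S.lvl (n + 1)).sup K), fun k hk γ hγ hγα => ?_⟩
    obtain ⟨β, hβ, hγβ, hβα⟩ := exists_between hn hγ hγα n.le_succ (le_of_max_le_left hk)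
    have hss : S.cell β ⊂ S.cell α := by
      refine hβα.ssubset_of_ne fun he => ?_
      have := S.cell_injective he
      subst this
      exact Finset.disjoint_left.1 (S.lvl_disjoint n (n + 1) (by omega)) hn hβ
    exact hK β hβ hss k ((Finset.le_sup hβ).trans (le_of_max_le_right hk)) γ hγ hγβ
  choose next hnext using step
  let a : ℕ → {α // ¬ P α} := fun n => next^[n] ⟨S.root, hroot⟩
  have ha : ∀ n, S.cell (a (n + 1)).1 ⊂ S.cell (a n).1 := fun n => by
    simp only [a, Function.iterate_succ_apply']
    exact hnext _
  obtain ⟨x, hx⟩ := S.shrink (fun n => (a n).1) ha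
  have hanti : Antitone fun n => S.cell (a n).1 := antitone_nat_of_succ_le fun n => (ha n).subset
  obtain ⟨i, hi⟩ := exists_subset_nhds_of_isCompact' (V := fun n => S.cell (a n).1)
    (directed_of_isDirected_le fun i j hij => hanti hij) (fun n => S.cell_compact _)
    (fun n => (S.cell_compact _).isClosed) (U := Metric.ball x (ε / 2)) (by
      intro y hy
      rw [hx] at hy
      rw [Set.mem_singleton_iff.1 hy]
      exact Metric.ball_mem_nhds x (half_pos hε))
  refine (a i).2 ⟨0, fun k _ β _ hβ y hy z hz => ?_⟩
  have h1 := Metric.mem_ball.1 (hi (hβ hy))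
  have h2 := Metric.mem_ball'.1 (hi (hβ hz))
  linarith [dist_triangle y x z]

variable (S) in
lemma exists_oscillation_lt {Y : Type*} [PseudoMetricSpace Y] {f : F → Y} (hf : Continuous f)
    {ε : ℝ} (hε : 0 < ε) :
    ∃ N, ∀ n ≥ N, ∀ α ∈ S.lvl n, ∀ x ∈ S.cell α, ∀ y ∈ S.cell α, dist (f x) (f y) < ε := by
  obtain ⟨δ, hδ, h⟩ := Metric.uniformContinuous_iff.1
    (CompactSpace.uniformContinuous_of_continuous hf) ε hε
  obtain ⟨N, hN⟩ := S.exists_mesh_lt hδ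
  exact ⟨N, fun n hn α hα x hx y hy => h (hN n hn α hα x hx y hy)⟩

variable (S) in
lemma dense_Vstar : Dense S.Vstar := by
  refine Metric.dense_iff.2 fun x ε hε => ?_
  obtain ⟨N, hN⟩ := S.exists_mesh_lt hε
  obtain ⟨α, hα, hx⟩ := S.exists_cell N x
  obtain ⟨v, hv⟩ := V_nonempty (S := S) α
  exact ⟨v, Metric.mem_ball.2 (hN N le_rfl α hα _ (S.vert_subset α (mem_V.1 hv)) x hx), v.2⟩

lemma eq_of_res_eq {f g : F → ℝ} (hf : Continuous f) (hg : Continuous g)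
    (h : S.res f = S.res g) : f = g :=
  Continuous.ext_on S.dense_Vstar hf hg fun x hx => congrFun h ⟨x, hx⟩

variable (S) in
/-- No `k`-cell contains two distinct points of `V_n`. -/
def Separates (n k : ℕ) : Prop :=
  n ≤ k ∧ ∀ x ∈ S.Vlvl n, ∀ y ∈ S.Vlvl n, x ≠ y → ∀ γ ∈ S.lvl k,
    (x : F) ∈ S.cell γ → (y : F) ∉ S.cell γ

variable (S) in
lemma eventually_separates (n : ℕ) : ∀ᶠ k in atTop, S.Separates n k := by
  have h : ∀ x ∈ S.Vlvl n, ∀ y ∈ S.Vlvl n, ∀ᶠ k in atTop, x ≠ y → ∀ γ ∈ S.lvl k,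
      (x : F) ∈ S.cell γ → (y : F) ∉ S.cell γ := by
    intro x _ y _
    by_cases hxy : x = y
    · exact Eventually.of_forall fun k h => absurd hxy h
    · obtain ⟨N, hN⟩ := S.exists_mesh_lt (ε := dist x y) (dist_pos.2 hxy)
      filter_upwards [eventually_ge_atTop N] with k hk _ γ hγ hx hy
      exact lt_irrefl _ (hN k hk γ hγ _ hx _ hy)
  have h' := ((S.Vlvl n).eventually_all).2 fun x hx => ((S.Vlvl n).eventually_all).2 (h x hx)
  filter_upwards [h', eventually_ge_atTop n] with k hk hnk using ⟨hnk, hk⟩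

lemma Separates.le (h : S.Separates n k) : n ≤ k := h.1

lemma Separates.mono_left (h : S.Separates n k) (hmn : m ≤ n) : S.Separates m k :=
  ⟨hmn.trans h.1, fun x hx y hy => h.2 x (S.Vlvl_mono hmn hx) y (S.Vlvl_mono hmn hy)⟩

open scoped Classical in
variable (S) in
/-- The vertices of level `k` in a cell. -/
noncomputable def Vin (k : ℕ) (α : A) : Finset S.Vstar :=
  (S.Vlvl k).filter (fun x : S.Vstar => (x : F) ∈ S.cell α)

lemma mem_Vin {x : S.Vstar} : x ∈ S.Vin k α ↔ x ∈ S.Vlvl k ∧ (x : F) ∈ S.cell α := by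
  simp [Vin]

variable (S) in
lemma Vin_root (k : ℕ) : S.Vin k S.root = S.Vlvl k := by
  ext x; simp [mem_Vin, S.cell_root]

lemma Vin_self (hα : α ∈ S.lvl n) : S.Vin n α = S.V α := by
  ext x
  rw [mem_Vin]
  exact ⟨fun h => mem_V_of_mem_cell h.1 hα h.2,
    fun h => ⟨V_subset_Vlvl hα h, S.vert_subset α (mem_V.1 h)⟩⟩

open scoped Classical in
variable (S) in
/-- The cells of level `m` inside a cell. -/
noncomputable def below (m : ℕ) (α : A) : Finset A :=
  (S.lvl m).filter (fun β => S.cell β ⊆ S.cell α)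

lemma mem_below : β ∈ S.below m α ↔ β ∈ S.lvl m ∧ S.cell β ⊆ S.cell α := by
  simp [below]

variable (S) in
lemma below_root (m : ℕ) : S.below m S.root = S.lvl m := by
  ext x; simp [mem_below, S.cell_root]

/-- A sum over the edges inside a cell is the sum over its subcells. -/
lemma sum_pairs_eq_sum_below (hα : α ∈ S.lvl n) (hnm : n ≤ m) (hsep : S.Separates m k)
    {T : S.Vstar → S.Vstar → ℝ}
    (hT : ∀ x ∈ S.Vlvl k, ∀ y ∈ S.Vlvl k, T x y ≠ 0 →
      x ≠ y ∧ ∃ γ ∈ S.lvl k, (x : F) ∈ S.cell γ ∧ (y : F) ∈ S.cell γ) :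
    ∑ x ∈ S.Vin k α, ∑ y ∈ S.Vin k α, T x y
      = ∑ β ∈ S.below m α, ∑ x ∈ S.Vin k β, ∑ y ∈ S.Vin k β, T x y := by
  classical
  have hind : ∀ β, ∑ x ∈ S.Vin k β, ∑ y ∈ S.Vin k β, T x y
      = ∑ x ∈ S.Vlvl k, ∑ y ∈ S.Vlvl k,
        if (x : F) ∈ S.cell β ∧ (y : F) ∈ S.cell β then T x y else 0 := by
    intro β
    rw [Vin, Finset.sum_filter]
    refine Finset.sum_congr rfl fun x _ => ?_
    rw [Finset.sum_filter]
    by_cases hx : (x : F) ∈ S.cell β <;> simp [hx]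
  rw [hind, Finset.sum_congr rfl fun β _ => hind β, Finset.sum_comm (s := S.below m α)]
  refine Finset.sum_congr rfl fun x hx => ?_
  rw [Finset.sum_comm (s := S.below m α)]
  refine Finset.sum_congr rfl fun y hy => ?_
  by_cases h0 : T x y = 0
  · simp [h0]
  obtain ⟨hxy, γ, hγ, hxγ, hyγ⟩ := hT x hx y hy h0
  have huniq : ∀ j ≤ m, ∀ δ ∈ S.lvl j, ∀ δ' ∈ S.lvl j, (x : F) ∈ S.cell δ → (y : F) ∈ S.cell δ →
      (x : F) ∈ S.cell δ' → (y : F) ∈ S.cell δ' → δ = δ' := by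
    intro j hj δ hδ δ' hδ' h1 h2 h3 h4
    by_contra hne
    refine hsep.2 x ?_ y ?_ hxy γ hγ hxγ hyγ
    · exact S.Vlvl_mono hj (mem_Vlvl.2 ⟨δ, hδ, mem_Vlvl_of_mem_two hδ hδ' hne h1 h3⟩)
    · exact S.Vlvl_mono hj (mem_Vlvl.2 ⟨δ, hδ, mem_Vlvl_of_mem_two hδ hδ' hne h2 h4⟩)
  obtain ⟨β, hβ, hγβ⟩ := exists_parent hγ hsep.le
  by_cases hβα : S.cell β ⊆ S.cell α
  · rw [if_pos ⟨hβα (hγβ hxγ), hβα (hγβ hyγ)⟩, Finset.sum_eq_single β,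
      if_pos ⟨hγβ hxγ, hγβ hyγ⟩]
    · intro δ hδ hne
      rw [if_neg]
      rintro ⟨h1, h2⟩
      exact hne (huniq m le_rfl δ (mem_below.1 hδ).1 β hβ h1 h2 (hγβ hxγ) (hγβ hyγ))
    · intro h; exact absurd (mem_below.2 ⟨hβ, hβα⟩) h
  · rw [if_neg]
    · refine (Finset.sum_eq_zero fun δ hδ => ?_).symm
      rw [if_neg]
      rintro ⟨h1, h2⟩
      obtain rfl := huniq m le_rfl δ (mem_below.1 hδ).1 β hβ h1 h2 (hγβ hxγ) (hγβ hyγ)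
      exact hβα (mem_below.1 hδ).2
    · rintro ⟨h1, h2⟩
      obtain ⟨α', hα', hβα'⟩ := exists_parent hβ hnm
      obtain rfl := huniq n hnm α hα α' hα' h1 h2 (hβα' (hγβ hxγ)) (hβα' (hγβ hyγ))
      exact hβα hβα'

end Combinatorics

end FinitelyRamified

namespace FinitelyRamified

section Local

variable {F : Type*} [MetricSpace F] [CompactSpace F] {A : Type*} {S : FinitelyRamified F A}
  {E : ResistanceForm S.Vstar} {n m k l : ℕ} {α β γ : A}

variable (S E) in
/-- The part of the trace form on `V_k` carried by the edges inside a cell. -/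
noncomputable def cellDisc (k : ℕ) (α : A) (u v : S.Vstar → ℝ) : ℝ :=
  (∑ x ∈ S.Vin k α, ∑ y ∈ S.Vin k α,
    E.conductance (S.Vlvl k) x y * (u x - u y) * (v x - v y)) / 2

lemma cellDisc_comm (u v : S.Vstar → ℝ) : S.cellDisc E k α u v = S.cellDisc E k α v u := by
  simp only [cellDisc, mul_assoc, mul_comm (u _ - u _)]

lemma cellDisc_congr {u u' v v' : S.Vstar → ℝ} (hu : ∀ x : S.Vstar, (x : F) ∈ S.cell α → u x = u' x)
    (hv : ∀ x : S.Vstar, (x : F) ∈ S.cell α → v x = v' x) :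
    S.cellDisc E k α u v = S.cellDisc E k α u' v' := by
  unfold cellDisc
  congr 1
  refine Finset.sum_congr rfl fun x hx => Finset.sum_congr rfl fun y hy => ?_
  rw [hu x (mem_Vin.1 hx).2, hu y (mem_Vin.1 hy).2, hv x (mem_Vin.1 hx).2,
    hv y (mem_Vin.1 hy).2]

variable (S E k α) in
/-- `cellDisc` as a bilinear map. -/
noncomputable def cellDiscₗ : (S.Vstar → ℝ) →ₗ[ℝ] (S.Vstar → ℝ) →ₗ[ℝ] ℝ :=
  LinearMap.mk₂ ℝ (S.cellDisc E k α)
    (fun u v w => by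
      simp only [cellDisc, ← add_div, ← Finset.sum_add_distrib, Pi.add_apply]
      congr 1
      exact Finset.sum_congr rfl fun x _ => Finset.sum_congr rfl fun y _ => by ring)
    (fun c u v => by
      simp only [cellDisc, smul_eq_mul, mul_div_assoc', Finset.mul_sum, Pi.smul_apply]
      congr 1
      exact Finset.sum_congr rfl fun x _ => Finset.sum_congr rfl fun y _ => by ring)
    (fun u v w => by
      simp only [cellDisc, ← add_div, ← Finset.sum_add_distrib, Pi.add_apply]
      congr 1
      exact Finset.sum_congr rfl fun x _ => Finset.sum_congr rfl fun y _ => by ring)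
    (fun c u v => by
      simp only [cellDisc, smul_eq_mul, mul_div_assoc', Finset.mul_sum, Pi.smul_apply]
      congr 1
      exact Finset.sum_congr rfl fun x _ => Finset.sum_congr rfl fun y _ => by ring)

lemma cellDiscₗ_apply (u v : S.Vstar → ℝ) : S.cellDiscₗ E k α u v = S.cellDisc E k α u v := rfl

lemma cellDisc_const_right (u : S.Vstar → ℝ) (c : ℝ) :
    S.cellDisc E k α u (fun _ => c) = 0 := by simp [cellDisc]

lemma cellDisc_self_nonneg (u : S.Vstar → ℝ) : 0 ≤ S.cellDisc E k α u u := by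
  unfold cellDisc
  refine div_nonneg (Finset.sum_nonneg fun x hx => Finset.sum_nonneg fun y _ => ?_) two_pos.le
  rw [mul_assoc]
  exact ResistanceForm.conductance_mul_nonneg (mem_Vin.1 hx).1 (mul_self_nonneg _)
    (fun h => by simp [h])

/-- Functions of pairs of vertices carried by the edges of the cells of level `k`. -/
lemma edge_of_conductance_ne_zero (hlocal : S.IsLocal E) {x y : S.Vstar} (hx : x ∈ S.Vlvl k)
    (hy : y ∈ S.Vlvl k) (hxy : x ≠ y) (h : E.conductance (S.Vlvl k) x y ≠ 0) :
    ∃ γ ∈ S.lvl k, (x : F) ∈ S.cell γ ∧ (y : F) ∈ S.cell γ := by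
  by_contra hcon
  refine h (hlocal k x hx y hy hxy ?_)
  rintro ⟨α, hα, h1, h2⟩
  exact hcon ⟨α, hα, S.vert_subset α (mem_V.1 h1), S.vert_subset α (mem_V.1 h2)⟩

lemma sum_conductance_eq_sum_below (hlocal : S.IsLocal E) (hα : α ∈ S.lvl n) (hnm : n ≤ m)
    (hsep : S.Separates m k) {T : S.Vstar → S.Vstar → ℝ} (hT : ∀ x, T x x = 0) :
    ∑ x ∈ S.Vin k α, ∑ y ∈ S.Vin k α, E.conductance (S.Vlvl k) x y * T x y
      = ∑ β ∈ S.below m α, ∑ x ∈ S.Vin k β, ∑ y ∈ S.Vin k β,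
        E.conductance (S.Vlvl k) x y * T x y := by
  refine sum_pairs_eq_sum_below hα hnm hsep fun x hx y hy h => ?_
  have hxy : x ≠ y := by
    rintro rfl
    exact h (by rw [hT, mul_zero])
  exact ⟨hxy, edge_of_conductance_ne_zero hlocal hx hy hxy (left_ne_zero_of_mul h)⟩

lemma cellDisc_eq_sum_below (hlocal : S.IsLocal E) (hα : α ∈ S.lvl n) (hnm : n ≤ m)
    (hsep : S.Separates m k) (u v : S.Vstar → ℝ) :
    S.cellDisc E k α u v = ∑ β ∈ S.below m α, S.cellDisc E k β u v := by
  simp only [cellDisc, ← Finset.sum_div, mul_assoc]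
  rw [sum_conductance_eq_sum_below hlocal hα hnm hsep (by simp)]

lemma cellDisc_root (u v : S.Vstar → ℝ) :
    S.cellDisc E k S.root u v = E.disc (S.Vlvl k) u v := by
  rw [cellDisc, Vin_root]; rfl

lemma disc_eq_sum_cells (hlocal : S.IsLocal E) (hsep : S.Separates m k) (u v : S.Vstar → ℝ) :
    E.disc (S.Vlvl k) u v = ∑ β ∈ S.lvl m, S.cellDisc E k β u v := by
  rw [← cellDisc_root, cellDisc_eq_sum_below hlocal S.root_mem (Nat.zero_le _) hsep, below_root]

lemma cellDisc_le_disc (hlocal : S.IsLocal E) (hsep : S.Separates n k) (hα : α ∈ S.lvl n)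
    (u : S.Vstar → ℝ) : S.cellDisc E k α u u ≤ E.disc (S.Vlvl k) u u := by
  rw [disc_eq_sum_cells hlocal hsep]
  exact Finset.single_le_sum (f := fun β => S.cellDisc E k β u u)
    (fun β _ => cellDisc_self_nonneg u) hα

open scoped Classical in
/-- Restriction of a function to a cell, extended by zero. -/
noncomputable def cut (α : A) (w : S.Vstar → ℝ) : S.Vstar → ℝ :=
  fun x => if (x : F) ∈ S.cell α then w x else 0

lemma cut_of_mem {w : S.Vstar → ℝ} {x : S.Vstar} (hx : (x : F) ∈ S.cell α) :
    cut α w x = w x := if_pos hx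

lemma cut_of_notMem {w : S.Vstar → ℝ} {x : S.Vstar} (hx : (x : F) ∉ S.cell α) :
    cut α w x = 0 := if_neg hx

lemma disc_cut (hlocal : S.IsLocal E) (hα : α ∈ S.lvl n) (hsep : S.Separates n l)
    {w : S.Vstar → ℝ} (hw : ∀ x ∈ S.V α, w x = 0) (u : S.Vstar → ℝ) :
    E.disc (S.Vlvl l) u (cut α w) = S.cellDisc E l α u w := by
  rw [disc_eq_sum_cells hlocal hsep, Finset.sum_eq_single α]
  · exact cellDisc_congr (fun _ _ => rfl) fun x hx => cut_of_mem hx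
  · intro β hβ hne
    rw [← cellDisc_const_right (k := l) (α := β) (E := E) u 0]
    refine cellDisc_congr (fun _ _ => rfl) fun x hx => ?_
    by_cases hxα : (x : F) ∈ S.cell α
    · rw [cut_of_mem hxα, hw x (mem_V.2 (mem_Vlvl_of_mem_two hα hβ hne.symm hxα hx))]
    · exact cut_of_notMem hxα
  · exact fun h => absurd hα h

/-- On each cell, minimal energy extensions are orthogonal to functions that vanish at the
vertices. -/
lemma cellDisc_ext_orth (hlocal : S.IsLocal E) (hα : α ∈ S.lvl n) (hnk : n ≤ k) (hkl : k ≤ l)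
    (hsep : S.Separates n l) {w : S.Vstar → ℝ} (hw : ∀ x ∈ S.Vin k α, w x = 0)
    (u : S.Vstar → ℝ) : S.cellDisc E l α (E.ext (S.Vlvl k) u) w = 0 := by
  have hw' : ∀ x ∈ S.V α, w x = 0 := fun x hx => hw x (mem_Vin.2
    ⟨S.Vlvl_mono hnk (V_subset_Vlvl hα hx), S.vert_subset α (mem_V.1 hx)⟩)
  rw [← disc_cut hlocal hα hsep hw', ResistanceForm.disc_eq (S.exhausts.nonempty l),
    ResistanceForm.ext_ext_of_subset (S.exhausts.nonempty k) (S.Vlvl_mono hkl)]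
  refine ResistanceForm.ext_orth _ (ResistanceForm.ext_mem _ _) fun x hx => ?_
  rw [ResistanceForm.ext_apply _ (S.Vlvl_mono hkl hx)]
  by_cases hxα : (x : F) ∈ S.cell α
  · rw [cut_of_mem hxα, hw x (mem_Vin.2 ⟨hx, hxα⟩)]
  · exact cut_of_notMem hxα

lemma ext_eq_zero_on_cell (hlocal : S.IsLocal E) (hα : α ∈ S.lvl n) (hnk : n ≤ k)
    {u : S.Vstar → ℝ} (hu : ∀ x ∈ S.Vin k α, u x = 0) {x : S.Vstar} (hx : (x : F) ∈ S.cell α) :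
    E.ext (S.Vlvl k) u x = 0 := by
  set w := E.ext (S.Vlvl k) u with hw
  have hw0 : ∀ x ∈ S.Vin k α, w x = 0 := fun x hx => by
    rw [hw, ResistanceForm.ext_apply _ (mem_Vin.1 hx).1, hu x hx]
  have hwV : ∀ x ∈ S.V α, w x = 0 := fun x hx => hw0 x (mem_Vin.2
    ⟨S.Vlvl_mono hnk (V_subset_Vlvl hα hx), S.vert_subset α (mem_V.1 hx)⟩)
  have hzero : ∀ᶠ l in atTop, E.disc (S.Vlvl l) (cut α w) (cut α w) = 0 := by
    filter_upwards [S.eventually_separates n, eventually_ge_atTop k] with l hsep hkl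
    rw [disc_cut hlocal hα hsep hwV, cellDisc_congr (u' := w) (v' := w)
      (fun x hx => cut_of_mem hx) (fun _ _ => rfl)]
    exact cellDisc_ext_orth hlocal hα hnk hkl hsep hw0 u
  have hle : ∀ j, E.disc (S.Vlvl j) (cut α w) (cut α w) ≤ 0 := by
    intro j
    obtain ⟨l, hl, hjl⟩ := (hzero.and (eventually_ge_atTop j)).exists
    exact (ResistanceForm.disc_mono S.exhausts _ hjl).trans_eq hl
  obtain ⟨hmem, hE⟩ := ResistanceForm.form_le_of_disc_le S.exhausts hle
  obtain ⟨c, hc⟩ := (E.eq_zero_iff _ hmem).1 (le_antisymm hE (E.nonneg _ hmem))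
  obtain ⟨p, hp⟩ := V_nonempty (S := S) α
  have h1 := congrFun hc p
  have h2 := congrFun hc x
  rw [cut_of_mem (S.vert_subset α (mem_V.1 hp)), hwV p hp] at h1
  rw [cut_of_mem hx] at h2
  rw [h2, ← h1]

lemma ext_congr_on_cell (hlocal : S.IsLocal E) (hα : α ∈ S.lvl n) (hnk : n ≤ k)
    {u u' : S.Vstar → ℝ} (hu : ∀ x ∈ S.Vin k α, u x = u' x) {x : S.Vstar}
    (hx : (x : F) ∈ S.cell α) : E.ext (S.Vlvl k) u x = E.ext (S.Vlvl k) u' x := by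
  have := ext_eq_zero_on_cell hlocal hα hnk (u := u - u') (fun x hx => by simp [hu x hx]) hx
  rw [ResistanceForm.ext_sub] at this
  simpa [sub_eq_zero] using this

variable (S) in
/-- Levels `k` from which on the energies of the cells of level `n` are consistent. -/
def Stable (n k : ℕ) : Prop :=
  ∃ N, N ≤ k ∧ S.Separates n N ∧ ∀ l ≥ k, S.Separates N l

variable (S) in
lemma eventually_stable (n : ℕ) : ∀ᶠ k in atTop, S.Stable n k := by
  obtain ⟨N, hN⟩ := (S.eventually_separates n).exists
  obtain ⟨K, hK⟩ := eventually_atTop.1 (S.eventually_separates N)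
  filter_upwards [eventually_ge_atTop K, eventually_ge_atTop N] with k hk hkN
  exact ⟨N, hkN, hN, fun l hl => hK l (hk.trans hl)⟩

lemma Stable.le (h : S.Stable n k) : n ≤ k := by
  obtain ⟨N, h1, h2, -⟩ := h
  exact h2.le.trans h1

lemma Stable.separates (h : S.Stable n k) (hkl : k ≤ l) : S.Separates n l := by
  obtain ⟨N, h1, h2, h3⟩ := h
  exact (h3 l hkl).mono_left h2.le

lemma Stable.mono (h : S.Stable n k) (hkl : k ≤ l) : S.Stable n l := by
  obtain ⟨N, h1, h2, h3⟩ := h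
  exact ⟨N, h1.trans hkl, h2, fun j hj => h3 j (hkl.trans hj)⟩

lemma cellDisc_ext_single (hlocal : S.IsLocal E) (hα : α ∈ S.lvl n) (hst : S.Stable n k)
    (hkl : k ≤ l) {x y : S.Vstar} (hx : x ∈ S.Vin k α) (hy : y ∈ S.Vin k α) (hxy : x ≠ y) :
    S.cellDisc E l α (E.ext (S.Vlvl k) (ResistanceForm.delta x)) (E.ext (S.Vlvl k) (ResistanceForm.delta y))
      = - E.conductance (S.Vlvl k) x y := by
  set a := E.ext (S.Vlvl k) (ResistanceForm.delta x) with ha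
  set b := E.ext (S.Vlvl k) (ResistanceForm.delta y) with hb
  have hvan : ∀ (z : S.Vstar) j, j ≤ k → ∀ β ∈ S.lvl j, (z : F) ∉ S.cell β →
      ∀ t : S.Vstar, (t : F) ∈ S.cell β → E.ext (S.Vlvl k) (ResistanceForm.delta z) t = 0 := by
    intro z j hj β hβ hz t ht
    refine ext_eq_zero_on_cell hlocal hβ hj (fun s hs => ?_) ht
    rw [ResistanceForm.delta_of_ne]
    rintro rfl
    exact hz (mem_Vin.1 hs).2
  have hzero : ∀ j, j ≤ k → ∀ β ∈ S.lvl j, ¬ ((x : F) ∈ S.cell β ∧ (y : F) ∈ S.cell β) →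
      S.cellDisc E l β a b = 0 := by
    intro j hj β hβ hnot
    by_cases h1 : (x : F) ∈ S.cell β
    · rw [← cellDisc_const_right (k := l) (α := β) (E := E) a 0]
      exact cellDisc_congr (fun _ _ => rfl) (hvan y j hj β hβ fun h2 => hnot ⟨h1, h2⟩)
    · rw [cellDisc_comm, ← cellDisc_const_right (k := l) (α := β) (E := E) b 0]
      exact cellDisc_congr (fun _ _ => rfl) (hvan x j hj β hβ h1)
  rw [ResistanceForm.conductance_eq, neg_neg]
  change S.cellDisc E l α a b = E.form a b
  have htot : E.form a b = ∑ β ∈ S.lvl n, S.cellDisc E l β a b := by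
    rw [← disc_eq_sum_cells hlocal (hst.separates hkl), ResistanceForm.disc_eq
      (S.exhausts.nonempty l), ha, hb,
      ResistanceForm.ext_ext_of_subset (S.exhausts.nonempty k) (S.Vlvl_mono hkl),
      ResistanceForm.ext_ext_of_subset (S.exhausts.nonempty k) (S.Vlvl_mono hkl)]
  by_cases hother : ∃ β ∈ S.lvl n, β ≠ α ∧ (x : F) ∈ S.cell β ∧ (y : F) ∈ S.cell β
  · obtain ⟨β, hβ, hne, hxβ, hyβ⟩ := hother
    have hxn : x ∈ S.Vlvl n := mem_Vlvl.2
      ⟨α, hα, mem_Vlvl_of_mem_two hα hβ hne.symm (mem_Vin.1 hx).2 hxβ⟩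
    have hyn : y ∈ S.Vlvl n := mem_Vlvl.2
      ⟨α, hα, mem_Vlvl_of_mem_two hα hβ hne.symm (mem_Vin.1 hy).2 hyβ⟩
    obtain ⟨N, hNk, hnN, hNl⟩ := hst
    have hall : ∀ β ∈ S.lvl n, S.cellDisc E l β a b = 0 := by
      intro β hβ
      rw [cellDisc_eq_sum_below hlocal hβ hnN.le (hNl l hkl)]
      refine Finset.sum_eq_zero fun δ hδ => hzero N hNk δ (mem_below.1 hδ).1 ?_
      rintro ⟨h1, h2⟩
      exact hnN.2 x hxn y hyn hxy δ (mem_below.1 hδ).1 h1 h2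
    rw [htot, Finset.sum_eq_zero hall, hall α hα]
  · rw [htot, Finset.sum_eq_single α (fun β hβ hne => hzero n hst.le β hβ fun h =>
      hother ⟨β, hβ, hne, h⟩) (fun h => absurd hα h)]

lemma cellDisc_ext (hlocal : S.IsLocal E) (hα : α ∈ S.lvl n) (hst : S.Stable n k)
    (hkl : k ≤ l) (u v : S.Vstar → ℝ) :
    S.cellDisc E l α (E.ext (S.Vlvl k) u) (E.ext (S.Vlvl k) v) = S.cellDisc E k α u v := by
  classical
  set q : S.Vstar → S.Vstar → ℝ := fun x y => S.cellDisc E l α (E.ext (S.Vlvl k) (ResistanceForm.delta x))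
    (E.ext (S.Vlvl k) (ResistanceForm.delta y)) with hq
  have hloc : ∀ u : S.Vstar → ℝ, ∀ t : S.Vstar, (t : F) ∈ S.cell α → E.ext (S.Vlvl k) u t
      = (∑ x ∈ S.Vin k α, u x • E.ext (S.Vlvl k) (ResistanceForm.delta x)) t := by
    intro u t ht
    have h : ∑ x ∈ S.Vin k α, u x • E.ext (S.Vlvl k) (ResistanceForm.delta x)
        = E.ext (S.Vlvl k) (∑ x ∈ S.Vin k α, u x • ResistanceForm.delta x) := by
      rw [← ResistanceForm.extₗ_apply, map_sum]
      exact Finset.sum_congr rfl fun x _ => ((E.extₗ (S.Vlvl k)).map_smul _ _).symm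
    rw [h]
    refine ext_congr_on_cell hlocal hα hst.le (fun x hx => ?_) ht
    exact (ResistanceForm.sum_smul_delta _ u hx).symm
  have hexp : ∀ u v : S.Vstar → ℝ, S.cellDisc E l α (E.ext (S.Vlvl k) u) (E.ext (S.Vlvl k) v)
      = ∑ x ∈ S.Vin k α, ∑ y ∈ S.Vin k α, u x * v y * q x y := by
    intro u v
    rw [cellDisc_congr (hloc u) (hloc v), ← cellDiscₗ_apply]
    simp only [map_sum, LinearMap.sum_apply, map_smul, LinearMap.smul_apply, smul_eq_mul]
    simp only [Finset.mul_sum]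
    rw [Finset.sum_comm]
    refine Finset.sum_congr rfl fun x _ => Finset.sum_congr rfl fun y _ => ?_
    rw [cellDiscₗ_apply]; ring
  have hrow : ∀ x ∈ S.Vin k α, ∑ y ∈ S.Vin k α, q x y = 0 := by
    intro x hx
    have h := hexp (ResistanceForm.delta x) (fun _ => 1)
    rw [ResistanceForm.ext_const (S.exhausts.nonempty k), cellDisc_const_right] at h
    rw [Finset.sum_eq_single x] at h
    · simpa [ResistanceForm.delta_self] using h.symm
    · intro z _ hz
      simp [ResistanceForm.delta_of_ne hz]
    · exact fun h => absurd hx h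
  have key := Finset.sum_mul_sub_mul_sub (S.Vin k α) q (fun x _ y _ => cellDisc_comm _ _) hrow u v
  rw [hexp, cellDisc]
  have : ∑ x ∈ S.Vin k α, ∑ y ∈ S.Vin k α,
      E.conductance (S.Vlvl k) x y * (u x - u y) * (v x - v y)
      = - ∑ x ∈ S.Vin k α, ∑ y ∈ S.Vin k α, q x y * (u x - u y) * (v x - v y) := by
    rw [← Finset.sum_neg_distrib]
    refine Finset.sum_congr rfl fun x hx => ?_
    rw [← Finset.sum_neg_distrib]
    refine Finset.sum_congr rfl fun y hy => ?_
    by_cases hxy : x = y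
    · simp [hxy]
    · simp only [hq]
      rw [cellDisc_ext_single hlocal hα hst hkl hx hy hxy]; ring
  rw [this, key]; ring

lemma cellDisc_self_eq_add (hlocal : S.IsLocal E) (hα : α ∈ S.lvl n) (hnk : n ≤ k) (hkl : k ≤ l)
    (hsep : S.Separates n l) {u w : S.Vstar → ℝ} (huw : ∀ x ∈ S.Vin k α, u x = w x) :
    S.cellDisc E l α u u = S.cellDisc E l α (E.ext (S.Vlvl k) w) (E.ext (S.Vlvl k) w)
      + S.cellDisc E l α (u - E.ext (S.Vlvl k) w) (u - E.ext (S.Vlvl k) w) := by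
  have h0 := cellDisc_ext_orth hlocal hα hnk hkl hsep (w := u - E.ext (S.Vlvl k) w)
    (fun x hx => by simp [ResistanceForm.ext_apply _ (mem_Vin.1 hx).1, huw x hx]) w
  have h1 := h0
  rw [cellDisc_comm] at h1
  simp only [← cellDiscₗ_apply] at h0 h1 ⊢
  simp only [map_sub, LinearMap.sub_apply] at h0 h1 ⊢
  linarith

lemma cellDisc_ext_le (hlocal : S.IsLocal E) (hα : α ∈ S.lvl n) (hnk : n ≤ k) (hkl : k ≤ l)
    (hsep : S.Separates n l) {u w : S.Vstar → ℝ} (huw : ∀ x ∈ S.Vin k α, u x = w x) :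
    S.cellDisc E l α (E.ext (S.Vlvl k) w) (E.ext (S.Vlvl k) w) ≤ S.cellDisc E l α u u := by
  rw [cellDisc_self_eq_add hlocal hα hnk hkl hsep huw]
  linarith [cellDisc_self_nonneg (E := E) (k := l) (α := α) (u - E.ext (S.Vlvl k) w)]

lemma cellDisc_mono (hlocal : S.IsLocal E) (hα : α ∈ S.lvl n) (hst : S.Stable n k) (hkl : k ≤ l)
    (u : S.Vstar → ℝ) : S.cellDisc E k α u u ≤ S.cellDisc E l α u u := by
  rw [← cellDisc_ext hlocal hα hst hkl u u]
  exact cellDisc_ext_le hlocal hα hst.le hkl (hst.separates hkl) fun _ _ => rfl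

lemma cellEnergy_eq_limUnder (f : S.Vstar → ℝ) :
    S.cellEnergy E α f = limUnder atTop fun k => S.cellDisc E k α f f := by
  simp only [cellEnergy, cellDisc, sq, mul_assoc]
  rfl

lemma tendsto_cellDisc (hlocal : S.IsLocal E) (hα : α ∈ S.lvl n) {g : S.Vstar → ℝ}
    (hg : g ∈ E.dom) :
    Tendsto (fun k => S.cellDisc E k α g g) atTop (𝓝 (S.cellEnergy E α g)) := by
  obtain ⟨K, hK⟩ := (S.eventually_stable n).exists
  have hmono : Monotone fun j => S.cellDisc E (j + K) α g g := fun i j hij =>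
    cellDisc_mono hlocal hα (hK.mono (by omega)) (by omega) g
  have hbdd : BddAbove (Set.range fun j => S.cellDisc E (j + K) α g g) :=
    ⟨E.form g g, by
      rintro _ ⟨j, rfl⟩
      exact (cellDisc_le_disc hlocal (hK.separates (by omega)) hα g).trans
        (ResistanceForm.disc_self_le_form (S.exhausts.nonempty _) hg)⟩
  have h := (tendsto_add_atTop_iff_nat (f := fun k => S.cellDisc E k α g g) K).1
    (tendsto_atTop_ciSup hmono hbdd)
  rw [cellEnergy_eq_limUnder, h.limUnder_eq]
  exact h

lemma cellDisc_eq_of_ext_eq (hlocal : S.IsLocal E) (hα : α ∈ S.lvl n) (hst : S.Stable n k)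
    (hkl : k ≤ l) {u v : S.Vstar → ℝ} (hu : E.ext (S.Vlvl k) u = u)
    (hv : E.ext (S.Vlvl k) v = v) : S.cellDisc E l α u v = S.cellDisc E k α u v := by
  have := cellDisc_ext hlocal hα hst hkl u v
  rwa [hu, hv] at this

lemma cellTrace_eq (hlocal : S.IsLocal E) (hα : α ∈ S.lvl n) (w : S.Vstar → ℝ) :
    S.cellTrace E α w = S.cellEnergy E α (E.ext (S.Vlvl n) w) := by
  refine IsLeast.csInf_eq ⟨⟨_, ResistanceForm.ext_mem _ _, fun x hx =>
    ResistanceForm.ext_apply w (V_subset_Vlvl hα hx), rfl⟩, ?_⟩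
  rintro e ⟨g, hg, hgw, rfl⟩
  refine le_of_tendsto_of_tendsto (tendsto_cellDisc hlocal hα (ResistanceForm.ext_mem _ _))
    (tendsto_cellDisc hlocal hα hg) ?_
  filter_upwards [S.eventually_separates n] with l hl
  exact cellDisc_ext_le hlocal hα le_rfl hl.le hl fun x hx => hgw x (by rwa [Vin_self hα] at hx)

lemma ext_ext_Vlvl (hkl : k ≤ l) (w : S.Vstar → ℝ) :
    E.ext (S.Vlvl l) (E.ext (S.Vlvl k) w) = E.ext (S.Vlvl k) w :=
  ResistanceForm.ext_ext_of_subset (S.exhausts.nonempty k) (S.Vlvl_mono hkl) w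

lemma cellTrace_eq_cellDisc (hlocal : S.IsLocal E) (hα : α ∈ S.lvl n) (hst : S.Stable n k)
    (w : S.Vstar → ℝ) :
    S.cellTrace E α w = S.cellDisc E k α (E.ext (S.Vlvl n) w) (E.ext (S.Vlvl n) w) := by
  rw [cellTrace_eq hlocal hα]
  refine tendsto_nhds_unique (tendsto_cellDisc hlocal hα (ResistanceForm.ext_mem _ _))
    (tendsto_const_nhds.congr' ?_)
  filter_upwards [eventually_ge_atTop k] with l hl
  exact (cellDisc_eq_of_ext_eq hlocal hα hst hl (ext_ext_Vlvl hst.le w)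
    (ext_ext_Vlvl hst.le w)).symm

lemma cellFormMatrix_eq (hlocal : S.IsLocal E) (hα : α ∈ S.lvl n) (hst : S.Stable n k)
    (x y : S.V α) :
    S.cellFormMatrix E α x y =
      S.cellDisc E k α (E.ext (S.Vlvl n) (ResistanceForm.delta (x : S.Vstar)))
        (E.ext (S.Vlvl n) (ResistanceForm.delta (y : S.Vstar))) := by
  rw [cellFormMatrix, Matrix.of_apply]
  simp only [cellTrace_eq_cellDisc hlocal hα hst, ResistanceForm.ext_add,
    ResistanceForm.single_eq_delta]
  set a := E.ext (S.Vlvl n) (ResistanceForm.delta (x : S.Vstar))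
  set b := E.ext (S.Vlvl n) (ResistanceForm.delta (y : S.Vstar))
  have h := cellDisc_comm (E := E) (k := k) (α := α) a b
  simp only [← cellDiscₗ_apply] at h ⊢
  simp only [map_add, LinearMap.add_apply, ← h]
  ring

end Local

end FinitelyRamified

namespace FinitelyRamified

section Harmonic

variable {F : Type*} [MetricSpace F] [CompactSpace F] {A : Type*} {S : FinitelyRamified F A}
  {E : ResistanceForm S.Vstar} {n m k l : ℕ} {α β γ : A}

lemma isHarmonic_iff {u : S.Vstar → ℝ} : S.IsHarmonic E u ↔ E.ext S.V0 u = u :=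
  (ResistanceForm.ext_eq_self_iff (V_nonempty S.root)).symm

lemma isHarmonic_ext (w : S.Vstar → ℝ) : S.IsHarmonic E (E.ext S.V0 w) :=
  isHarmonic_iff.2 (ResistanceForm.ext_congr fun _ hx => ResistanceForm.ext_apply w hx)

lemma IsHarmonic.mem {u : S.Vstar → ℝ} (hu : S.IsHarmonic E u) : u ∈ E.dom := hu.1

lemma IsHarmonic.ext_eq {u : S.Vstar → ℝ} (hu : S.IsHarmonic E u) (k : ℕ) :
    E.ext (S.Vlvl k) u = u := by
  rw [isHarmonic_iff, V0_eq] at hu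
  rw [← hu]
  exact ext_ext_Vlvl (Nat.zero_le k) u

lemma IsHarmonic.eq_of_V0 {u v : S.Vstar → ℝ} (hu : S.IsHarmonic E u) (hv : S.IsHarmonic E v)
    (h : ∀ x ∈ S.V0, u x = v x) : u = v := by
  rw [← isHarmonic_iff.1 hu, ← isHarmonic_iff.1 hv]
  exact ResistanceForm.ext_congr h

lemma IsHarmonic.add {u v : S.Vstar → ℝ} (hu : S.IsHarmonic E u) (hv : S.IsHarmonic E v) :
    S.IsHarmonic E (u + v) := by
  rw [isHarmonic_iff, ResistanceForm.ext_add, isHarmonic_iff.1 hu, isHarmonic_iff.1 hv]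

lemma IsHarmonic.smul {u : S.Vstar → ℝ} (c : ℝ) (hu : S.IsHarmonic E u) :
    S.IsHarmonic E (c • u) := by
  rw [isHarmonic_iff, ResistanceForm.ext_smul, isHarmonic_iff.1 hu]

lemma IsHarmonic.sum {ι : Type*} (s : Finset ι) {u : ι → S.Vstar → ℝ}
    (hu : ∀ i ∈ s, S.IsHarmonic E (u i)) : S.IsHarmonic E (∑ i ∈ s, u i) := by
  rw [isHarmonic_iff, ← ResistanceForm.extₗ_apply, map_sum]
  exact Finset.sum_congr rfl fun i hi => isHarmonic_iff.1 (hu i hi)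

lemma isHarmonic_const (c : ℝ) : S.IsHarmonic E (fun _ => c) :=
  isHarmonic_iff.2 (ResistanceForm.ext_const (V_nonempty S.root) c)

open scoped Classical in
/-- Extension by zero of a function on the vertex boundary. -/
noncomputable def extendBoundary (b : S.V0 → ℝ) : S.Vstar → ℝ :=
  fun x => if h : x ∈ S.V0 then b ⟨x, h⟩ else 0

lemma extendBoundary_apply (b : S.V0 → ℝ) (v : S.V0) : extendBoundary b v = b v := by
  simp [extendBoundary]

lemma harmonicExtension_spec (hcont : S.HarmonicContinuous E) (b : S.V0 → ℝ) :
    Continuous (S.harmonicExtension E b) ∧ S.IsHarmonic E (S.res (S.harmonicExtension E b)) ∧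
      ∀ v : S.V0, S.res (S.harmonicExtension E b) v = b v := by
  refine Classical.epsilon_spec (p := fun U : F → ℝ =>
    Continuous U ∧ S.IsHarmonic E (S.res U) ∧ ∀ v : S.V0, S.res U v = b v) ?_
  obtain ⟨U, hU, hUr⟩ := hcont _ (isHarmonic_ext (E := E) (extendBoundary b))
  refine ⟨U, hU, hUr ▸ isHarmonic_ext _, fun v => ?_⟩
  rw [hUr, ResistanceForm.ext_apply _ v.2, extendBoundary_apply]

variable (S E) in
/-- The harmonic coordinates as functions on `V_*`. -/
noncomputable def coordRes (i : S.V0) : S.Vstar → ℝ := S.res fun x => S.coord E x i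

lemma continuous_coord_apply (hcont : S.HarmonicContinuous E) (i : S.V0) :
    Continuous fun x => S.coord E x i :=
  (harmonicExtension_spec hcont _).1

lemma continuous_coord (hcont : S.HarmonicContinuous E) : Continuous (S.coord E) :=
  continuous_pi fun i => continuous_coord_apply hcont i

lemma isHarmonic_coordRes (hcont : S.HarmonicContinuous E) (i : S.V0) :
    S.IsHarmonic E (S.coordRes E i) :=
  (harmonicExtension_spec hcont _).2.1

lemma coordRes_apply_V0 (hcont : S.HarmonicContinuous E) (i v : S.V0) :
    S.coordRes E i v = ResistanceForm.delta i v := by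
  rw [coordRes, res, coord]
  refine ((harmonicExtension_spec hcont _).2.2 v).trans ?_
  rw [ResistanceForm.single_eq_delta]

lemma IsHarmonic.eq_sum (hcont : S.HarmonicContinuous E) {u : S.Vstar → ℝ}
    (hu : S.IsHarmonic E u) : u = ∑ i : S.V0, u i • S.coordRes E i := by
  refine hu.eq_of_V0 (IsHarmonic.sum _ fun i _ => (isHarmonic_coordRes hcont i).smul _)
    fun x hx => ?_
  have := ResistanceForm.sum_smul_delta Finset.univ (fun i : S.V0 => u i)
    (Finset.mem_univ (⟨x, hx⟩ : S.V0))
  simp only [Finset.sum_apply, Pi.smul_apply, smul_eq_mul] at this ⊢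
  rw [← this]
  refine Finset.sum_congr rfl fun i _ => ?_
  rw [show S.coordRes E i x = _ from coordRes_apply_V0 hcont i ⟨x, hx⟩]

/-- The continuous extension of a harmonic function. -/
lemma IsHarmonic.exists_continuous (hcont : S.HarmonicContinuous E) {u : S.Vstar → ℝ}
    (hu : S.IsHarmonic E u) :
    S.res (fun x => ∑ i : S.V0, u i * S.coord E x i) = u := by
  conv_rhs => rw [hu.eq_sum hcont]
  ext x
  simp [res, coordRes]

variable (S E) in
/-- The energy form of a cell on harmonic functions. -/
noncomputable def harmForm (α : A) (u v : S.Vstar → ℝ) : ℝ :=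
  (S.cellTrace E α (u + v) - S.cellTrace E α u - S.cellTrace E α v) / 2

lemma cellTrace_of_harmonic (hlocal : S.IsLocal E) (hα : α ∈ S.lvl n) (hst : S.Stable n k)
    {u : S.Vstar → ℝ} (hu : S.IsHarmonic E u) : S.cellTrace E α u = S.cellDisc E k α u u := by
  rw [cellTrace_eq_cellDisc hlocal hα hst, hu.ext_eq]

lemma harmForm_eq (hlocal : S.IsLocal E) (hα : α ∈ S.lvl n) (hst : S.Stable n k)
    {u v : S.Vstar → ℝ} (hu : S.IsHarmonic E u) (hv : S.IsHarmonic E v) :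
    S.harmForm E α u v = S.cellDisc E k α u v := by
  rw [harmForm, cellTrace_of_harmonic hlocal hα hst hu, cellTrace_of_harmonic hlocal hα hst hv,
    cellTrace_of_harmonic hlocal hα hst (hu.add hv)]
  have h := cellDisc_comm (E := E) (k := k) (α := α) u v
  simp only [← cellDiscₗ_apply] at h ⊢
  simp only [map_add, LinearMap.add_apply, ← h]
  ring

lemma harmForm_self (hlocal : S.IsLocal E) {u : S.Vstar → ℝ} (hu : S.IsHarmonic E u) :
    S.harmForm E α u u = S.cellTrace E α u := by
  obtain ⟨n, hα⟩ := S.lvl_exhaust α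
  obtain ⟨k, hst⟩ := (S.eventually_stable n).exists
  rw [harmForm_eq hlocal hα hst hu hu, cellTrace_of_harmonic hlocal hα hst hu]

lemma cellTrace_nonneg (hlocal : S.IsLocal E) {u : S.Vstar → ℝ} (hu : S.IsHarmonic E u) :
    0 ≤ S.cellTrace E α u := by
  obtain ⟨n, hα⟩ := S.lvl_exhaust α
  obtain ⟨k, hst⟩ := (S.eventually_stable n).exists
  rw [cellTrace_of_harmonic hlocal hα hst hu]
  exact cellDisc_self_nonneg u

lemma harmForm_eq_sum_below (hlocal : S.IsLocal E) (hα : α ∈ S.lvl n) (hnm : n ≤ m)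
    {u v : S.Vstar → ℝ} (hu : S.IsHarmonic E u) (hv : S.IsHarmonic E v) :
    S.harmForm E α u v = ∑ β ∈ S.below m α, S.harmForm E β u v := by
  obtain ⟨k, hk1, hk2⟩ := ((S.eventually_stable n).and (S.eventually_stable m)).exists
  rw [harmForm_eq hlocal hα hk1 hu hv,
    cellDisc_eq_sum_below hlocal hα hnm (hk2.separates le_rfl)]
  exact Finset.sum_congr rfl fun β hβ =>
    (harmForm_eq hlocal (mem_below.1 hβ).1 hk2 hu hv).symm

lemma disc_of_harmonic {u v : S.Vstar → ℝ} (hu : S.IsHarmonic E u) (hv : S.IsHarmonic E v) :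
    E.disc (S.Vlvl k) u v = E.form u v := by
  rw [ResistanceForm.disc_eq (S.exhausts.nonempty k), hu.ext_eq, hv.ext_eq]

lemma sum_harmForm (hlocal : S.IsLocal E) {u v : S.Vstar → ℝ} (hu : S.IsHarmonic E u)
    (hv : S.IsHarmonic E v) : ∑ β ∈ S.lvl m, S.harmForm E β u v = E.form u v := by
  obtain ⟨k, hk⟩ := (S.eventually_stable m).exists
  rw [← disc_of_harmonic (k := k) hu hv, disc_eq_sum_cells hlocal (hk.separates le_rfl)]
  exact Finset.sum_congr rfl fun β hβ => harmForm_eq hlocal hβ hk hu hv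

/-- `M_αᵀ D_α M_α` is the matrix of the energy form of the cell in the harmonic coordinates. -/
lemma transpose_mul_mul_apply (hlocal : S.IsLocal E) (hcont : S.HarmonicContinuous E)
    (i j : S.V0) :
    ((S.harmonicMatrix E α).transpose * S.cellFormMatrix E α * S.harmonicMatrix E α) i j
      = S.harmForm E α (S.coordRes E i) (S.coordRes E j) := by
  obtain ⟨n, hα⟩ := S.lvl_exhaust α
  obtain ⟨k, hst⟩ := (S.eventually_stable n).exists
  have hi := isHarmonic_coordRes hcont i
  have hj := isHarmonic_coordRes hcont j
  rw [harmForm_eq hlocal hα hst hi hj]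
  have hloc : ∀ u : S.Vstar → ℝ, S.IsHarmonic E u → ∀ t : S.Vstar, (t : F) ∈ S.cell α → u t
      = (∑ x : S.V α, u x • E.ext (S.Vlvl n) (ResistanceForm.delta (x : S.Vstar))) t := by
    intro u hu t ht
    have h : ∑ x : S.V α, u x • E.ext (S.Vlvl n) (ResistanceForm.delta (x : S.Vstar))
        = E.ext (S.Vlvl n) (∑ x ∈ S.V α, u x • ResistanceForm.delta x) := by
      rw [← ResistanceForm.extₗ_apply, map_sum]
      simp only [map_smul, ResistanceForm.extₗ_apply]
      exact Finset.sum_coe_sort (S.V α)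
        fun x => u x • E.ext (S.Vlvl n) (ResistanceForm.delta x)
    rw [h]
    conv_lhs => rw [← hu.ext_eq n]
    refine ext_congr_on_cell hlocal hα le_rfl (fun x hx => ?_) ht
    rw [Vin_self hα] at hx
    exact (ResistanceForm.sum_smul_delta _ u hx).symm
  rw [cellDisc_congr (hloc _ hi) (hloc _ hj), ← cellDiscₗ_apply]
  simp only [map_sum, LinearMap.sum_apply, map_smul, LinearMap.smul_apply, smul_eq_mul,
    Matrix.mul_apply, Matrix.transpose_apply, cellFormMatrix_eq hlocal hα hst]
  refine Finset.sum_congr rfl fun y _ => ?_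
  rw [mul_comm, Finset.mul_sum, Finset.mul_sum]
  refine Finset.sum_congr rfl fun x _ => ?_
  rw [cellDiscₗ_apply]
  simp only [harmonicMatrix, Matrix.of_apply, coordRes, res]

lemma Zcell_apply [MeasurableSpace F] (hlocal : S.IsLocal E) (hcont : S.HarmonicContinuous E)
    (ν : Measure F) (i j : S.V0) :
    S.Zcell E ν α i j
      = (ν.real (S.cell α))⁻¹ * S.harmForm E α (S.coordRes E i) (S.coordRes E j) := by
  rw [Zcell, Matrix.smul_apply, transpose_mul_mul_apply hlocal hcont, smul_eq_mul]

/-- The energy of a harmonic function does not concentrate at points. -/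
lemma exists_sum_cellTrace_lt (hlocal : S.IsLocal E) (hcont : S.HarmonicContinuous E)
    {u : S.Vstar → ℝ} (hu : S.IsHarmonic E u) (x : F) {ε : ℝ} (hε : 0 < ε) :
    ∃ N, ∀ n ≥ N, ∀ s ⊆ S.lvl n, (∀ α ∈ s, x ∈ S.cell α) →
      ∑ α ∈ s, S.cellTrace E α u < ε := by
  obtain ⟨U, hU, hUr⟩ := hcont u hu
  obtain ⟨δ, hδ, hδ'⟩ := ResistanceForm.exists_form_clamp_lt S.exhausts hu.mem (U x) hε
  obtain ⟨hvm, hvE⟩ := hδ' δ hδ le_rfl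
  set v : S.Vstar → ℝ := fun y => ResistanceForm.clamp δ (u y - U x) with hv
  obtain ⟨N, hN⟩ := S.exists_oscillation_lt hU hδ
  refine ⟨N, fun n hn s hs hx => ?_⟩
  obtain ⟨k, hst⟩ := (S.eventually_stable n).exists
  calc ∑ α ∈ s, S.cellTrace E α u = ∑ α ∈ s, S.cellDisc E k α v v := by
        refine Finset.sum_congr rfl fun α hα => ?_
        rw [cellTrace_of_harmonic hlocal (hs hα) hst hu]
        have hvu : ∀ y : S.Vstar, (y : F) ∈ S.cell α → v y = (u - fun _ : S.Vstar => U x) y := by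
          intro y hy
          have := (hN n hn α (hs hα) y hy x (hx α hα)).le
          rw [Real.dist_eq] at this
          rw [hv, ← hUr]
          exact ResistanceForm.clamp_of_abs_le this
        rw [cellDisc_congr hvu hvu]
        simp [cellDisc]
    _ ≤ ∑ α ∈ S.lvl n, S.cellDisc E k α v v :=
        Finset.sum_le_sum_of_subset_of_nonneg hs fun _ _ _ => cellDisc_self_nonneg v
    _ = E.disc (S.Vlvl k) v v := (disc_eq_sum_cells hlocal (hst.separates le_rfl) v v).symm
    _ ≤ E.form v v := ResistanceForm.disc_self_le_form (S.exhausts.nonempty k) hvm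
    _ < ε := hvE

variable (S E) in
/-- The integral of `φ` with respect to the discrete mutual energy measure of `u` and `v`. -/
noncomputable def edgeSum (k : ℕ) (u v : S.Vstar → ℝ) (φ : F → ℝ) : ℝ :=
  (∑ x ∈ S.Vlvl k, ∑ y ∈ S.Vlvl k,
    E.conductance (S.Vlvl k) x y * ((u x - u y) * (v x - v y) * φ x)) / 2

lemma abs_edgeSum_sub_le (hlocal : S.IsLocal E) (hsep : S.Separates m k) (u v : S.Vstar → ℝ)
    {φ : F → ℝ} {p : A → F} (hp : ∀ β ∈ S.lvl m, p β ∈ S.cell β) {η : ℝ}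
    (hφ : ∀ β ∈ S.lvl m, ∀ x ∈ S.cell β, ∀ y ∈ S.cell β, |φ x - φ y| ≤ η) :
    |S.edgeSum E k u v φ - ∑ β ∈ S.lvl m, φ (p β) * S.cellDisc E k β u v|
      ≤ η * ((E.disc (S.Vlvl k) u u + E.disc (S.Vlvl k) v v) / 2) := by
  have h1 : S.edgeSum E k u v φ = ∑ β ∈ S.lvl m, (∑ x ∈ S.Vin k β, ∑ y ∈ S.Vin k β,
      E.conductance (S.Vlvl k) x y * ((u x - u y) * (v x - v y) * φ x)) / 2 := by
    have h0 := sum_conductance_eq_sum_below hlocal S.root_mem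
      (Nat.zero_le m) hsep (T := fun x y => (u x - u y) * (v x - v y) * φ x) (by simp)
    rw [Vin_root, below_root] at h0
    rw [edgeSum, ← Finset.sum_div, h0]
  rw [h1, ← Finset.sum_sub_distrib, disc_eq_sum_cells hlocal hsep, disc_eq_sum_cells hlocal hsep,
    ← Finset.sum_add_distrib, Finset.sum_div, Finset.mul_sum]
  refine (Finset.abs_sum_le_sum_abs _ _).trans (Finset.sum_le_sum fun β hβ => ?_)
  have h2 : (∑ x ∈ S.Vin k β, ∑ y ∈ S.Vin k β, E.conductance (S.Vlvl k) x y *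
      ((u x - u y) * (v x - v y) * φ x)) / 2 - φ (p β) * S.cellDisc E k β u v
      = (∑ x ∈ S.Vin k β, ∑ y ∈ S.Vin k β, E.conductance (S.Vlvl k) x y *
        ((u x - u y) * (v x - v y) * (φ x - φ (p β)))) / 2 := by
    rw [cellDisc, mul_div_assoc', ← sub_div, Finset.mul_sum, ← Finset.sum_sub_distrib]
    congr 1
    refine Finset.sum_congr rfl fun x _ => ?_
    rw [Finset.mul_sum, ← Finset.sum_sub_distrib]
    exact Finset.sum_congr rfl fun y _ => by ring
  have h3 : η * ((S.cellDisc E k β u u + S.cellDisc E k β v v) / 2)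
      = (∑ x ∈ S.Vin k β, ∑ y ∈ S.Vin k β, E.conductance (S.Vlvl k) x y *
        (η * (((u x - u y) ^ 2 + (v x - v y) ^ 2) / 2))) / 2 := by
    rw [cellDisc, cellDisc, ← add_div, ← Finset.sum_add_distrib, mul_div_assoc', mul_div_assoc',
      Finset.mul_sum, Finset.sum_div]
    congr 1
    refine Finset.sum_congr rfl fun x _ => ?_
    rw [← Finset.sum_add_distrib, Finset.mul_sum, Finset.sum_div]
    exact Finset.sum_congr rfl fun y _ => by ring
  rw [h2, h3, abs_div, abs_two]
  gcongr
  refine (Finset.abs_sum_le_sum_abs _ _).trans (Finset.sum_le_sum fun x hx => ?_)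
  refine (Finset.abs_sum_le_sum_abs _ _).trans (Finset.sum_le_sum fun y _ => ?_)
  by_cases hxy : x = y
  · simp [hxy]
  have hc := ResistanceForm.conductance_nonneg (E := E) (mem_Vin.1 hx).1 hxy
  rw [abs_mul, abs_of_nonneg hc]
  refine mul_le_mul_of_nonneg_left ?_ hc
  rw [abs_mul, mul_comm η]
  refine mul_le_mul ?_ (hφ β hβ x (mem_Vin.1 hx).2 _ (hp β hβ)) (abs_nonneg _) (by positivity)
  rw [abs_mul, ← sq_abs (u x - u y), ← sq_abs (v x - v y)]
  nlinarith [sq_nonneg (|u x - u y| - |v x - v y|)]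

lemma exists_points (S : FinitelyRamified F A) : ∃ p : A → F, ∀ β, p β ∈ S.cell β := by
  choose p hp using fun β => (S.cell_connected β).nonempty
  exact ⟨p, hp⟩

/-- Discrete mutual energy measures of harmonic functions converge weakly; the limits are
approximated by Riemann sums over cells. -/
lemma abs_edgeSum_sub_harmForm_le (hlocal : S.IsLocal E) {u v : S.Vstar → ℝ}
    (hu : S.IsHarmonic E u) (hv : S.IsHarmonic E v) (hst : S.Stable m k)
    {φ : F → ℝ} {p : A → F} (hp : ∀ β ∈ S.lvl m, p β ∈ S.cell β) {η : ℝ}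
    (hφ : ∀ β ∈ S.lvl m, ∀ x ∈ S.cell β, ∀ y ∈ S.cell β, |φ x - φ y| ≤ η) :
    |S.edgeSum E k u v φ - ∑ β ∈ S.lvl m, φ (p β) * S.harmForm E β u v|
      ≤ η * ((E.form u u + E.form v v) / 2) := by
  have h := abs_edgeSum_sub_le hlocal (hst.separates le_rfl) u v hp hφ
  rw [disc_of_harmonic hu hu, disc_of_harmonic hv hv] at h
  rwa [Finset.sum_congr rfl fun β hβ => by rw [harmForm_eq hlocal hβ hst hu hv]]

end Harmonic

end FinitelyRamified

/-- A pointwise convergent sequence of positive functionals on continuous functions is represented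
in the limit by a finite measure. -/
lemma exists_measure_of_tendsto {F : Type*} [MetricSpace F] [CompactSpace F] [MeasurableSpace F]
    [BorelSpace F] (s : ℕ → (F → ℝ) → ℝ) (hadd : ∀ k φ χ, s k (φ + χ) = s k φ + s k χ)
    (hsmul : ∀ k (c : ℝ) φ, s k (c • φ) = c * s k φ) (hnonneg : ∀ k φ, 0 ≤ φ → 0 ≤ s k φ)
    (hconv : ∀ φ, Continuous φ → ∃ L, Tendsto (fun k => s k φ) atTop (𝓝 L)) :
    ∃ μ : Measure F, IsFiniteMeasure μ ∧
      ∀ φ, Continuous φ → Tendsto (fun k => s k φ) atTop (𝓝 (∫ x, φ x ∂μ)) := by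
  choose! L hL using hconv
  let ℓ : CompactlySupportedContinuousMap F ℝ →ₗ[ℝ] ℝ :=
    { toFun := fun φ => L φ
      map_add' := fun φ χ => by
        refine tendsto_nhds_unique (hL _ (φ + χ).continuous) ?_
        refine ((hL _ φ.continuous).add (hL _ χ.continuous)).congr fun k => ?_
        exact (hadd k φ χ).symm
      map_smul' := fun c φ => by
        refine tendsto_nhds_unique (hL _ (c • φ).continuous) ?_
        refine ((hL _ φ.continuous).const_mul c).congr fun k => ?_
        exact (hsmul k c φ).symm }
  let Λ : CompactlySupportedContinuousMap F ℝ →ₚ[ℝ] ℝ := PositiveLinearMap.mk₀ ℓ fun φ hφ =>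
    ge_of_tendsto' (hL _ φ.continuous) fun k => hnonneg k φ hφ
  refine ⟨RealRMK.rieszMeasure Λ, inferInstance, fun φ hφ => ?_⟩
  let φ' : CompactlySupportedContinuousMap F ℝ :=
    { toFun := φ
      continuous_toFun := hφ
      hasCompactSupport' := HasCompactSupport.of_compactSpace _ }
  have h : ∫ x, φ x ∂(RealRMK.rieszMeasure Λ) = L φ := RealRMK.integral_rieszMeasure Λ φ'
  rw [h]
  exact hL φ hφ

lemma exists_tendsto_of_forall_approx {s : ℕ → ℝ}
    (h : ∀ ε > 0, ∃ a, ∀ᶠ k in atTop, |s k - a| ≤ ε) : ∃ L, Tendsto s atTop (𝓝 L) := by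
  refine cauchySeq_tendsto_of_complete (Metric.cauchySeq_iff.2 fun ε hε => ?_)
  obtain ⟨a, ha⟩ := h (ε / 3) (by positivity)
  obtain ⟨N, hN⟩ := eventually_atTop.1 ha
  refine ⟨N, fun m hm n hn => ?_⟩
  have h1 := hN m hm
  have h2 := hN n hn
  rw [Real.dist_eq]
  rw [abs_le] at h1 h2
  rw [abs_lt]
  constructor <;> linarith

namespace FinitelyRamified

section Measures

variable {F : Type*} [MetricSpace F] [CompactSpace F] {A : Type*} {S : FinitelyRamified F A}
  {E : ResistanceForm S.Vstar} {n m k l : ℕ} {α β γ : A}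

lemma edgeSum_add (u v : S.Vstar → ℝ) (φ χ : F → ℝ) :
    S.edgeSum E k u v (φ + χ) = S.edgeSum E k u v φ + S.edgeSum E k u v χ := by
  simp only [edgeSum, ← add_div, ← Finset.sum_add_distrib, Pi.add_apply, mul_add]

lemma edgeSum_smul (u v : S.Vstar → ℝ) (c : ℝ) (φ : F → ℝ) :
    S.edgeSum E k u v (c • φ) = c * S.edgeSum E k u v φ := by
  simp only [edgeSum, smul_eq_mul, mul_div_assoc', Finset.mul_sum, Pi.smul_apply]
  congr 1
  exact Finset.sum_congr rfl fun x _ => Finset.sum_congr rfl fun y _ => by ring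

lemma edge_term_nonneg {x y : S.Vstar} (hx : x ∈ S.Vlvl k) (u : S.Vstar → ℝ) {φ : F → ℝ}
    (hφ : ∀ x, 0 ≤ φ x) :
    0 ≤ E.conductance (S.Vlvl k) x y * ((u x - u y) * (u x - u y) * φ x) :=
  ResistanceForm.conductance_mul_nonneg hx (mul_nonneg (mul_self_nonneg _) (hφ x))
    fun h => by simp [h]

lemma edgeSum_self_nonneg (u : S.Vstar → ℝ) {φ : F → ℝ} (hφ : ∀ x, 0 ≤ φ x) :
    0 ≤ S.edgeSum E k u u φ :=
  div_nonneg (Finset.sum_nonneg fun _ hx => Finset.sum_nonneg fun _ _ =>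
    edge_term_nonneg hx u hφ) two_pos.le

lemma edgeSum_one (u v : S.Vstar → ℝ) :
    S.edgeSum E k u v (fun _ => 1) = E.disc (S.Vlvl k) u v := by
  simp only [edgeSum, ResistanceForm.disc, mul_one, mul_assoc]

lemma cellDisc_le_edgeSum (u : S.Vstar → ℝ) {φ : F → ℝ} (hφ : ∀ x, 0 ≤ φ x)
    (h1 : ∀ x ∈ S.cell α, φ x = 1) : S.cellDisc E k α u u ≤ S.edgeSum E k u u φ := by
  have hsub : S.Vin k α ⊆ S.Vlvl k := fun x hx => (mem_Vin.1 hx).1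
  unfold cellDisc edgeSum
  gcongr ?_ / 2
  calc _ = ∑ x ∈ S.Vin k α, ∑ y ∈ S.Vin k α,
        E.conductance (S.Vlvl k) x y * ((u x - u y) * (u x - u y) * φ x) :=
        Finset.sum_congr rfl fun x hx => Finset.sum_congr rfl fun y _ => by
          rw [h1 x (mem_Vin.1 hx).2]; ring
    _ ≤ ∑ x ∈ S.Vin k α, ∑ y ∈ S.Vlvl k,
        E.conductance (S.Vlvl k) x y * ((u x - u y) * (u x - u y) * φ x) :=
        Finset.sum_le_sum fun x hx => Finset.sum_le_sum_of_subset_of_nonneg hsub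
          fun y _ _ => edge_term_nonneg (hsub hx) u hφ
    _ ≤ _ := Finset.sum_le_sum_of_subset_of_nonneg hsub
          fun x hx _ => Finset.sum_nonneg fun y _ => edge_term_nonneg hx u hφ

lemma edgeSum_le_sum_cellDisc (hlocal : S.IsLocal E) (hsep : S.Separates m k) (u : S.Vstar → ℝ)
    {φ : F → ℝ} (hφ : ∀ x, φ x ≤ 1) {s : Finset A} (hs : s ⊆ S.lvl m)
    (h0 : ∀ β ∈ S.lvl m, β ∉ s → ∀ x ∈ S.cell β, φ x = 0) :
    S.edgeSum E k u u φ ≤ ∑ β ∈ s, S.cellDisc E k β u u := by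
  have h1 := sum_conductance_eq_sum_below hlocal S.root_mem
    (Nat.zero_le m) hsep (T := fun x y => (u x - u y) * (u x - u y) * φ x) (by simp)
  rw [Vin_root, below_root] at h1
  rw [edgeSum, h1, Finset.sum_div, ← Finset.sum_subset hs]
  · refine Finset.sum_le_sum fun β _ => ?_
    rw [cellDisc]
    gcongr ?_ / 2
    refine Finset.sum_le_sum fun x hx => Finset.sum_le_sum fun y _ => ?_
    have := ResistanceForm.conductance_mul_nonneg (E := E) (mem_Vin.1 hx).1 (y := y)
      (mul_nonneg (mul_self_nonneg (u x - u y)) (sub_nonneg.2 (hφ x))) fun h => by simp [h]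
    nlinarith
  · intro β hβ hβs
    rw [Finset.sum_eq_zero, zero_div]
    intro x hx
    refine Finset.sum_eq_zero fun y _ => ?_
    rw [h0 β hβ hβs x (mem_Vin.1 hx).2]; ring

lemma eventually_abs_edgeSum_sub_le (hlocal : S.IsLocal E) {u v : S.Vstar → ℝ}
    (hu : S.IsHarmonic E u) (hv : S.IsHarmonic E v) {φ : F → ℝ} (hφ : Continuous φ) {ε : ℝ}
    (hε : 0 < ε) : ∃ N, ∀ m ≥ N, ∀ p : A → F, (∀ β, p β ∈ S.cell β) →
      ∀ᶠ k in atTop, |S.edgeSum E k u v φ - ∑ β ∈ S.lvl m, φ (p β) * S.harmForm E β u v| ≤ ε := by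
  set C := (E.form u u + E.form v v) / 2 with hC
  have hC0 : 0 ≤ C := by
    have := E.nonneg u hu.mem; have := E.nonneg v hv.mem; positivity
  obtain ⟨N, hN⟩ := S.exists_oscillation_lt hφ (ε := ε / (C + 1)) (by positivity)
  refine ⟨N, fun m hm p hp => ?_⟩
  filter_upwards [S.eventually_stable m] with k hk
  refine (abs_edgeSum_sub_harmForm_le hlocal hu hv hk (fun β _ => hp β)
    (η := ε / (C + 1)) (fun β hβ x hx y hy => (hN m hm β hβ x hx y hy).le)).trans ?_
  rw [← hC, div_mul_eq_mul_div, div_le_iff₀ (by positivity)]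
  nlinarith

lemma exists_tendsto_edgeSum (hlocal : S.IsLocal E) {u v : S.Vstar → ℝ}
    (hu : S.IsHarmonic E u) (hv : S.IsHarmonic E v) {φ : F → ℝ} (hφ : Continuous φ) :
    ∃ L, Tendsto (fun k => S.edgeSum E k u v φ) atTop (𝓝 L) := by
  obtain ⟨p, hp⟩ := S.exists_points
  refine exists_tendsto_of_forall_approx fun ε hε => ?_
  obtain ⟨N, hN⟩ := eventually_abs_edgeSum_sub_le hlocal hu hv hφ hε
  exact ⟨_, hN N le_rfl p hp⟩

variable [MeasurableSpace F] [BorelSpace F]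

lemma measurableSet_cell (α : A) : MeasurableSet (S.cell α) :=
  (S.cell_compact α).measurableSet

lemma cell_eq_biUnion_below (hα : α ∈ S.lvl n) (hnm : n ≤ m) :
    S.cell α = ⋃ β ∈ S.below m α, S.cell β := by
  ext x
  simp only [Set.mem_iUnion, exists_prop]
  constructor
  · intro hx
    obtain ⟨β, hβ, hβα, hxβ⟩ := exists_descendant hα hnm hx
    exact ⟨β, mem_below.2 ⟨hβ, hβα⟩, hxβ⟩
  · rintro ⟨β, hβ, hxβ⟩
    exact (mem_below.1 hβ).2 hxβ

lemma measure_inter_cell {μ : Measure F} [NullSingletonClass μ] (hα : α ∈ S.lvl n) (hβ : β ∈ S.lvl n)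
    (h : α ≠ β) : μ (S.cell α ∩ S.cell β) = 0 :=
  (inter_finite hα hβ h).measure_zero μ

lemma measureReal_cell_eq_sum_below {μ : Measure F} [IsFiniteMeasure μ] [NullSingletonClass μ]
    (hα : α ∈ S.lvl n) (hnm : n ≤ m) :
    μ.real (S.cell α) = ∑ β ∈ S.below m α, μ.real (S.cell β) := by
  rw [cell_eq_biUnion_below hα hnm]
  refine measureReal_biUnion_finset₀ (fun β hβ γ hγ h => ?_)
    (fun β _ => (measurableSet_cell β).nullMeasurableSet)
  exact measure_inter_cell (mem_below.1 hβ).1 (mem_below.1 hγ).1 h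

lemma exists_isEnergyMeasure (hlocal : S.IsLocal E) (hcont : S.HarmonicContinuous E)
    {u : S.Vstar → ℝ} (hu : S.IsHarmonic E u) :
    ∃ μ : Measure F, S.IsEnergyMeasure E u μ := by
  obtain ⟨μ, hfin, hμ⟩ := exists_measure_of_tendsto (fun k φ => S.edgeSum E k u u φ)
    (fun k => edgeSum_add u u) (fun k => edgeSum_smul u u)
    (fun k φ hφ => edgeSum_self_nonneg u hφ)
    (fun φ hφ => exists_tendsto_edgeSum hlocal hu hu hφ)
  have hint : ∀ {φ : F → ℝ}, Continuous φ → Integrable φ μ := fun hφ =>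
    hφ.integrable_of_hasCompactSupport (HasCompactSupport.of_compactSpace _)
  have hge : ∀ α, S.cellTrace E α u ≤ μ.real (S.cell α) := by
    intro α
    by_contra! hlt
    have hlt' : μ (S.cell α) < ENNReal.ofReal (S.cellTrace E α u) := by
      rwa [measureReal_def, ENNReal.lt_ofReal_iff_toReal_lt (measure_ne_top _ _)] at *
    obtain ⟨O, hO, hOo, hOlt⟩ := Set.exists_isOpen_lt_of_lt _ _ hlt'
    obtain ⟨φ, hφ0, hφ1, hφ⟩ := exists_continuous_zero_one_of_isClosed
      (isClosed_compl_iff.2 hOo) (S.cell_compact α).isClosed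
      (Set.disjoint_compl_left_iff_subset.2 hO)
    obtain ⟨n, hα⟩ := S.lvl_exhaust α
    have h1 : S.cellTrace E α u ≤ ∫ x, φ x ∂μ := by
      refine ge_of_tendsto (hμ φ φ.continuous) ?_
      filter_upwards [S.eventually_stable n] with k hk
      rw [cellTrace_of_harmonic hlocal hα hk hu]
      exact cellDisc_le_edgeSum u (fun x => (hφ x).1) fun x hx => hφ1 hx
    have h2 : ∫ x, φ x ∂μ ≤ μ.real O := by
      rw [← integral_indicator_one hOo.measurableSet]
      refine integral_mono (hint φ.continuous)
        ((integrable_const (1 : ℝ)).indicator hOo.measurableSet) fun x => ?_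
      by_cases hx : x ∈ O
      · simpa [hx] using (hφ x).2
      · simpa [hx] using (hφ0 hx).le
    rw [ENNReal.lt_ofReal_iff_toReal_lt (measure_ne_top _ _)] at hOlt
    exact absurd (h1.trans h2) (not_le.2 hOlt)
  have hatom : ∀ x, μ {x} = 0 := by
    classical
    intro x
    rw [← measureReal_eq_zero_iff]
    refine le_antisymm (le_of_forall_pos_le_add fun ε hε => ?_) measureReal_nonneg
    rw [zero_add]
    obtain ⟨N, hN⟩ := exists_sum_cellTrace_lt hlocal hcont hu x hε
    set s := (S.lvl N).filter (fun α => x ∈ S.cell α) with hs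
    have hK : IsClosed (⋃ β ∈ S.lvl N \ s, S.cell β) :=
      Set.Finite.isClosed_biUnion (Finset.finite_toSet _) fun β _ => (S.cell_compact β).isClosed
    obtain ⟨φ, hφ0, hφ1, hφ⟩ := exists_continuous_zero_one_of_isClosed
      hK (isClosed_singleton (x := x)) (by
        rw [Set.disjoint_singleton_right]
        simp only [Set.mem_iUnion, not_exists]
        intro β hβ hx
        rw [Finset.mem_sdiff, hs, Finset.mem_filter] at hβ
        exact hβ.2 ⟨hβ.1, hx⟩)
    have h1 : μ.real {x} ≤ ∫ y, φ y ∂μ := by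
      rw [← integral_indicator_one (measurableSet_singleton x)]
      refine integral_mono ((integrable_const (1 : ℝ)).indicator (measurableSet_singleton x))
        (hint φ.continuous) fun y => ?_
      by_cases hy : y = x
      · subst hy; simp [hφ1 rfl]
      · simpa [hy] using (hφ y).1
    refine h1.trans (le_of_tendsto (hμ φ φ.continuous) ?_)
    filter_upwards [S.eventually_stable N] with k hk
    refine (edgeSum_le_sum_cellDisc hlocal (hk.separates le_rfl) u (fun y => (hφ y).2)
      (s := s) (hs ▸ Finset.filter_subset _ _) fun β hβ hβs y hy => hφ0 ?_).trans ?_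
    · exact Set.mem_iUnion₂.2 ⟨β, Finset.mem_sdiff.2 ⟨hβ, hβs⟩, hy⟩
    · rw [Finset.sum_congr rfl fun β hβ => (cellTrace_of_harmonic hlocal
        (Finset.mem_filter.1 hβ).1 hk hu).symm]
      exact (hN N le_rfl s (Finset.filter_subset _ _)
        fun α hα => (Finset.mem_filter.1 hα).2).le
  have : NullSingletonClass μ := ⟨hatom⟩
  refine ⟨μ, hatom, fun α => ?_⟩
  obtain ⟨n, hα⟩ := S.lvl_exhaust α
  have htot : μ.real Set.univ = E.form u u := by
    have h1 := hμ (fun _ => 1) continuous_const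
    simp only [edgeSum_one, disc_of_harmonic hu hu, integral_const, smul_eq_mul, mul_one] at h1
    exact tendsto_nhds_unique h1 tendsto_const_nhds
  have hsum : ∑ β ∈ S.lvl n, S.cellTrace E β u = ∑ β ∈ S.lvl n, μ.real (S.cell β) := by
    rw [← below_root, ← measureReal_cell_eq_sum_below S.root_mem (Nat.zero_le n), S.cell_root,
      htot, ← sum_harmForm (m := n) hlocal hu hu, below_root]
    exact Finset.sum_congr rfl fun β _ => (harmForm_self hlocal hu).symm
  have := (Finset.sum_eq_sum_iff_of_le fun β _ => hge β).1 hsum α hα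
  rw [this, measureReal_def, ENNReal.ofReal_toReal (measure_ne_top _ _)]

lemma generateFrom_cells (S : FinitelyRamified F A) :
    ‹MeasurableSpace F› = MeasurableSpace.generateFrom (Set.range S.cell) := by
  have : Countable A := S.countable
  refine le_antisymm ?_ (MeasurableSpace.generateFrom_le ?_)
  · rw [BorelSpace.measurable_eq (α := F)]
    refine MeasurableSpace.generateFrom_le fun O hO => ?_
    have : O = ⋃ α : {α // S.cell α ⊆ O}, S.cell α.1 := by
      ext x
      simp only [Set.mem_iUnion, Subtype.exists, exists_prop]
      constructor
      · intro hx
        obtain ⟨ε, hε, hball⟩ := Metric.isOpen_iff.1 hO x hx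
        obtain ⟨N, hN⟩ := S.exists_mesh_lt hε
        obtain ⟨α, hα, hxα⟩ := S.exists_cell N x
        exact ⟨α, fun y hy => hball (hN N le_rfl α hα y hy x hxα), hxα⟩
      · rintro ⟨α, hα, hx⟩
        exact hα hx
    rw [this]
    exact MeasurableSet.iUnion fun α => MeasurableSpace.measurableSet_generateFrom ⟨α.1, rfl⟩
  · rintro _ ⟨α, rfl⟩
    exact measurableSet_cell α

lemma cells_inter (S : FinitelyRamified F A) (α β : A) :
    S.cell α ⊆ S.cell β ∨ S.cell β ⊆ S.cell α ∨ (S.cell α ∩ S.cell β).Finite := by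
  have key : ∀ n m α β, n ≤ m → α ∈ S.lvl n → β ∈ S.lvl m →
      S.cell β ⊆ S.cell α ∨ (S.cell α ∩ S.cell β).Finite := by
    intro n m α β hnm hα hβ
    obtain ⟨α', hα', hβα'⟩ := exists_parent hβ hnm
    by_cases h : α = α'
    · exact Or.inl (h ▸ hβα')
    · exact Or.inr ((inter_finite hα hα' h).subset (Set.inter_subset_inter_right _ hβα'))
  obtain ⟨n, hα⟩ := S.lvl_exhaust α
  obtain ⟨m, hβ⟩ := S.lvl_exhaust β
  rcases le_total n m with h | h
  · exact Or.inr (key n m α β h hα hβ)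
  · rcases key m n β α h hβ hα with h' | h'
    · exact Or.inl h'
    · rw [Set.inter_comm] at h'
      exact Or.inr (Or.inr h')

/-- Finite measures without atoms are determined by their values on cells. -/
lemma measure_ext_of_cells {μ μ' : Measure F} [IsFiniteMeasure μ] [NullSingletonClass μ] [NullSingletonClass μ']
    (h : ∀ α, μ (S.cell α) = μ' (S.cell α)) : μ = μ' := by
  refine ext_of_generate_finite (Set.range S.cell ∪ {s : Set F | s.Finite}) ?_ ?_ ?_ ?_
  · refine le_antisymm ?_ (MeasurableSpace.generateFrom_le ?_)
    · rw [generateFrom_cells S]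
      exact MeasurableSpace.generateFrom_mono Set.subset_union_left
    · rintro s (⟨α, rfl⟩ | hs)
      · exact measurableSet_cell α
      · exact hs.measurableSet
  · rintro s (⟨α, rfl⟩ | hs) t (⟨β, rfl⟩ | ht) -
    · rcases cells_inter S α β with h' | h' | h'
      · exact Or.inl ⟨α, (Set.inter_eq_left.2 h').symm⟩
      · exact Or.inl ⟨β, (Set.inter_eq_right.2 h').symm⟩
      · exact Or.inr h'
    · exact Or.inr (ht.inter_of_right _)
    · exact Or.inr (hs.inter_of_left _)
    · exact Or.inr (hs.inter_of_left _)
  · rintro s (⟨α, rfl⟩ | hs)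
    · exact h α
    · rw [hs.measure_zero μ, hs.measure_zero μ']
  · have := h S.root
    rwa [S.cell_root] at this

lemma IsEnergyMeasure.nullSingletonClass {u : S.Vstar → ℝ} {μ : Measure F}
    (h : S.IsEnergyMeasure E u μ) : NullSingletonClass μ := ⟨h.1⟩

lemma IsEnergyMeasure.isFiniteMeasure {u : S.Vstar → ℝ} {μ : Measure F}
    (h : S.IsEnergyMeasure E u μ) : IsFiniteMeasure μ := ⟨by
  rw [← S.cell_root, h.2]; exact ENNReal.ofReal_lt_top⟩

lemma IsEnergyMeasure.unique {u : S.Vstar → ℝ} {μ μ' : Measure F}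
    (h : S.IsEnergyMeasure E u μ) (h' : S.IsEnergyMeasure E u μ') : μ = μ' := by
  have := h.nullSingletonClass
  have := h'.nullSingletonClass
  have := h.isFiniteMeasure
  exact measure_ext_of_cells fun α => by rw [h.2, h'.2]

lemma existsUnique_isKusuokaMeasure (hlocal : S.IsLocal E) (hcont : S.HarmonicContinuous E)
    {d : ℕ} {h : Fin d → S.Vstar → ℝ} (hharm : ∀ i, S.IsHarmonic E (h i)) :
    ∃ ν : Measure F, S.IsKusuokaMeasure E h ν ∧ ∀ ν', S.IsKusuokaMeasure E h ν' → ν' = ν := by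
  choose μ hμ using fun i => exists_isEnergyMeasure hlocal hcont (hharm i)
  refine ⟨∑ i, μ i, ⟨μ, hμ, rfl⟩, ?_⟩
  rintro ν' ⟨μ', hμ', rfl⟩
  exact Finset.sum_congr rfl fun i _ => (hμ' i).unique (hμ i)

lemma IsKusuokaMeasure.nullSingletonClass {d : ℕ} {h : Fin d → S.Vstar → ℝ} {ν : Measure F}
    (hν : S.IsKusuokaMeasure E h ν) : NullSingletonClass ν := by
  obtain ⟨μ, hμ, rfl⟩ := hν
  exact ⟨fun x => by simp [(hμ _).1 x]⟩

lemma IsKusuokaMeasure.isFiniteMeasure {d : ℕ} {h : Fin d → S.Vstar → ℝ} {ν : Measure F}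
    (hν : S.IsKusuokaMeasure E h ν) : IsFiniteMeasure ν := by
  obtain ⟨μ, hμ, rfl⟩ := hν
  have := fun i => (hμ i).isFiniteMeasure
  infer_instance

lemma IsKusuokaMeasure.measureReal_cell (hlocal : S.IsLocal E) {d : ℕ} {h : Fin d → S.Vstar → ℝ}
    (hharm : ∀ i, S.IsHarmonic E (h i)) {ν : Measure F}
    (hν : S.IsKusuokaMeasure E h ν) (α : A) :
    ν.real (S.cell α) = ∑ i, S.cellTrace E α (h i) := by
  obtain ⟨μ, hμ, rfl⟩ := hν
  rw [measureReal_def, Measure.finsetSum_apply, ENNReal.toReal_sum]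
  · exact Finset.sum_congr rfl fun i _ => by
      rw [(hμ i).2, ENNReal.toReal_ofReal (cellTrace_nonneg hlocal (hharm i))]
  · intro i _
    rw [(hμ i).2]; exact ENNReal.ofReal_ne_top

end Measures

end FinitelyRamified

namespace FinitelyRamified

section Density

variable {F : Type*} [MetricSpace F] [CompactSpace F] {A : Type*} {S : FinitelyRamified F A}
  {E : ResistanceForm S.Vstar} {n m k l : ℕ} {α β γ : A}

lemma sum_lvl_eq_sum_below {M : Type*} [AddCommMonoid M] (hnm : n ≤ m) (a : A → M) :
    ∑ β ∈ S.lvl m, a β = ∑ α ∈ S.lvl n, ∑ β ∈ S.below m α, a β := by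
  classical
  rw [← Finset.sum_biUnion]
  · refine Finset.sum_congr ?_ fun _ _ => rfl
    ext β
    simp only [Finset.mem_biUnion, mem_below]
    constructor
    · intro hβ
      obtain ⟨α, hα, hβα⟩ := exists_parent hβ hnm
      exact ⟨α, hα, hβ, hβα⟩
    · rintro ⟨_, _, hβ, _⟩
      exact hβ
  · intro α hα α' hα' hne
    rw [Function.onFun, Finset.disjoint_left]
    intro β hβ hβ'
    exact hne (eq_of_subset hα hα' (mem_below.1 hβ).2 (mem_below.1 hβ').2)

lemma eq_of_mem_cell {x : F} (hx : x ∉ S.Vstar) (hα : α ∈ S.lvl n) (hβ : β ∈ S.lvl n)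
    (hxα : x ∈ S.cell α) (hxβ : x ∈ S.cell β) : α = β := by
  by_contra h
  exact hx (mem_Vstar (mem_Vlvl_of_mem_two hα hβ h hxα hxβ))

variable (S) in
/-- The function with the value `c α` on the cells of level `n`. -/
noncomputable def stepFun (n : ℕ) (c : A → ℝ) (x : F) : ℝ :=
  ∑ α ∈ S.lvl n, (S.cell α).indicator (fun _ => c α) x

lemma stepFun_apply {x : F} (hx : x ∉ S.Vstar) (hα : α ∈ S.lvl n) (hxα : x ∈ S.cell α)
    (c : A → ℝ) : S.stepFun n c x = c α := by
  rw [stepFun, Finset.sum_eq_single α, Set.indicator_of_mem hxα]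
  · intro β hβ hne
    exact Set.indicator_of_notMem (fun h => hne (eq_of_mem_cell hx hβ hα h hxα)) _
  · exact fun h => absurd hα h

variable [MeasurableSpace F] [BorelSpace F]

lemma ae_notMem_Vstar (S : FinitelyRamified F A) (ν : Measure F) [NullSingletonClass ν] :
    ∀ᵐ x ∂ν, x ∉ S.Vstar := by
  have : Countable A := S.countable
  have hc : S.Vstar.Countable := Set.countable_iUnion fun α => (S.vert α).countable_toSet
  exact (measure_eq_zero_iff_ae_notMem).1 (hc.measure_zero ν)

lemma integral_stepFun_mul {ν : Measure F} {z : F → ℝ} (hz : Integrable z ν) (c : A → ℝ) :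
    ∫ x, S.stepFun n c x * z x ∂ν = ∑ α ∈ S.lvl n, c α * ∫ x in S.cell α, z x ∂ν := by
  simp only [stepFun, Finset.sum_mul]
  have h : ∀ α x, (S.cell α).indicator (fun _ => c α) x * z x
      = (S.cell α).indicator (fun x => c α * z x) x := by
    intro α x
    by_cases hx : x ∈ S.cell α <;> simp [hx]
  simp only [h]
  rw [integral_finsetSum _ fun α _ => (hz.const_mul (c α)).indicator (measurableSet_cell α)]
  refine Finset.sum_congr rfl fun α _ => ?_
  rw [integral_indicator (measurableSet_cell α), integral_const_mul]

lemma setIntegral_stepFun {ν : Measure F} [IsFiniteMeasure ν] (c : A → ℝ) (s : Set F) :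
    ∫ x in s, S.stepFun n c x ∂ν = ∑ α ∈ S.lvl n, c α * ν.real (S.cell α ∩ s) := by
  have h := integral_stepFun_mul (S := S) (n := n) (ν := ν.restrict s)
    (integrable_const (1 : ℝ)) c
  simp only [mul_one] at h
  rw [h]
  refine Finset.sum_congr rfl fun α _ => ?_
  rw [Measure.restrict_restrict (measurableSet_cell α)]
  simp

lemma measurable_stepFun (c : A → ℝ) : Measurable (S.stepFun n c) :=
  Finset.measurable_fun_sum _ fun α _ => measurable_const.indicator (measurableSet_cell α)

lemma ae_abs_stepFun_le {ν : Measure F} [NullSingletonClass ν] {c : A → ℝ} {C : ℝ}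
    (hc : ∀ α ∈ S.lvl n, |c α| ≤ C) : ∀ᵐ x ∂ν, |S.stepFun n c x| ≤ C := by
  filter_upwards [ae_notMem_Vstar S ν] with x hx
  obtain ⟨α, hα, hxα⟩ := S.exists_cell n x
  rw [stepFun_apply hx hα hxα]
  exact hc α hα

lemma integrable_of_ae_abs_le {ν : Measure F} [IsFiniteMeasure ν] {z : F → ℝ} {C : ℝ}
    (hz : Measurable z) (h : ∀ᵐ x ∂ν, |z x| ≤ C) : Integrable z ν :=
  Integrable.of_bound hz.aestronglyMeasurable C h

variable (S) in
/-- The filtration generated by the cells. -/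
def cellFiltration : Filtration ℕ ‹MeasurableSpace F› where
  seq n := MeasurableSpace.generateFrom {s | ∃ k ≤ n, ∃ α ∈ S.lvl k, s = S.cell α}
  mono' := fun _ _ hnm => MeasurableSpace.generateFrom_mono
    fun _ ⟨k, hk, h⟩ => ⟨k, hk.trans hnm, h⟩
  le' := fun _ => MeasurableSpace.generateFrom_le fun _ ⟨_, _, α, _, hs⟩ =>
    hs ▸ measurableSet_cell α

/-- Up to null sets, an event of the filtration contains a cell or is disjoint from it. -/
lemma cellFiltration_dichotomy {ν : Measure F} [NullSingletonClass ν] {s : Set F}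
    (hs : MeasurableSet[S.cellFiltration n] s) (hα : α ∈ S.lvl n) :
    ν (S.cell α ∩ s) = 0 ∨ ν (S.cell α \ s) = 0 := by
  induction s, hs using MeasurableSpace.generateFrom_induction with
  | hC t ht _ =>
    obtain ⟨k, hk, γ, hγ, rfl⟩ := ht
    obtain ⟨γ', hγ', hαγ'⟩ := exists_parent hα hk
    by_cases h : γ = γ'
    · right
      rw [h, Set.sdiff_eq_empty.2 hαγ', measure_empty]
    · left
      exact ((inter_finite hγ' hγ (Ne.symm h)).subset
        (Set.inter_subset_inter_left _ hαγ')).measure_zero ν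
  | empty => simp
  | compl t _ ih =>
    rw [← Set.sdiff_eq, Set.sdiff_compl]
    exact ih.symm
  | iUnion f _ ih =>
    by_cases h : ∃ i, ν (S.cell α \ f i) = 0
    · obtain ⟨i, hi⟩ := h
      exact Or.inr (measure_mono_null (Set.sdiff_subset_sdiff_right (Set.subset_iUnion f i)) hi)
    · left
      rw [Set.inter_iUnion]
      exact measure_iUnion_null fun i => (ih i).resolve_right fun hi => h ⟨i, hi⟩

/-- The Radon-Nikodym derivative of an additive function of cells that is dominated by `ν`, as a
martingale limit. -/
lemma exists_density {ν : Measure F} [IsFiniteMeasure ν] [NullSingletonClass ν] {a : A → ℝ}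
    (hadd : ∀ n, ∀ α ∈ S.lvl n, ∀ m ≥ n, a α = ∑ β ∈ S.below m α, a β) {C : ℝ}
    (hC : ∀ α, |a α| ≤ C * ν.real (S.cell α)) :
    ∃ z : F → ℝ, Measurable z ∧ (∀ᵐ x ∂ν, |z x| ≤ C) ∧
      (∀ᵐ x ∂ν, Tendsto (fun n => S.stepFun n (fun α => (ν.real (S.cell α))⁻¹ * a α) x) atTop
        (𝓝 (z x))) ∧
      ∀ α, ∫ x in S.cell α, z x ∂ν = a α := by
  set c : A → ℝ := fun α => (ν.real (S.cell α))⁻¹ * a α with hc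
  have ha0 : ∀ α, ν.real (S.cell α) = 0 → a α = 0 := fun α h => by
    have := hC α
    rw [h, mul_zero] at this
    exact abs_eq_zero.1 (le_antisymm this (abs_nonneg _))
  have hcmul : ∀ α, c α * ν.real (S.cell α) = a α := by
    intro α
    by_cases h : ν.real (S.cell α) = 0
    · rw [h, ha0 α h, mul_zero]
    · rw [hc]; field_simp
  have hC0 : 0 ≤ C ∨ ∀ α, ν.real (S.cell α) = 0 := by
    by_cases h : 0 ≤ C
    · exact Or.inl h
    · right
      intro α
      have h1 := (abs_nonneg _).trans (hC α)
      have h2 : 0 ≤ ν.real (S.cell α) := measureReal_nonneg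
      push Not at h
      nlinarith
  rcases hC0 with hC0 | hnull
  swap
  · have hν : ν = 0 := by
      have := hnull S.root
      rwa [S.cell_root, measureReal_eq_zero_iff, Measure.measure_univ_eq_zero] at this
    refine ⟨0, measurable_const, by simp [hν], by simp [hν], fun α => ?_⟩
    rw [ha0 α (hnull α)]; simp
  have hcC : ∀ α, |c α| ≤ C := by
    intro α
    by_cases h : ν.real (S.cell α) = 0
    · simpa [hc, h] using hC0
    · have hpos : 0 < ν.real (S.cell α) := lt_of_le_of_ne measureReal_nonneg (Ne.symm h)
      rw [hc, abs_mul, abs_inv, abs_of_pos hpos, inv_mul_le_iff₀ hpos, mul_comm]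
      exact hC α
  have hae : ∀ n, ∀ᵐ x ∂ν, |S.stepFun n c x| ≤ C := fun n => ae_abs_stepFun_le fun α _ => hcC α
  have hint : ∀ n, Integrable (S.stepFun n c) ν := fun n =>
    integrable_of_ae_abs_le (measurable_stepFun c) (hae n)
  have hadp : StronglyAdapted S.cellFiltration fun n => S.stepFun n c := by
    intro n
    refine Measurable.stronglyMeasurable ?_
    refine Finset.measurable_fun_sum _ fun α hα => measurable_const.indicator ?_
    exact MeasurableSpace.measurableSet_generateFrom ⟨n, le_rfl, α, hα, rfl⟩
  have hmart : Martingale (fun n => S.stepFun n c) S.cellFiltration ν := by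
    refine martingale_nat hadp hint fun n => ?_
    refine ae_eq_condExp_of_forall_setIntegral_eq (S.cellFiltration.le n) (hint (n + 1))
      (fun s _ _ => (hint n).integrableOn) (fun s hs _ => ?_) (hadp n).aestronglyMeasurable
    rw [setIntegral_stepFun, setIntegral_stepFun, sum_lvl_eq_sum_below n.le_succ]
    refine Finset.sum_congr rfl fun α hα => ?_
    rcases cellFiltration_dichotomy (ν := ν) hs hα with h | h
    · rw [measureReal_def, h, ENNReal.toReal_zero, mul_zero, Finset.sum_eq_zero]
      intro β hβ
      rw [measureReal_def, measure_mono_null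
        (Set.inter_subset_inter_left s (mem_below.1 hβ).2) h, ENNReal.toReal_zero, mul_zero]
    · have hfull : ∀ γ, S.cell γ ⊆ S.cell α → ν.real (S.cell γ ∩ s) = ν.real (S.cell γ) := by
        intro γ hγ
        have h0 := measure_mono_null (Set.sdiff_subset_sdiff_left hγ) h
        have h1 := measure_sdiff_null (s := S.cell γ) h0
        rw [Set.sdiff_sdiff_right_self] at h1
        rw [measureReal_def, measureReal_def, ← h1]
      rw [hfull α subset_rfl, hcmul, hadd n α hα (n + 1) n.le_succ]
      exact Finset.sum_congr rfl fun β hβ => by rw [hfull β (mem_below.1 hβ).2, hcmul]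
  obtain ⟨z, hzm, hlim⟩ : ∃ z : F → ℝ, Measurable z ∧
      ∀ᵐ x ∂ν, Tendsto (fun n => S.stepFun n c x) atTop (𝓝 (z x)) := by
    refine measurable_limit_of_tendsto_metrizable_ae
      (fun n => (measurable_stepFun c).aemeasurable) ?_
    refine hmart.submartingale.exists_ae_tendsto_of_bdd
      (R := (ν Set.univ ^ (1 : ENNReal).toReal⁻¹ * ENNReal.ofReal C).toNNReal) fun n => ?_
    rw [ENNReal.coe_toNNReal]
    · exact eLpNorm_le_of_ae_bound (hae n)
    · exact ENNReal.mul_ne_top (by simp) ENNReal.ofReal_ne_top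
  have hzC : ∀ᵐ x ∂ν, |z x| ≤ C := by
    filter_upwards [hlim, ae_all_iff.2 hae] with x hx hb
    exact le_of_tendsto' hx.abs hb
  refine ⟨z, hzm, hzC, hlim, fun α => ?_⟩
  obtain ⟨n₀, hα⟩ := S.lvl_exhaust α
  have h1 : Tendsto (fun n => ∫ x in S.cell α, S.stepFun n c x ∂ν) atTop
      (𝓝 (∫ x in S.cell α, z x ∂ν)) := by
    refine tendsto_integral_of_dominated_convergence (fun _ => C)
      (fun n => (measurable_stepFun c).aestronglyMeasurable) (integrable_const _)
      (fun n => ae_restrict_of_ae (hae n)) (ae_restrict_of_ae hlim)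
  refine tendsto_nhds_unique h1 (tendsto_const_nhds.congr' ?_)
  filter_upwards [eventually_ge_atTop n₀] with n hn
  rw [setIntegral_stepFun, sum_lvl_eq_sum_below hn, Finset.sum_eq_single α]
  · rw [hadd n₀ α hα n hn]
    refine Finset.sum_congr rfl fun β hβ => ?_
    rw [Set.inter_eq_left.2 (mem_below.1 hβ).2, hcmul]
  · intro α' hα' hne
    refine Finset.sum_eq_zero fun β hβ => ?_
    rw [measureReal_def, measure_mono_null
      (Set.inter_subset_inter_left _ (mem_below.1 hβ).2) (measure_inter_cell hα' hα hne),
      ENNReal.toReal_zero, mul_zero]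
  · exact fun h => absurd hα h

/-- Weak convergence of the discrete mutual energy measures to the one with density `z`. -/
lemma tendsto_edgeSum (hlocal : S.IsLocal E) {ν : Measure F} [IsFiniteMeasure ν]
    [NullSingletonClass ν] {u v : S.Vstar → ℝ} (hu : S.IsHarmonic E u) (hv : S.IsHarmonic E v)
    {z : F → ℝ} (hzm : Measurable z) {C : ℝ} (hzC : ∀ᵐ x ∂ν, |z x| ≤ C)
    (hz : ∀ α, ∫ x in S.cell α, z x ∂ν = S.harmForm E α u v) {φ : F → ℝ} (hφ : Continuous φ) :
    Tendsto (fun k => S.edgeSum E k u v φ) atTop (𝓝 (∫ x, φ x * z x ∂ν)) := by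
  obtain ⟨p, hp⟩ := S.exists_points
  have hzi : Integrable z ν := integrable_of_ae_abs_le hzm hzC
  obtain ⟨B, hB⟩ := (HasCompactSupport.of_compactSpace φ).exists_bound_of_continuous hφ
  have hφz : Integrable (fun x => φ x * z x) ν :=
    hzi.bdd_mul hφ.aestronglyMeasurable (c := B) (Eventually.of_forall hB)
  refine Metric.tendsto_atTop.2 fun ε hε => ?_
  set K := |C| * ν.real Set.univ + 1 with hK
  have hK0 : 0 < K := by positivity
  obtain ⟨N₁, hN₁⟩ := eventually_abs_edgeSum_sub_le hlocal hu hv hφ (ε := ε / 3) (by positivity)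
  obtain ⟨N₂, hN₂⟩ := S.exists_oscillation_lt hφ (ε := ε / (3 * K)) (by positivity)
  set m := max N₁ N₂
  obtain ⟨k₀, hk₀⟩ := eventually_atTop.1 (hN₁ m (le_max_left _ _) p hp)
  have h2 : |∫ x, φ x * z x ∂ν - ∑ β ∈ S.lvl m, φ (p β) * S.harmForm E β u v| ≤ ε / 3 := by
    have hstep : Integrable (fun x => S.stepFun m (fun β => φ (p β)) x * z x) ν :=
      hzi.bdd_mul (measurable_stepFun _).aestronglyMeasurable (c := B)
        (ae_abs_stepFun_le fun β _ => hB (p β))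
    have hsum : ∑ β ∈ S.lvl m, φ (p β) * S.harmForm E β u v
        = ∑ β ∈ S.lvl m, φ (p β) * ∫ x in S.cell β, z x ∂ν :=
      Finset.sum_congr rfl fun β _ => by rw [hz β]
    rw [hsum, ← integral_stepFun_mul hzi,
      ← integral_sub hφz hstep]
    have hbd : ∀ᵐ x ∂ν, ‖φ x * z x - S.stepFun m (fun β => φ (p β)) x * z x‖
        ≤ ε / (3 * K) * |C| := by
      filter_upwards [ae_notMem_Vstar S ν, hzC] with x hx hxC
      obtain ⟨β, hβ, hxβ⟩ := S.exists_cell m x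
      rw [stepFun_apply hx hβ hxβ, ← sub_mul, norm_mul]
      exact mul_le_mul (hN₂ m (le_max_right _ _) β hβ x hxβ _ (hp β)).le
        (hxC.trans (le_abs_self C)) (norm_nonneg _) (by positivity)
    refine (norm_integral_le_of_norm_le_const hbd).trans ?_
    rw [mul_assoc, div_mul_eq_mul_div, div_le_div_iff₀ (by positivity) (by positivity)]
    nlinarith
  refine ⟨k₀, fun k hk => ?_⟩
  have h1 := hk₀ k hk
  rw [Real.dist_eq]
  rw [abs_le] at h1 h2
  rw [abs_lt]
  constructor <;> linarith

end Density

section Kusuoka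

variable {F : Type*} [MetricSpace F] [CompactSpace F] {A : Type*} {S : FinitelyRamified F A}
  {E : ResistanceForm S.Vstar} {n m k l : ℕ} {α β γ : A}

/-- Harmonic functions are combinations of constants and an orthonormal system of the right
cardinality. -/
lemma IsHarmonic.exists_coefficients {h : Fin (S.V0.card - 1) → S.Vstar → ℝ}
    (hharm : ∀ i, S.IsHarmonic E (h i))
    (horth : ∀ i j, E.form (h i) (h j) = if i = j then 1 else 0)
    {u : S.Vstar → ℝ} (hu : S.IsHarmonic E u) :
    ∃ (c₀ : ℝ) (c : Fin (S.V0.card - 1) → ℝ), u = (fun _ => c₀) + ∑ l, c l • h l := by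
  let e : Option (Fin (S.V0.card - 1)) → S.V0 → ℝ := fun o => o.elim (fun _ => 1) fun l v => h l v
  have hglob : ∀ (g : Option (Fin (S.V0.card - 1)) → ℝ) (w : S.Vstar → ℝ), S.IsHarmonic E w →
      (∀ v : S.V0, w v = (∑ o, g o • e o) v) →
      w = (fun _ => g none) + ∑ l, g (some l) • h l := by
    intro g w hw hwv
    refine hw.eq_of_V0 ((isHarmonic_const _).add (IsHarmonic.sum _ fun l _ => (hharm l).smul _))
      fun x hx => ?_
    rw [hwv ⟨x, hx⟩, Fintype.sum_option]
    simp [e, Finset.sum_apply]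
  have hli : LinearIndependent ℝ e := by
    rw [Fintype.linearIndependent_iff]
    intro g hg
    have h0 := hglob g (fun _ => 0) (isHarmonic_const 0) fun v => by rw [hg]; rfl
    have hsome : ∀ l, g (some l) = 0 := by
      intro l
      have h1 := E.form_const_right 0 (hharm l).mem
      have hs : ∑ l, g (some l) • h l ∈ E.dom :=
        E.dom.sum_mem fun l _ => E.dom.smul_mem _ (hharm l).mem
      rw [h0, E.add_right (hharm l).mem (E.const_mem _) hs,
        E.form_const_right _ (hharm l).mem, E.symm _ (hharm l).mem _ hs,
        E.sum_left _ _ _ (fun l _ => (hharm l).mem) (hharm l).mem] at h1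
      simpa [horth] using h1
    intro o
    cases o with
    | some l => exact hsome l
    | none =>
      obtain ⟨p, -⟩ := V_nonempty (S := S) S.root
      have := congrFun h0 p
      simpa [hsome] using this.symm
  have hcard : Fintype.card (Option (Fin (S.V0.card - 1))) = Module.finrank ℝ (S.V0 → ℝ) := by
    rw [Fintype.card_option, Fintype.card_fin, Module.finrank_fintype_fun_eq_card,
      Fintype.card_coe]
    exact Nat.sub_add_cancel (Finset.card_pos.2 (V_nonempty S.root))
  have hspan := hli.span_eq_top_of_card_eq_finrank' hcard
  have hmem : (fun v : S.V0 => u v) ∈ Submodule.span ℝ (Set.range e) := hspan ▸ Submodule.mem_top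
  obtain ⟨g, hg⟩ := (Submodule.mem_span_range_iff_exists_fun ℝ).1 hmem
  exact ⟨g none, fun l => g (some l), hglob g u hu fun v => by rw [hg]⟩

lemma cellTrace_le_sum (hlocal : S.IsLocal E) {h : Fin (S.V0.card - 1) → S.Vstar → ℝ}
    (hharm : ∀ i, S.IsHarmonic E (h i))
    (horth : ∀ i j, E.form (h i) (h j) = if i = j then 1 else 0)
    {u : S.Vstar → ℝ} (hu : S.IsHarmonic E u) :
    ∃ C : ℝ, 0 ≤ C ∧ ∀ α, S.cellTrace E α u ≤ C * ∑ l, S.cellTrace E α (h l) := by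
  obtain ⟨c₀, c, huc⟩ := hu.exists_coefficients hharm horth
  refine ⟨∑ l, c l ^ 2, by positivity, fun α => ?_⟩
  obtain ⟨n, hα⟩ := S.lvl_exhaust α
  obtain ⟨k, hst⟩ := (S.eventually_stable n).exists
  rw [cellTrace_of_harmonic hlocal hα hst hu, Finset.sum_congr rfl fun l _ =>
    cellTrace_of_harmonic hlocal hα hst (hharm l), Finset.mul_sum]
  simp only [cellDisc, mul_assoc, ← sq]
  refine ResistanceForm.sum_edges_le_sum (fun x hx => (mem_Vin.1 hx).1) Finset.univ
    (C := fun _ => ∑ l, c l ^ 2) (v := h) fun x _ y _ => ?_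
  have hd : u x - u y = ∑ l, c l * (h l x - h l y) := by
    rw [huc]
    simp [Finset.sum_apply, mul_sub]
  rw [hd, ← Finset.mul_sum]
  exact Finset.sum_mul_sq_le_sq_mul_sq _ _ _

lemma abs_harmForm_le (hlocal : S.IsLocal E) {u v : S.Vstar → ℝ} (hu : S.IsHarmonic E u)
    (hv : S.IsHarmonic E v) (α : A) :
    |S.harmForm E α u v| ≤ (S.cellTrace E α u + S.cellTrace E α v) / 2 := by
  obtain ⟨n, hα⟩ := S.lvl_exhaust α
  obtain ⟨k, hst⟩ := (S.eventually_stable n).exists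
  rw [harmForm_eq hlocal hα hst hu hv, cellTrace_of_harmonic hlocal hα hst hu,
    cellTrace_of_harmonic hlocal hα hst hv]
  have h1 := cellDisc_self_nonneg (E := E) (k := k) (α := α) (u + v)
  have h2 := cellDisc_self_nonneg (E := E) (k := k) (α := α) (u - v)
  have h3 := cellDisc_comm (E := E) (k := k) (α := α) u v
  simp only [← cellDiscₗ_apply] at h1 h2 h3 ⊢
  simp only [map_add, map_sub, LinearMap.add_apply, LinearMap.sub_apply, ← h3] at h1 h2
  rw [abs_le]
  constructor <;> linarith

variable [MeasurableSpace F] [BorelSpace F]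

/-- The matrix density of the mutual energy measures of the harmonic coordinates, as the limit of
the matrices `Z_n`. -/
lemma exists_Z (hlocal : S.IsLocal E) (hcont : S.HarmonicContinuous E)
    {h : Fin (S.V0.card - 1) → S.Vstar → ℝ} (hharm : ∀ i, S.IsHarmonic E (h i))
    (horth : ∀ i j, E.form (h i) (h j) = if i = j then 1 else 0)
    {ν : Measure F} (hν : S.IsKusuokaMeasure E h ν) :
    ∃ Z : F → Matrix S.V0 S.V0 ℝ,
      (∀ᵐ x ∂ν, Tendsto (fun n => S.Zlvl E ν n x) atTop (𝓝 (Z x))) ∧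
      (∀ i j, Measurable fun x => Z x i j) ∧
      (∃ C, ∀ i j, ∀ᵐ x ∂ν, |Z x i j| ≤ C) ∧
      ∀ i j α, ∫ x in S.cell α, Z x i j ∂ν = S.harmForm E α (S.coordRes E i) (S.coordRes E j) := by
  have := hν.isFiniteMeasure
  have := hν.nullSingletonClass
  choose C hC0 hC using fun i => cellTrace_le_sum hlocal hharm horth
    (isHarmonic_coordRes (S := S) (E := E) hcont i)
  set K := ∑ i, C i with hK
  have hbound : ∀ i j α, |S.harmForm E α (S.coordRes E i) (S.coordRes E j)|
      ≤ K * ν.real (S.cell α) := by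
    intro i j α
    refine (abs_harmForm_le hlocal (isHarmonic_coordRes hcont i)
      (isHarmonic_coordRes hcont j) α).trans ?_
    have h1 : ∀ i, S.cellTrace E α (S.coordRes E i) ≤ K * ν.real (S.cell α) := fun i => by
      refine (hC i α).trans ?_
      rw [hν.measureReal_cell hlocal hharm]
      exact mul_le_mul_of_nonneg_right (Finset.single_le_sum (fun i _ => hC0 i)
        (Finset.mem_univ i)) (Finset.sum_nonneg fun l _ => cellTrace_nonneg hlocal (hharm l))
    linarith [h1 i, h1 j]
  choose z hzm hzK hzlim hzint using fun i j => exists_density (S := S) (ν := ν)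
    (a := fun α => S.harmForm E α (S.coordRes E i) (S.coordRes E j))
    (fun n α hα m hm => harmForm_eq_sum_below hlocal hα hm (isHarmonic_coordRes hcont i)
      (isHarmonic_coordRes hcont j)) (hbound i j)
  refine ⟨fun x => Matrix.of fun i j => z i j x, ?_, hzm, ⟨K, hzK⟩, hzint⟩
  have hall : ∀ᵐ x ∂ν, ∀ i j, Tendsto (fun n => S.stepFun n (fun α => (ν.real (S.cell α))⁻¹ *
      S.harmForm E α (S.coordRes E i) (S.coordRes E j)) x) atTop (𝓝 (z i j x)) :=
    ae_all_iff.2 fun i => ae_all_iff.2 fun j => hzlim i j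
  filter_upwards [hall, ae_notMem_Vstar S ν] with x hx hxV
  refine tendsto_pi_nhds.2 fun i => tendsto_pi_nhds.2 fun j => (hx i j).congr fun n => ?_
  rw [Zlvl, stepFun, Matrix.sum_apply]
  refine Finset.sum_congr rfl fun α _ => ?_
  by_cases hxα : x ∈ S.cell α
  · rw [Set.indicator_of_mem hxα, if_pos ⟨hxα, fun h => hxV (mem_Vstar h)⟩,
      Zcell_apply hlocal hcont]
  · rw [Set.indicator_of_notMem hxα, if_neg fun h => hxα h.1, Matrix.zero_apply]

end Kusuoka

end FinitelyRamified

section Taylor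

variable {V : Type*} [NormedAddCommGroup V] [NormedSpace ℝ V]

/-- Second order Taylor expansion, uniformly on balls. -/
lemma exists_taylor_two [ProperSpace V] {f : V → ℝ} (hf : ContDiff ℝ 2 f) (R : ℝ)
    {η : ℝ} (hη : 0 < η) :
    ∃ δ > 0, ∀ x ∈ Metric.closedBall (0 : V) R, ∀ y ∈ Metric.closedBall (0 : V) R, dist x y < δ →
      |f y - f x - fderiv ℝ f x (y - x) - fderiv ℝ (fderiv ℝ f) x (y - x) (y - x) / 2|
        ≤ η * ‖y - x‖ ^ 2 := by
  have hf1 : ContDiff ℝ 1 (fderiv ℝ f) := hf.fderiv_right (by norm_num)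
  have hd0 : Differentiable ℝ f := hf.differentiable (by norm_num)
  have hd1 : Differentiable ℝ (fderiv ℝ f) := hf1.differentiable (by norm_num)
  have hc2 : Continuous (fderiv ℝ (fderiv ℝ f)) := hf1.continuous_fderiv (by norm_num)
  have hu : UniformContinuousOn (fderiv ℝ (fderiv ℝ f)) (Metric.closedBall (0 : V) R) :=
    (isCompact_closedBall (0 : V) R).uniformContinuousOn_of_continuous
      (f := fderiv ℝ (fderiv ℝ f)) hc2.continuousOn
  obtain ⟨δ, hδ, hunif⟩ := (Metric.uniformContinuousOn_iff
    (f := fderiv ℝ (fderiv ℝ f))).1 hu η hη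
  refine ⟨δ, hδ, fun x hx y hy hxy => ?_⟩
  set B := fderiv ℝ (fderiv ℝ f) x with hB
  have hsymm : ∀ v w, B v w = B w v := fun v w =>
    (hf.contDiffAt (x := x)).isSymmSndFDerivAt (by simp) v w
  have hconv : Convex ℝ (segment ℝ x y) := convex_segment x y
  have hxs := left_mem_segment ℝ x y
  have hys := right_mem_segment ℝ x y
  have hsub : segment ℝ x y ⊆ Metric.closedBall 0 R := (convex_closedBall 0 R).segment_subset hx hy
  have hdist : ∀ z ∈ segment ℝ x y, ‖z - x‖ ≤ ‖y - x‖ := fun z hz => by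
    have := (convex_closedBall x ‖y - x‖).segment_subset
      (Metric.mem_closedBall_self (norm_nonneg _))
      (by rw [Metric.mem_closedBall, dist_eq_norm]) hz
    rwa [Metric.mem_closedBall, dist_eq_norm] at this
  have h1 : ∀ z ∈ segment ℝ x y, ‖fderiv ℝ f z - fderiv ℝ f x - B (z - x)‖ ≤ η * ‖y - x‖ := by
    intro z hz
    have h := hconv.norm_image_sub_le_of_norm_hasFDerivWithin_le
      (f := fun z => fderiv ℝ f z - B z) (f' := fun z => fderiv ℝ (fderiv ℝ f) z - B) (C := η)
      (fun z _ => ((hd1 z).hasFDerivAt.sub B.hasFDerivAt).hasFDerivWithinAt)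
      (fun z hz => by
        rw [← dist_eq_norm]
        refine (hunif z (hsub hz) x hx ?_).le
        rw [dist_eq_norm]
        refine (hdist z hz).trans_lt ?_
        rwa [← dist_eq_norm, dist_comm]) hxs hz
    have e : fderiv ℝ f z - fderiv ℝ f x - B (z - x)
        = fderiv ℝ f z - B z - (fderiv ℝ f x - B x) := by
      rw [map_sub]; abel
    rw [e]
    exact h.trans (mul_le_mul_of_nonneg_left (hdist z hz) hη.le)
  have h2 := hconv.norm_image_sub_le_of_norm_hasFDerivWithin_le
    (f := fun z => f z - fderiv ℝ f x z - (1 / 2 : ℝ) * B (z - x) (z - x))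
    (f' := fun z => fderiv ℝ f z - fderiv ℝ f x - B (z - x)) (C := η * ‖y - x‖)
    (fun z _ => by
      have hs : HasFDerivAt (fun z : V => z - x) (ContinuousLinearMap.id ℝ V) z :=
        (hasFDerivAt_id z).sub_const x
      have hc : HasFDerivAt (fun z : V => B (z - x)) (B.comp (ContinuousLinearMap.id ℝ V)) z :=
        B.hasFDerivAt.comp z hs
      have hq := (hc.clm_apply hs).const_mul (1 / 2 : ℝ)
      have := (((hd0 z).hasFDerivAt.sub (fderiv ℝ f x).hasFDerivAt).sub hq).hasFDerivWithinAt
        (s := segment ℝ x y)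
      refine this.congr_fderiv ?_
      ext w
      simp only [sub_apply, smul_apply, add_apply, ContinuousLinearMap.comp_apply,
        ContinuousLinearMap.flip_apply, ContinuousLinearMap.id_apply, smul_eq_mul]
      rw [hsymm w (z - x)]
      ring) h1 hxs hys
  have e : f y - f x - fderiv ℝ f x (y - x) - B (y - x) (y - x) / 2
      = f y - fderiv ℝ f x y - 1 / 2 * B (y - x) (y - x)
        - (f x - fderiv ℝ f x x - 1 / 2 * B (x - x) (x - x)) := by
    rw [map_sub (fderiv ℝ f x), sub_self x, map_zero]
    simp
    ring
  rw [e, ← Real.norm_eq_abs]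
  refine h2.trans (le_of_eq ?_)
  ring

lemma fderiv_apply_eq_sum {ι : Type*} [Fintype ι] [DecidableEq ι] (f : (ι → ℝ) → ℝ)
    (x v : ι → ℝ) : fderiv ℝ f x v = ∑ i, v i * fderiv ℝ f x (Pi.single i 1) := by
  have := LinearMap.pi_apply_eq_sum_univ (fderiv ℝ f x).toLinearMap v
  simp only [ContinuousLinearMap.coe_coe, smul_eq_mul] at this
  rw [this]
  refine Finset.sum_congr rfl fun i _ => ?_
  congr 2
  ext j
  simp [Pi.single_apply, eq_comm]

lemma fderiv_fderiv_apply_eq_sum {ι : Type*} [Fintype ι] (f : (ι → ℝ) → ℝ) (x v w : ι → ℝ) :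
    fderiv ℝ (fderiv ℝ f) x w v = ∑ i, ∑ j, v i * w j * hessianMatrix f x j i := by
  classical
  have hpi : ∀ v : ι → ℝ, v = ∑ i, v i • (Pi.single i 1 : ι → ℝ) := fun v => by
    ext j; simp [Finset.sum_apply, Pi.single_apply]
  conv_lhs => rw [hpi v, hpi w]
  simp only [map_sum, map_smul, sum_apply, smul_apply,
    smul_eq_mul, Finset.mul_sum]
  refine Finset.sum_congr rfl fun i _ => Finset.sum_congr rfl fun j _ => ?_
  rw [hessianMatrix, Matrix.of_apply, iteratedFDeriv_two_apply]
  simp only [Matrix.cons_val_zero, Matrix.cons_val_one]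
  rw [mul_assoc]

lemma continuous_hessianMatrix {ι : Type*} [Fintype ι] {f : (ι → ℝ) → ℝ} (hf : ContDiff ℝ 2 f)
    (i j : ι) : Continuous fun x => hessianMatrix f x i j := by
  classical
  simp only [hessianMatrix, Matrix.of_apply, iteratedFDeriv_two_apply]
  have hf1 : ContDiff ℝ 1 (fderiv ℝ f) := hf.fderiv_right (by norm_num)
  exact ((hf1.continuous_fderiv (by norm_num)).clm_apply continuous_const).clm_apply
    continuous_const

lemma norm_sq_le_sum_sq {ι : Type*} [Fintype ι] (v : ι → ℝ) : ‖v‖ ^ 2 ≤ ∑ i, v i ^ 2 := by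
  have h : ‖v‖ ≤ √(∑ i, v i ^ 2) := (pi_norm_le_iff_of_nonneg (Real.sqrt_nonneg _)).2 fun i =>
    Real.abs_le_sqrt (Finset.single_le_sum (fun i _ => sq_nonneg (v i)) (Finset.mem_univ i))
  calc ‖v‖ ^ 2 ≤ √(∑ i, v i ^ 2) ^ 2 := pow_le_pow_left₀ (norm_nonneg _) h 2
    _ = _ := Real.sq_sqrt (Finset.sum_nonneg fun i _ => sq_nonneg _)

end Taylor

namespace ResistanceForm

lemma disc_eq_sum {X : Type*} {E : ResistanceForm X} {U : Finset X} (u v : X → ℝ) :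
    E.disc U u v = ∑ x ∈ U, ∑ y ∈ U, E.conductance U x y * (u x - u y) * v x := by
  have h : ∑ x ∈ U, ∑ y ∈ U, E.conductance U x y * (u x - u y) * v y
      = - ∑ x ∈ U, ∑ y ∈ U, E.conductance U x y * (u x - u y) * v x := by
    rw [Finset.sum_comm, ← Finset.sum_neg_distrib]
    refine Finset.sum_congr rfl fun x _ => ?_
    rw [← Finset.sum_neg_distrib]
    exact Finset.sum_congr rfl fun y _ => by rw [conductance_comm]; ring
  simp only [disc, mul_sub (_ * _), Finset.sum_sub_distrib] at h ⊢
  rw [h]; ring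

end ResistanceForm

namespace FinitelyRamified

section Laplacian

variable {F : Type*} [MetricSpace F] [CompactSpace F] {A : Type*} {S : FinitelyRamified F A}
  {E : ResistanceForm S.Vstar} {n m k l : ℕ} {α β γ : A}

lemma IsHarmonic.sum_conductance_mul_sub {u : S.Vstar → ℝ} (hu : S.IsHarmonic E u) {x : S.Vstar}
    (hx : x ∈ S.Vlvl k) (hx0 : x ∉ S.V0) :
    ∑ y ∈ S.Vlvl k, E.conductance (S.Vlvl k) x y * (u x - u y) = 0 := by
  have h1 := ResistanceForm.disc_eq_sum (E := E) (U := S.Vlvl k) u (ResistanceForm.delta x)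
  rw [Finset.sum_eq_single x] at h1
  · simp only [ResistanceForm.delta_self, mul_one] at h1
    rw [← h1, ResistanceForm.disc_eq (S.exhausts.nonempty k), hu.ext_eq, ← isHarmonic_iff.1 hu]
    refine ResistanceForm.ext_orth _ (ResistanceForm.ext_mem _ _) fun v hv => ?_
    rw [ResistanceForm.ext_apply _ (V0_subset k hv), ResistanceForm.delta_of_ne]
    rintro rfl
    exact hx0 hv
  · intro y _ hy
    simp [ResistanceForm.delta_of_ne hy]
  · exact fun h => absurd hx h

lemma exists_coord_bound (hcont : S.HarmonicContinuous E) :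
    ∃ R, ∀ x, S.coord E x ∈ Metric.closedBall (0 : S.V0 → ℝ) R := by
  obtain ⟨R, hR⟩ := (isCompact_range (continuous_coord hcont)).isBounded.subset_closedBall
    (0 : S.V0 → ℝ)
  exact ⟨R, fun x => hR ⟨x, rfl⟩⟩

lemma res_comp_coord_mem (hcont : S.HarmonicContinuous E) {f : (S.V0 → ℝ) → ℝ}
    (hf : ContDiff ℝ 1 f) : S.res (f ∘ S.coord E) ∈ E.dom := by
  obtain ⟨R, hR⟩ := exists_coord_bound hcont
  obtain ⟨L, hL⟩ := hf.contDiffOn.exists_lipschitzOnWith one_ne_zero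
    (convex_closedBall (0 : S.V0 → ℝ) R) (isCompact_closedBall _ _)
  refine (ResistanceForm.form_le_sum_of_increments (E := E) S.exhausts (Finset.univ : Finset S.V0)
    (C := fun _ => (L : ℝ) ^ 2) (v := S.coordRes E) (fun _ _ => by positivity)
    (fun i _ => (isHarmonic_coordRes hcont i).mem) fun x y => ?_).1
  rw [← Finset.mul_sum]
  calc (S.res (f ∘ S.coord E) x - S.res (f ∘ S.coord E) y) ^ 2
      ≤ (L * ‖S.coord E x - S.coord E y‖) ^ 2 := by
        rw [← sq_abs]
        refine pow_le_pow_left₀ (abs_nonneg _) ?_ 2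
        have := hL.dist_le_mul _ (hR x) _ (hR y)
        rwa [dist_eq_norm, dist_eq_norm] at this
    _ ≤ (L : ℝ) ^ 2 * ∑ i, (S.coordRes E i x - S.coordRes E i y) ^ 2 := by
        rw [mul_pow]
        exact mul_le_mul_of_nonneg_left (norm_sq_le_sum_sq _) (by positivity)

lemma disc_comp_coord_add (hcont : S.HarmonicContinuous E)
    (f : (S.V0 → ℝ) → ℝ) {g : F → ℝ} (hg0 : ∀ v ∈ S.V0, g v = 0) (k : ℕ) :
    E.disc (S.Vlvl k) (S.res (f ∘ S.coord E)) (S.res g)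
      + ∑ i, ∑ j, S.edgeSum E k (S.coordRes E i) (S.coordRes E j)
        (fun x => g x * hessianMatrix f (S.coord E x) j i)
      = - ∑ x ∈ S.Vlvl k, ∑ y ∈ S.Vlvl k, E.conductance (S.Vlvl k) x y * g x *
        (f (S.coord E y) - f (S.coord E x) - fderiv ℝ f (S.coord E x) (S.coord E y - S.coord E x)
          - fderiv ℝ (fderiv ℝ f) (S.coord E x) (S.coord E y - S.coord E x)
            (S.coord E y - S.coord E x) / 2) := by
  classical
  have hlin : ∑ x ∈ S.Vlvl k, ∑ y ∈ S.Vlvl k, E.conductance (S.Vlvl k) x y * g x *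
      fderiv ℝ f (S.coord E x) (S.coord E y - S.coord E x) = 0 := by
    refine Finset.sum_eq_zero fun x hx => ?_
    by_cases hx0 : x ∈ S.V0
    · simp [hg0 x hx0]
    · rw [Finset.sum_congr rfl fun y _ => by rw [fderiv_apply_eq_sum f, Finset.mul_sum],
        Finset.sum_comm]
      refine Finset.sum_eq_zero fun i _ => ?_
      have h := (isHarmonic_coordRes hcont i).sum_conductance_mul_sub hx hx0
      calc _ = -(g x * fderiv ℝ f (S.coord E x) (Pi.single i 1)) *
            ∑ y ∈ S.Vlvl k, E.conductance (S.Vlvl k) x y *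
              (S.coordRes E i x - S.coordRes E i y) := by
            rw [Finset.mul_sum]
            refine Finset.sum_congr rfl fun y _ => ?_
            simp only [coordRes, res, Pi.sub_apply]; ring
        _ = 0 := by rw [h, mul_zero]
  have hquad : ∑ i, ∑ j, S.edgeSum E k (S.coordRes E i) (S.coordRes E j)
        (fun x => g x * hessianMatrix f (S.coord E x) j i)
      = ∑ x ∈ S.Vlvl k, ∑ y ∈ S.Vlvl k, E.conductance (S.Vlvl k) x y * g x *
        (fderiv ℝ (fderiv ℝ f) (S.coord E x) (S.coord E y - S.coord E x)
            (S.coord E y - S.coord E x) / 2) := by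
    simp only [edgeSum, fderiv_fderiv_apply_eq_sum f, Finset.sum_div, Finset.mul_sum]
    rw [Finset.sum_congr rfl fun i _ => Finset.sum_comm, Finset.sum_comm]
    refine Finset.sum_congr rfl fun x _ => ?_
    rw [Finset.sum_congr rfl fun i _ => Finset.sum_comm, Finset.sum_comm]
    refine Finset.sum_congr rfl fun y _ => Finset.sum_congr rfl fun i _ =>
      Finset.sum_congr rfl fun j _ => ?_
    simp only [coordRes, res, Pi.sub_apply]; ring
  rw [hquad, ResistanceForm.disc_eq_sum]
  simp only [mul_sub, Finset.sum_sub_distrib, hlin]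
  simp only [res, Function.comp_apply, sub_mul, Finset.sum_sub_distrib]
  have h1 : ∀ φ : S.Vstar → S.Vstar → ℝ, ∑ x ∈ S.Vlvl k, ∑ y ∈ S.Vlvl k,
      E.conductance (S.Vlvl k) x y * φ x y * g x
      = ∑ x ∈ S.Vlvl k, ∑ y ∈ S.Vlvl k, E.conductance (S.Vlvl k) x y * g x * φ x y := fun φ =>
    Finset.sum_congr rfl fun x _ => Finset.sum_congr rfl fun y _ => mul_right_comm _ _ _
  rw [h1 fun x _ => f (S.coord E x), h1 fun _ y => f (S.coord E y)]
  ring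

variable [MeasurableSpace F] [BorelSpace F]

/-- The Gauss-Green formula against continuous functions. -/
lemma form_comp_coord (hlocal : S.IsLocal E) (hcont : S.HarmonicContinuous E)
    {ν : Measure F} [IsFiniteMeasure ν] [NullSingletonClass ν] {Z : F → Matrix S.V0 S.V0 ℝ}
    (hZm : ∀ i j, Measurable fun x => Z x i j) {C : ℝ} (hZC : ∀ i j, ∀ᵐ x ∂ν, |Z x i j| ≤ C)
    (hZ : ∀ i j α, ∫ x in S.cell α, Z x i j ∂ν
      = S.harmForm E α (S.coordRes E i) (S.coordRes E j))
    {f : (S.V0 → ℝ) → ℝ} (hf : ContDiff ℝ 2 f) {g : F → ℝ} (hg : Continuous g)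
    (hgm : S.res g ∈ E.dom) (hg0 : ∀ v ∈ S.V0, g v = 0) :
    E.form (S.res (f ∘ S.coord E)) (S.res g)
      = - ∫ x, g x * (Z x * hessianMatrix f (S.coord E x)).trace ∂ν := by
  have hψ := continuous_coord hcont
  have hum := res_comp_coord_mem hcont (hf.of_le (by norm_num : (1 : WithTop ℕ∞) ≤ 2))
  have hφ : ∀ i j, Continuous fun x => g x * hessianMatrix f (S.coord E x) j i := fun i j =>
    hg.mul ((continuous_hessianMatrix hf j i).comp hψ)
  have hlim : Tendsto (fun k => E.disc (S.Vlvl k) (S.res (f ∘ S.coord E)) (S.res g)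
      + ∑ i, ∑ j, S.edgeSum E k (S.coordRes E i) (S.coordRes E j)
        (fun x => g x * hessianMatrix f (S.coord E x) j i)) atTop
      (𝓝 (E.form (S.res (f ∘ S.coord E)) (S.res g)
        + ∑ i, ∑ j, ∫ x, g x * hessianMatrix f (S.coord E x) j i * Z x i j ∂ν)) :=
    (ResistanceForm.tendsto_disc S.exhausts hum hgm).add <| tendsto_finsetSum _ fun i _ =>
      tendsto_finsetSum _ fun j _ => tendsto_edgeSum hlocal (isHarmonic_coordRes hcont i)
        (isHarmonic_coordRes hcont j) (hZm i j) (hZC i j) (hZ i j) (hφ i j)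
  have hzero : Tendsto (fun k => E.disc (S.Vlvl k) (S.res (f ∘ S.coord E)) (S.res g)
      + ∑ i, ∑ j, S.edgeSum E k (S.coordRes E i) (S.coordRes E j)
        (fun x => g x * hessianMatrix f (S.coord E x) j i)) atTop (𝓝 0) := by
    simp only [disc_comp_coord_add hcont f hg0]
    obtain ⟨R, hR⟩ := exists_coord_bound hcont
    obtain ⟨B, hB⟩ := (HasCompactSupport.of_compactSpace g).exists_bound_of_continuous hg
    have hB0 : 0 ≤ B := by
      obtain ⟨p, -⟩ := S.exists_points
      exact (norm_nonneg _).trans (hB (p S.root))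
    set Q := ∑ i, E.form (S.coordRes E i) (S.coordRes E i) with hQ
    have hQ0 : 0 ≤ Q := Finset.sum_nonneg fun i _ => E.nonneg _ (isHarmonic_coordRes hcont i).mem
    refine Metric.tendsto_atTop.2 fun ε hε => ?_
    set η := ε / (2 * (B * Q + 1)) with hη
    have hη0 : 0 < η := by positivity
    obtain ⟨δ, hδ, hT⟩ := exists_taylor_two hf R hη0
    obtain ⟨N, hN⟩ := S.exists_oscillation_lt hψ hδ
    refine ⟨N, fun k hk => ?_⟩
    rw [dist_zero_right, norm_neg]
    have hbound : ‖∑ x ∈ S.Vlvl k, ∑ y ∈ S.Vlvl k, E.conductance (S.Vlvl k) x y * g x *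
        (f (S.coord E y) - f (S.coord E x) - fderiv ℝ f (S.coord E x) (S.coord E y - S.coord E x)
          - fderiv ℝ (fderiv ℝ f) (S.coord E x) (S.coord E y - S.coord E x)
            (S.coord E y - S.coord E x) / 2)‖ ≤ ∑ x ∈ S.Vlvl k, ∑ y ∈ S.Vlvl k,
          B * η * ∑ i, E.conductance (S.Vlvl k) x y *
            (S.coordRes E i x - S.coordRes E i y) ^ 2 := by
      refine (norm_sum_le _ _).trans (Finset.sum_le_sum fun x hx =>
        (norm_sum_le _ _).trans (Finset.sum_le_sum fun y hy => ?_))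
      by_cases hxy : x = y
      · simp [hxy]
      by_cases hc : E.conductance (S.Vlvl k) x y = 0
      · simp [hc]
      have hc0 := ResistanceForm.conductance_nonneg (E := E) hx hxy
      obtain ⟨γ, hγ, hxγ, hyγ⟩ := edge_of_conductance_ne_zero hlocal hx hy hxy hc
      have hr := hT _ (hR x) _ (hR y) (hN k hk γ hγ x hxγ y hyγ)
      rw [norm_mul, norm_mul, Real.norm_of_nonneg hc0, ← Finset.mul_sum]
      have hn : ‖S.coord E y - S.coord E x‖ ^ 2
          ≤ ∑ i, (S.coordRes E i x - S.coordRes E i y) ^ 2 := by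
        rw [← norm_neg, neg_sub]
        exact norm_sq_le_sum_sq _
      calc _ ≤ E.conductance (S.Vlvl k) x y * B *
            (η * ∑ i, (S.coordRes E i x - S.coordRes E i y) ^ 2) := by
            refine mul_le_mul (mul_le_mul_of_nonneg_left (hB x) hc0)
              (hr.trans (mul_le_mul_of_nonneg_left hn hη0.le)) (norm_nonneg _) (by positivity)
        _ = _ := by ring
    refine hbound.trans_lt ?_
    have hsum : ∑ x ∈ S.Vlvl k, ∑ y ∈ S.Vlvl k,
        B * η * ∑ i, E.conductance (S.Vlvl k) x y *
          (S.coordRes E i x - S.coordRes E i y) ^ 2 = B * η * (2 * Q) := by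
      have h1 : ∀ i, ∑ x ∈ S.Vlvl k, ∑ y ∈ S.Vlvl k, E.conductance (S.Vlvl k) x y *
          (S.coordRes E i x - S.coordRes E i y) ^ 2
          = 2 * E.form (S.coordRes E i) (S.coordRes E i) := fun i => by
        rw [← disc_of_harmonic (k := k) (isHarmonic_coordRes hcont i)
          (isHarmonic_coordRes hcont i), ResistanceForm.disc_self_eq_sum]
        ring
      have h2 : 2 * Q = ∑ x ∈ S.Vlvl k, ∑ y ∈ S.Vlvl k, ∑ i, E.conductance (S.Vlvl k) x y *
          (S.coordRes E i x - S.coordRes E i y) ^ 2 := by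
        rw [hQ, Finset.mul_sum, ← Finset.sum_congr rfl fun i _ => h1 i,
          Finset.sum_comm]
        exact Finset.sum_congr rfl fun x _ => Finset.sum_comm
      rw [h2]
      simp only [Finset.mul_sum]
    rw [hsum, hη, mul_div_assoc', div_mul_eq_mul_div, div_lt_iff₀ (by positivity)]
    nlinarith
  have h := tendsto_nhds_unique hlim hzero
  have hint : ∀ i j, Integrable (fun x => g x * hessianMatrix f (S.coord E x) j i * Z x i j) ν := by
    intro i j
    obtain ⟨B, hB⟩ := (HasCompactSupport.of_compactSpace _).exists_bound_of_continuous (hφ i j)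
    exact (integrable_of_ae_abs_le (hZm i j) (hZC i j)).bdd_mul
      (hφ i j).aestronglyMeasurable (c := B) (Eventually.of_forall hB)
  rw [eq_neg_of_add_eq_zero_left h, neg_inj]
  rw [Finset.sum_congr rfl fun i _ => (integral_finsetSum _ fun j _ => hint i j).symm,
    ← integral_finsetSum _ fun i _ => integrable_finsetSum _ fun j _ => hint i j]
  refine integral_congr_ae (Eventually.of_forall fun x => ?_)
  simp only [Matrix.trace, Matrix.diag_apply, Matrix.mul_apply, Finset.mul_sum]
  exact Finset.sum_congr rfl fun i _ => Finset.sum_congr rfl fun j _ => by ring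

end Laplacian

end FinitelyRamified

lemma eLpNorm_two_le_of_integral_sq_le {α : Type*} {m : MeasurableSpace α} {μ : Measure α}
    {f : α → ℝ} (hf : MemLp f 2 μ) {c : ℝ} (hc : ∫ x, f x ^ 2 ∂μ ≤ c) :
    eLpNorm f 2 μ ≤ ENNReal.ofReal (√c) := by
  rw [hf.eLpNorm_eq_integral_rpow_norm two_ne_zero ENNReal.ofNat_ne_top]
  refine ENNReal.ofReal_le_ofReal ?_
  simp only [ENNReal.toReal_ofNat, Real.rpow_ofNat, Real.norm_eq_abs, sq_abs]
  rw [Real.sqrt_eq_rpow, one_div]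
  exact Real.rpow_le_rpow (integral_nonneg fun x => sq_nonneg _) hc (by norm_num)

lemma tendsto_integral_mul_of_eLpNorm_two {α : Type*} {m : MeasurableSpace α} {μ : Measure α}
    {u : ℕ → α → ℝ} {G w : α → ℝ} (hu : ∀ n, MemLp (u n) 2 μ) (hG : MemLp G 2 μ)
    (hw : MemLp w 2 μ) (h : Tendsto (fun n => eLpNorm (u n - G) 2 μ) atTop (𝓝 0)) :
    Tendsto (fun n => ∫ x, u n x * w x ∂μ) atTop (𝓝 (∫ x, G x * w x ∂μ)) := by
  refine tendsto_integral_of_L1' (fun x => G x * w x)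
    (hG.1.mul hw.1) (Eventually.of_forall fun n => (hu n).integrable_mul hw) ?_
  have hle : ∀ n, eLpNorm ((fun x => u n x * w x) - fun x => G x * w x) 1 μ
      ≤ eLpNorm (u n - G) 2 μ * eLpNorm w 2 μ := fun n => by
    have e : ((fun x => u n x * w x) - fun x => G x * w x) = (u n - G) • w := by
      ext x; simp [sub_mul]
    rw [e]
    exact eLpNorm_smul_le_mul_eLpNorm hw.1 ((hu n).1.sub hG.1)
  refine tendsto_of_tendsto_of_tendsto_of_le_of_le tendsto_const_nhds ?_ (fun n => zero_le) hle
  simpa using ENNReal.Tendsto.mul_const h (Or.inr hw.2.ne)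

namespace FinitelyRamified

variable {F : Type*} [MetricSpace F] [CompactSpace F] {A : Type*} {S : FinitelyRamified F A}
  {E : ResistanceForm S.Vstar} {n m k l : ℕ} {α β γ : A}

section Hardy

lemma edgeSum_sq_le {h u : S.Vstar → ℝ} (hh : S.IsHarmonic E h) {M : ℝ} (hM : ∀ x, |h x| ≤ M)
    {U : F → ℝ} (hU : S.res U = u) (hu0 : ∀ v ∈ S.V0, u v = 0) (k : ℕ) :
    S.edgeSum E k h h (fun x => U x ^ 2) ≤ 8 * M ^ 2 * E.disc (S.Vlvl k) u u := by
  subst hU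
  set u := S.res U
  set W := S.Vlvl k
  have h0 : E.disc W h (fun x => u x ^ 2 * h x) = 0 := by
    rw [ResistanceForm.disc_eq (S.exhausts.nonempty k), hh.ext_eq, ← isHarmonic_iff.1 hh]
    refine ResistanceForm.ext_orth _ (ResistanceForm.ext_mem _ _) fun v hv => ?_
    rw [ResistanceForm.ext_apply _ (V0_subset k hv), hu0 v hv]
    ring
  have hterm : ∀ x ∈ W, ∀ y ∈ W,
      E.conductance W x y * ((h x - h y) ^ 2 * u x ^ 2) -
        (E.conductance W x y * ((h x - h y) ^ 2 * u x ^ 2) / 8 +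
          E.conductance W y x * ((h y - h x) ^ 2 * u y ^ 2) / 8 +
          4 * M ^ 2 * (E.conductance W x y * (u x - u y) ^ 2))
      ≤ E.conductance W x y * (h x - h y) * (u x ^ 2 * h x - u y ^ 2 * h y) := by
    intro x hx y hy
    have key : 0 ≤ (h x - h y) * (u x ^ 2 * h x - u y ^ 2 * h y) - ((h x - h y) ^ 2 * u x ^ 2 -
        ((h x - h y) ^ 2 * u x ^ 2 / 8 + (h x - h y) ^ 2 * u y ^ 2 / 8 +
          4 * M ^ 2 * (u x - u y) ^ 2)) := by
      have hy2 : h y ^ 2 ≤ M ^ 2 := by rw [← sq_abs]; exact pow_le_pow_left₀ (abs_nonneg _) (hM y) 2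
      have e : (h x - h y) * (u x ^ 2 * h x - u y ^ 2 * h y) - ((h x - h y) ^ 2 * u x ^ 2 -
        ((h x - h y) ^ 2 * u x ^ 2 / 8 + (h x - h y) ^ 2 * u y ^ 2 / 8 +
          4 * M ^ 2 * (u x - u y) ^ 2))
        = ((h x - h y) * u x + 4 * (h y * (u x - u y))) ^ 2 / 8
          + ((h x - h y) * u y + 4 * (h y * (u x - u y))) ^ 2 / 8
          + 4 * (M ^ 2 - h y ^ 2) * (u x - u y) ^ 2 := by ring
      rw [e]
      have := sub_nonneg.2 hy2
      positivity
    have := ResistanceForm.conductance_mul_nonneg (E := E) (y := y) hx key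
      (fun hxy => by subst hxy; ring)
    rw [ResistanceForm.conductance_comm y x]
    nlinarith [this]
  have hX : S.edgeSum E k h h (fun x => U x ^ 2)
      = (∑ x ∈ W, ∑ y ∈ W, E.conductance W x y * ((h x - h y) ^ 2 * u x ^ 2)) / 2 := by
    rw [edgeSum]
    congr 1
    refine Finset.sum_congr rfl fun x _ => Finset.sum_congr rfl fun y _ => ?_
    simp only [u, res]; ring
  have hsum := Finset.sum_le_sum fun x hx => Finset.sum_le_sum fun y hy => hterm x hx y hy
  have hswap : ∑ x ∈ W, ∑ y ∈ W, E.conductance W y x * ((h y - h x) ^ 2 * u y ^ 2)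
      = ∑ x ∈ W, ∑ y ∈ W, E.conductance W x y * ((h x - h y) ^ 2 * u x ^ 2) := Finset.sum_comm
  simp only [Finset.sum_sub_distrib, Finset.sum_add_distrib, ← Finset.sum_div,
    ← Finset.mul_sum, hswap] at hsum
  rw [ResistanceForm.disc] at h0
  have hd := ResistanceForm.disc_self_eq_sum (E := E) (U := W) u
  rw [hX, hd]
  have hnn : 0 ≤ M ^ 2 * E.disc W u u := by
    rw [ResistanceForm.disc_eq (S.exhausts.nonempty k)]
    exact mul_nonneg (sq_nonneg _) (E.nonneg _ (ResistanceForm.ext_mem _ _))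
  rw [hd] at hnn
  have h0' := (div_eq_zero_iff.1 h0).resolve_right two_ne_zero
  rw [h0'] at hsum
  linarith

variable [MeasurableSpace F] [BorelSpace F]

lemma tendsto_edgeSum_self (hlocal : S.IsLocal E) {u : S.Vstar → ℝ} (hu : S.IsHarmonic E u)
    {μ : Measure F} (hμ : S.IsEnergyMeasure E u μ) {φ : F → ℝ} (hφ : Continuous φ) :
    Tendsto (fun k => S.edgeSum E k u u φ) atTop (𝓝 (∫ x, φ x ∂μ)) := by
  have := hμ.isFiniteMeasure
  have := hμ.nullSingletonClass
  have h := tendsto_edgeSum hlocal hu hu (ν := μ) (z := fun _ => 1) measurable_const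
    (C := 1) (by simp) (fun α => by
      rw [harmForm_self hlocal hu, setIntegral_const, smul_eq_mul, mul_one, Measure.real, hμ.2,
        ENNReal.toReal_ofReal (cellTrace_nonneg hlocal hu)]) hφ
  simpa using h

/-- A Hardy type inequality. -/
lemma IsKusuokaMeasure.exists_integral_sq_le (hlocal : S.IsLocal E)
    (hcont : S.HarmonicContinuous E) {d : ℕ} {h : Fin d → S.Vstar → ℝ}
    (hharm : ∀ i, S.IsHarmonic E (h i)) {ν : Measure F} (hν : S.IsKusuokaMeasure E h ν) :
    ∃ C : ℝ, 0 ≤ C ∧ ∀ U : F → ℝ, Continuous U → S.res U ∈ E.dom → (∀ v ∈ S.V0, U v = 0) →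
      ∫ x, U x ^ 2 ∂ν ≤ C * E.form (S.res U) (S.res U) := by
  obtain ⟨μ, hμ, rfl⟩ := hν
  have hM : ∀ i, ∃ M, ∀ x, |h i x| ≤ M := fun i => by
    obtain ⟨H, hH, hHi⟩ := hcont (h i) (hharm i)
    obtain ⟨B, hB⟩ := (HasCompactSupport.of_compactSpace H).exists_bound_of_continuous hH
    exact ⟨B, fun x => by rw [← hHi]; exact hB x⟩
  choose M hM using hM
  refine ⟨∑ i, 8 * M i ^ 2, by positivity, fun U hU hUm hU0 => ?_⟩
  have hU2 : Continuous fun x => U x ^ 2 := hU.pow 2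
  rw [integral_finsetSum_measure fun i _ => by
    have := (hμ i).isFiniteMeasure
    obtain ⟨B, hB⟩ := (HasCompactSupport.of_compactSpace _).exists_bound_of_continuous hU2
    exact Integrable.of_bound hU2.aestronglyMeasurable B (Eventually.of_forall hB), Finset.sum_mul]
  refine Finset.sum_le_sum fun i _ => le_of_tendsto (tendsto_edgeSum_self hlocal (hharm i) (hμ i)
    hU2) (Eventually.of_forall fun k => ?_)
  refine (edgeSum_sq_le (hharm i) (hM i) rfl hU0 k).trans ?_
  exact mul_le_mul_of_nonneg_left
    (ResistanceForm.disc_self_le_form (S.exhausts.nonempty k) hUm) (by positivity)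

end Hardy

section Versions

lemma IsPiecewiseHarmonic.exists_continuous (hcont : S.HarmonicContinuous E) {p : S.Vstar → ℝ}
    (hp : S.IsPiecewiseHarmonic E n p) :
    ∃ (P : F → ℝ) (H : A → F → ℝ), Continuous P ∧ S.res P = p ∧
      ∀ α ∈ S.lvl n, S.IsHarmonic E (S.res (H α)) ∧ Continuous (H α) ∧
        ∀ x ∈ S.cell α, P x = H α x := by
  classical
  have hH : ∀ α, ∃ H : F → ℝ, α ∈ S.lvl n → S.IsHarmonic E (S.res H) ∧ Continuous H ∧
      ∀ x : S.Vstar, (x : F) ∈ S.cell α → p x = H x := fun α => by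
    by_cases hα : α ∈ S.lvl n
    · obtain ⟨h, hh, hph⟩ := hp.2 α hα
      obtain ⟨H, hHc, rfl⟩ := hcont h hh
      exact ⟨H, fun _ => ⟨hh, hHc, hph⟩⟩
    · exact ⟨0, fun h => absurd h hα⟩
  choose H hH using hH
  choose c hc hxc using S.exists_cell n
  have hP : ∀ α ∈ S.lvl n, ∀ x ∈ S.cell α, H (c x) x = H α x := fun α hα x hx => by
    by_cases hne : c x = α
    · rw [hne]
    · have hv := mem_Vlvl_of_mem_two (hc x) hα hne (hxc x) hx
      have hxV : x ∈ S.Vstar := mem_Vstar hv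
      rw [← (hH _ (hc x)).2.2 ⟨x, hxV⟩ (hxc x), ← (hH _ hα).2.2 ⟨x, hxV⟩ hx]
  refine ⟨fun x => H (c x) x, H, ?_, ?_, fun α hα => ⟨(hH α hα).1, (hH α hα).2.1, hP α hα⟩⟩
  · refine LocallyFinite.continuous (f := fun α : S.lvl n => S.cell α)
      (locallyFinite_of_finite _) ?_ (fun α => (S.cell_compact _).isClosed) fun α => ?_
    · exact Set.eq_univ_of_forall fun x => Set.mem_iUnion.2 ⟨⟨c x, hc x⟩, hxc x⟩
    · exact ((hH _ α.2).2.1.continuousOn (s := S.cell α)).congr fun x hx => hP _ α.2 x hx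
  · ext x
    exact ((hH _ (hc x)).2.2 x (hxc x)).symm

variable (S E) in
/-- The function `U` minus the harmonic function with the same boundary values. -/
noncomputable def subHarmonic (U : F → ℝ) (x : F) : ℝ := U x - ∑ i : S.V0, U i * S.coord E x i

lemma continuous_subHarmonic (hcont : S.HarmonicContinuous E) {U : F → ℝ} (hU : Continuous U) :
    Continuous (S.subHarmonic E U) :=
  hU.sub (continuous_finsetSum _ fun i _ => continuous_const.mul (continuous_coord_apply hcont i))

lemma res_subHarmonic (hcont : S.HarmonicContinuous E) (U : F → ℝ) :
    S.res (S.subHarmonic E U) = S.res U - E.ext S.V0 (S.res U) := by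
  conv_rhs => rw [(isHarmonic_ext (E := E) (S.res U)).eq_sum hcont]
  ext x
  simp only [res, subHarmonic, Pi.sub_apply, Finset.sum_apply, Pi.smul_apply, smul_eq_mul]
  congr 1
  refine Finset.sum_congr rfl fun i _ => ?_
  rw [ResistanceForm.ext_apply _ i.2]
  rfl

lemma subHarmonic_mem (hcont : S.HarmonicContinuous E) {U : F → ℝ} (hU : S.res U ∈ E.dom) :
    S.res (S.subHarmonic E U) ∈ E.dom := by
  rw [res_subHarmonic hcont]
  exact E.dom.sub_mem hU (ResistanceForm.ext_mem _ _)

lemma subHarmonic_apply_V0 (hcont : S.HarmonicContinuous E) (U : F → ℝ) {v : S.Vstar}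
    (hv : v ∈ S.V0) : S.subHarmonic E U v = 0 := by
  change S.res (S.subHarmonic E U) v = 0
  rw [res_subHarmonic hcont, Pi.sub_apply, ResistanceForm.ext_apply _ hv, sub_self]

lemma form_subHarmonic_sub_le (hcont : S.HarmonicContinuous E) {U : F → ℝ} (hU : S.res U ∈ E.dom)
    {g : S.Vstar → ℝ} (hg : g ∈ E.dom) (hg0 : ∀ v ∈ S.V0, g v = 0) :
    E.form (S.res (S.subHarmonic E U) - g) (S.res (S.subHarmonic E U) - g)
      ≤ E.form (S.res U - g) (S.res U - g) := by
  have hV0 : E.ext S.V0 g = 0 := by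
    rw [ResistanceForm.ext_congr (w' := (0 : ℝ) • g) fun x hx => by simp [hg0 x hx],
      ResistanceForm.ext_smul, zero_smul]
  have e : S.res (S.subHarmonic E U) - g = (S.res U - g) - E.ext S.V0 (S.res U - g) := by
    rw [ResistanceForm.ext_sub, hV0, res_subHarmonic hcont]; abel
  rw [e, ResistanceForm.form_sub_ext (E.dom.sub_mem hU hg)]
  linarith [E.nonneg _ (ResistanceForm.ext_mem (E := E) S.V0 (S.res U - g))]

variable [MeasurableSpace F] [BorelSpace F]

lemma memLp_of_continuous {ν : Measure F} [IsFiniteMeasure ν] {U : F → ℝ} (hU : Continuous U) :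
    MemLp U 2 ν := by
  obtain ⟨B, hB⟩ := (HasCompactSupport.of_compactSpace U).exists_bound_of_continuous hU
  exact MemLp.of_bound hU.aestronglyMeasurable B (Eventually.of_forall hB)

lemma isVersion_res {ν : Measure F} [IsFiniteMeasure ν] {U : F → ℝ} (hU : Continuous U)
    (hUm : S.res U ∈ E.dom) : S.IsVersion E ν (S.res U) U := by
  refine ⟨memLp_of_continuous hU, fun _ => U, fun _ => hU, fun _ => hUm, ?_, fun x =>
    tendsto_const_nhds, ?_⟩
  · simp only [sub_self]
    rw [(E.eq_zero_iff 0 E.dom.zero_mem).2 ⟨0, rfl⟩]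
    exact tendsto_const_nhds
  · simp

lemma exists_isVersion (hlocal : S.IsLocal E) (hcont : S.HarmonicContinuous E)
    (hWN : S.WeaklyNondegenerate E) {d : ℕ} {h : Fin d → S.Vstar → ℝ}
    (hharm : ∀ i, S.IsHarmonic E (h i)) {ν : Measure F} (hν : S.IsKusuokaMeasure E h ν)
    {g : S.Vstar → ℝ} (hg : g ∈ E.dom) (hg0 : ∀ v ∈ S.V0, g v = 0) :
    ∃ G, S.IsVersion E ν g G := by
  have := hν.isFiniteMeasure
  obtain ⟨C, hC0, hC⟩ := hν.exists_integral_sq_le hlocal hcont hharm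
  set ε : ℕ → ℝ := fun n => (1 / 4 : ℝ) ^ n / (4 * (C + 1)) with hε
  have hε0 : ∀ n, 0 < ε n := fun n => by positivity
  have hεm : Antitone ε := fun n m hnm => by
    exact div_le_div_of_nonneg_right
      (pow_le_pow_of_le_one (by norm_num) (by norm_num) hnm) (by positivity)
  have hφ : ∀ n, ∃ φ : F → ℝ, Continuous φ ∧ S.res φ ∈ E.dom ∧ (∀ v ∈ S.V0, φ v = 0) ∧
      E.form (S.res φ - g) (S.res φ - g) < ε n := fun n => by
    obtain ⟨N, p, hp, hgp⟩ := hWN g hg (ε n) (hε0 n)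
    obtain ⟨P, -, hPc, rfl, -⟩ := hp.exists_continuous hcont
    refine ⟨S.subHarmonic E P, continuous_subHarmonic hcont hPc, subHarmonic_mem hcont hp.1,
      fun v hv => subHarmonic_apply_V0 hcont P hv,
      (form_subHarmonic_sub_le hcont hp.1 hg hg0).trans_lt ?_⟩
    rwa [E.form_sub_comm hp.1 hg]
  choose φ hφc hφm hφ0 hφg using hφ
  have hεt : Tendsto ε atTop (𝓝 0) := by
    have h := (tendsto_pow_atTop_nhds_zero_of_lt_one (by norm_num : (0 : ℝ) ≤ 1 / 4)
      (by norm_num)).div_const (4 * (C + 1))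
    rwa [zero_div] at h
  have hform : Tendsto (fun n => E.form (S.res (φ n) - g) (S.res (φ n) - g)) atTop (𝓝 0) :=
    squeeze_zero (fun n => E.nonneg _ (E.dom.sub_mem (hφm n) hg)) (fun n => (hφg n).le) hεt
  obtain ⟨v, hv⟩ := S.V_nonempty S.root
  have hcau : ∀ N n m, N ≤ n → N ≤ m →
      eLpNorm (φ n - φ m) 2 ν < ENNReal.ofReal ((1 / 2) ^ N) := by
    intro N n m hn hm
    refine (eLpNorm_two_le_of_integral_sq_le ((memLp_of_continuous (hφc n)).sub
      (memLp_of_continuous (hφc m))) (hC _ ((hφc n).sub (hφc m))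
        (E.dom.sub_mem (hφm n) (hφm m)) fun v hv => by
          rw [Pi.sub_apply, hφ0 n v hv, hφ0 m v hv, sub_zero])).trans_lt ?_
    rw [ENNReal.ofReal_lt_ofReal_iff (by positivity), Real.sqrt_lt' (by positivity)]
    have e : S.res (φ n - φ m) = (S.res (φ n) - g) + (-1 : ℝ) • (S.res (φ m) - g) := by
      ext x; simp [res]
    have h1 := E.form_add_self_le (E.dom.sub_mem (hφm n) hg)
      (E.dom.smul_mem (-1) (E.dom.sub_mem (hφm m) hg))
    rw [← e, E.form_smul_self _ (E.dom.sub_mem (hφm m) hg)] at h1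
    have h2 : E.form (S.res (φ n - φ m)) (S.res (φ n - φ m)) < 4 * ε N := by
      have := hεm hn
      have := hεm hm
      linarith [hφg n, hφg m]
    have h3 : (C + 1) * (4 * ε N) = ((1 / 2) ^ N) ^ 2 := by
      simp only [hε]
      rw [← pow_mul, mul_comm N 2, pow_mul]
      field_simp
      norm_num
    rw [← h3]
    calc C * E.form (S.res (φ n - φ m)) (S.res (φ n - φ m)) ≤ C * (4 * ε N) :=
          mul_le_mul_of_nonneg_left h2.le hC0
      _ < (C + 1) * (4 * ε N) := mul_lt_mul_of_pos_right (lt_add_one C) (by linarith [hε0 N])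
  have hB : ∑' N : ℕ, ENNReal.ofReal ((1 / 2) ^ N) ≠ ⊤ := by
    rw [← ENNReal.ofReal_tsum_of_nonneg (fun n => by positivity) summable_geometric_two]
    exact ENNReal.ofReal_ne_top
  obtain ⟨G, hG, hGt⟩ := Lp.cauchy_complete_eLpNorm one_le_two
    (fun n => memLp_of_continuous (ν := ν) (hφc n)) hB hcau
  refine ⟨G, hG, φ, hφc, hφm, hform, fun x => ?_, hGt⟩
  exact E.tendsto_apply_of_form v hφm hg hform x
    (tendsto_const_nhds.congr fun n => by rw [hg0 v hv]; exact (hφ0 n v hv).symm)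

lemma tendsto_eLpNorm_subHarmonic_sub (hcont : S.HarmonicContinuous E) {ν : Measure F}
    [IsFiniteMeasure ν] {G : F → ℝ} (hG : MemLp G 2 ν) {u : ℕ → F → ℝ}
    (huc : ∀ n, Continuous (u n)) (hu0 : ∀ v ∈ S.V0, Tendsto (fun n => u n v) atTop (𝓝 0))
    (huG : Tendsto (fun n => eLpNorm (u n - G) 2 ν) atTop (𝓝 0)) :
    Tendsto (fun n => eLpNorm (S.subHarmonic E (u n) - G) 2 ν) atTop (𝓝 0) := by
  have hle : ∀ n, eLpNorm (S.subHarmonic E (u n) - G) 2 ν ≤ eLpNorm (u n - G) 2 ν +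
      ∑ i : S.V0, ‖u n i‖ₑ * eLpNorm (fun x => S.coord E x i) 2 ν := fun n => by
    have hci : ∀ i : S.V0, AEStronglyMeasurable (u n i • fun x => S.coord E x i) ν := fun i =>
      ((continuous_coord_apply hcont i).const_smul (u n i)).aestronglyMeasurable
    have e : S.subHarmonic E (u n) - G
        = (u n - G) - ∑ i : S.V0, (u n i • fun x => S.coord E x i) := by
      ext x
      simp only [subHarmonic, Pi.sub_apply, Finset.sum_apply, Pi.smul_apply, smul_eq_mul]
      ring
    rw [e]
    refine (eLpNorm_sub_le ((huc n).aestronglyMeasurable.sub hG.1)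
      (Finset.aestronglyMeasurable_sum _ fun i _ => hci i) one_le_two).trans
      (add_le_add_right ?_ _)
    refine (eLpNorm_sum_le (fun i _ => hci i) one_le_two).trans (le_of_eq ?_)
    exact Finset.sum_congr rfl fun i _ => eLpNorm_const_smul _ _ _ _
  refine tendsto_of_tendsto_of_tendsto_of_le_of_le tendsto_const_nhds ?_ (fun n => zero_le) hle
  have h1 : Tendsto (fun n => ∑ i : S.V0, ‖u n i‖ₑ * eLpNorm (fun x => S.coord E x i) 2 ν) atTop
      (𝓝 (∑ i : S.V0, 0 * eLpNorm (fun x => S.coord E x i) 2 ν)) :=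
    tendsto_finsetSum _ fun i _ => ENNReal.Tendsto.mul_const
      (by simpa [Function.comp_def] using (continuous_enorm.tendsto (0 : ℝ)).comp (hu0 i i.2))
      (Or.inr (memLp_of_continuous (continuous_coord_apply hcont i)).2.ne)
  simpa using huG.add h1

/-- The functions `f ∘ ψ` belong to the domain of the Laplacian. -/
lemma isLaplacian_comp_coord (hlocal : S.IsLocal E) (hcont : S.HarmonicContinuous E)
    (hWN : S.WeaklyNondegenerate E) {d : ℕ} {h : Fin d → S.Vstar → ℝ}
    (hharm : ∀ i, S.IsHarmonic E (h i)) {ν : Measure F} (hν : S.IsKusuokaMeasure E h ν)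
    {Z : F → Matrix S.V0 S.V0 ℝ} (hZm : ∀ i j, Measurable fun x => Z x i j) {C : ℝ}
    (hZC : ∀ i j, ∀ᵐ x ∂ν, |Z x i j| ≤ C)
    (hZ : ∀ i j α, ∫ x in S.cell α, Z x i j ∂ν
      = S.harmForm E α (S.coordRes E i) (S.coordRes E j))
    {f : (S.V0 → ℝ) → ℝ} (hf : ContDiff ℝ 2 f) :
    S.IsLaplacian E ν (S.res (f ∘ S.coord E))
      fun x => (Z x * hessianMatrix f (S.coord E x)).trace := by
  have := hν.isFiniteMeasure
  have := hν.nullSingletonClass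
  have hfm := res_comp_coord_mem hcont (hf.of_le (by norm_num : (1 : WithTop ℕ∞) ≤ 2))
  have hw : MemLp (fun x => (Z x * hessianMatrix f (S.coord E x)).trace) 2 ν := by
    simp only [Matrix.trace, Matrix.diag_apply, Matrix.mul_apply]
    refine memLp_finsetSum _ fun i _ => memLp_finsetSum _ fun j _ => ?_
    have hc : Continuous fun x => hessianMatrix f (S.coord E x) j i :=
      (continuous_hessianMatrix hf j i).comp (continuous_coord hcont)
    obtain ⟨B, hB⟩ := (HasCompactSupport.of_compactSpace _).exists_bound_of_continuous hc
    refine MemLp.of_bound ((hZm i j).mul hc.measurable).aestronglyMeasurable (C * B) ?_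
    filter_upwards [hZC i j] with x hx
    rw [norm_mul]
    exact mul_le_mul hx (hB x) (norm_nonneg _) ((abs_nonneg _).trans hx)
  refine ⟨hfm, hw, fun g hg hg0 => ⟨exists_isVersion hlocal hcont hWN hharm hν hg hg0, ?_⟩⟩
  rintro G ⟨hG, u, huc, hum, hug, hux, huG⟩
  have h1 : Tendsto (fun n => E.form (S.res (f ∘ S.coord E)) (S.res (S.subHarmonic E (u n)))) atTop
      (𝓝 (E.form (S.res (f ∘ S.coord E)) g)) :=
    E.tendsto_form_self (fun n => subHarmonic_mem hcont (hum n)) hg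
      (squeeze_zero (fun n => E.nonneg _ (E.dom.sub_mem (subHarmonic_mem hcont (hum n)) hg))
        (fun n => form_subHarmonic_sub_le hcont (hum n) hg hg0) hug) hfm
  have h2 := tendsto_integral_mul_of_eLpNorm_two
    (fun n => memLp_of_continuous (ν := ν) (continuous_subHarmonic hcont (huc n))) hG hw
    (tendsto_eLpNorm_subHarmonic_sub hcont hG huc
      (fun v hv => by simpa [hg0 v hv] using hux v) huG)
  refine tendsto_nhds_unique h1 (h2.neg.congr fun n => ?_)
  exact (form_comp_coord hlocal hcont hZm hZC hZ hf (continuous_subHarmonic hcont (huc n))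
    (subHarmonic_mem hcont (hum n)) fun v hv => subHarmonic_apply_V0 hcont _ hv).symm

end Versions

end FinitelyRamified

namespace FinitelyRamified

section Uniqueness

variable {F : Type*} [MetricSpace F] [CompactSpace F] {A : Type*} {S : FinitelyRamified F A}
  {E : ResistanceForm S.Vstar} [MeasurableSpace F] [BorelSpace F]

lemma IsLaplacian.ae_eq (hcont : S.HarmonicContinuous E) (hHC : S.HarmonicCoordinates E)
    {ν : Measure F} [IsFiniteMeasure ν] [NullSingletonClass ν] {u : S.Vstar → ℝ} {w w' : F → ℝ}
    (h : S.IsLaplacian E ν u w) (h' : S.IsLaplacian E ν u w') : w =ᵐ[ν] w' := by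
  have hψc := continuous_coord hcont
  have hψ : MeasurableEmbedding (S.coord E) :=
    (hψc.isClosedEmbedding hHC.injective).measurableEmbedding
  set U : Set (S.V0 → ℝ) := (S.coord E '' ((S.V0 : Set S.Vstar).image (↑)))ᶜ with hU
  have hUo : IsOpen U := (((S.V0.finite_toSet).image _).image _).isClosed.isOpen_compl
  set d : (S.V0 → ℝ) → ℝ := Function.extend (S.coord E) (w - w') 0 with hd
  have hdψ : ∀ x, d (S.coord E x) = w x - w' x := fun x => hHC.injective.extend_apply _ _ x
  have hdi : Integrable d (ν.map (S.coord E)) := by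
    rw [hψ.integrable_map_iff]
    exact ((h.2.1.sub h'.2.1).integrable one_le_two).congr
      (Eventually.of_forall fun x => (hdψ x).symm)
  have hae := hUo.ae_eq_zero_of_integral_contDiff_smul_eq_zero
    (hdi.locallyIntegrable.locallyIntegrableOn U) fun f hf _ hfU => by
      have hfm : S.res (f ∘ S.coord E) ∈ E.dom :=
        res_comp_coord_mem hcont (hf.of_le (mod_cast le_top))
      have hfc : Continuous (f ∘ S.coord E) := hf.continuous.comp hψc
      have hf0 : ∀ v ∈ S.V0, S.res (f ∘ S.coord E) v = 0 := fun v hv =>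
        image_eq_zero_of_notMem_tsupport (f := f) fun hmem => hfU hmem ⟨v, ⟨v, hv, rfl⟩, rfl⟩
      have e1 := (h.2.2 _ hfm hf0).2 _ (isVersion_res hfc hfm)
      have e2 := (h'.2.2 _ hfm hf0).2 _ (isVersion_res hfc hfm)
      rw [hψ.integral_map]
      simp only [hdψ, smul_eq_mul, mul_sub]
      have hi := memLp_of_continuous (ν := ν) hfc
      have i1 := hi.integrable_mul h.2.1
      have i2 := hi.integrable_mul h'.2.1
      refine (integral_sub i1 i2).trans ?_
      rw [sub_eq_zero]
      exact neg_injective (e1.symm.trans e2)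
  filter_upwards [ae_of_ae_map hψc.aemeasurable hae, ae_notMem_Vstar S ν] with x hx hxV
  refine sub_eq_zero.1 ((hdψ x).symm.trans (hx ?_))
  rintro ⟨-, ⟨v, -, rfl⟩, hv⟩
  exact hxV (hHC.injective hv ▸ v.2)

end Uniqueness

end FinitelyRamified

/-- A smooth truncation of the identity, controlled by the piecewise linear one. -/
lemma exists_smooth_clamp : ∃ L : ℝ, 0 ≤ L ∧ ∀ δ : ℝ, 0 < δ → ∃ τ : ℝ → ℝ, ContDiff ℝ 2 τ ∧
    (∀ t, |t| ≤ δ → τ t = t) ∧ (∀ t, 2 * δ ≤ |t| → τ t = 0) ∧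
    ∀ s t, (τ s - τ t) ^ 2 ≤ L * (ResistanceForm.clamp (2 * δ) s
      - ResistanceForm.clamp (2 * δ) t) ^ 2 := by
  let χ : ContDiffBump (0 : ℝ) := ⟨1, 2, one_pos, one_lt_two⟩
  have hc : ContDiff ℝ 2 fun t => t * χ t := contDiff_id.mul χ.contDiff
  have hsupp : HasCompactSupport fun t => t * χ t := χ.hasCompactSupport.mul_left
  obtain ⟨L, hL⟩ := ContDiff.lipschitzWith_of_hasCompactSupport hsupp hc (by norm_num)
  have h1 : ∀ t : ℝ, |t| ≤ 1 → t * χ t = t := fun t ht => by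
    rw [χ.one_of_mem_closedBall (by simpa using ht), mul_one]
  have h2 : ∀ t : ℝ, 2 ≤ |t| → t * χ t = 0 := fun t ht => by
    rw [χ.zero_of_le_dist (by simpa using ht), mul_zero]
  refine ⟨(L : ℝ) ^ 2, by positivity, fun δ hδ => ⟨fun t => δ * (t / δ * χ (t / δ)), ?_, ?_, ?_, ?_⟩⟩
  · exact contDiff_const.mul (hc.comp (contDiff_id.div_const δ))
  · intro t ht
    beta_reduce
    rw [h1 _ (by rwa [abs_div, abs_of_pos hδ, div_le_one hδ]), mul_div_cancel₀ _ hδ.ne']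
  · intro t ht
    beta_reduce
    rw [h2 _ (by rwa [abs_div, abs_of_pos hδ, le_div_iff₀ hδ]), mul_zero]
  · have hcl : ∀ t : ℝ, δ * (t / δ * χ (t / δ)) = δ * (ResistanceForm.clamp (2 * δ) t / δ *
        χ (ResistanceForm.clamp (2 * δ) t / δ)) := fun t => by
      rcases le_or_gt |t| (2 * δ) with ht | ht
      · rw [ResistanceForm.clamp_of_abs_le ht]
      · have hcle : |ResistanceForm.clamp (2 * δ) t| = 2 * δ := by
          rw [ResistanceForm.clamp]
          rcases lt_abs.1 ht with h | h
          · rw [min_eq_right h.le, max_eq_right (by linarith), abs_of_pos (by linarith)]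
          · rw [min_eq_left (by linarith), max_eq_left (by linarith), abs_neg,
              abs_of_pos (by linarith)]
        rw [h2 _ (by rw [abs_div, abs_of_pos hδ, le_div_iff₀ hδ]; exact ht.le),
          h2 _ (by rw [abs_div, abs_of_pos hδ, le_div_iff₀ hδ, hcle])]
    intro s t
    simp only [hcl s, hcl t]
    set a := ResistanceForm.clamp (2 * δ) s
    set b := ResistanceForm.clamp (2 * δ) t
    have h := hL.dist_le_mul (a / δ) (b / δ)
    rw [Real.dist_eq, Real.dist_eq, ← sub_div, abs_div, abs_of_pos hδ] at h
    rw [← mul_pow, ← sq_abs, ← sq_abs (_ * (a - b)), ← mul_sub, abs_mul, abs_of_pos hδ, abs_mul,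
      NNReal.abs_eq]
    refine pow_le_pow_left₀ (by positivity) ?_ 2
    calc _ ≤ δ * (L * (|a - b| / δ)) := mul_le_mul_of_nonneg_left h hδ.le
      _ = _ := by field_simp

namespace ResistanceForm

variable {X : Type*} {E : ResistanceForm X} {V : ℕ → Finset X}

/-- A function of finite energy is approximated by its compositions with smooth functions that
are locally constant near a given finite set of values. -/
lemma exists_form_comp_sub_lt (hV : Exhausts V) {u : X → ℝ} (hu : u ∈ E.dom) (T : Finset ℝ)
    {ε : ℝ} (hε : 0 < ε) :
    ∃ Φ : ℝ → ℝ, ContDiff ℝ 2 Φ ∧ (∀ c ∈ T, ∀ᶠ t in 𝓝 c, Φ t = c) ∧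
      u - Φ ∘ u ∈ E.dom ∧ E.form (u - Φ ∘ u) (u - Φ ∘ u) < ε := by
  obtain ⟨L, hL0, hL⟩ := exists_smooth_clamp
  set K : ℝ := T.card * L with hK
  have hK0 : 0 ≤ K := by positivity
  set η : ℝ := ε / (T.card * K + 1) with hη
  have hη0 : 0 < η := by positivity
  have hcl : ∀ c : ℝ, ∀ᶠ δ in 𝓝[>] (0 : ℝ), (fun x => clamp (2 * δ) (u x - c)) ∈ E.dom ∧
      E.form (fun x => clamp (2 * δ) (u x - c)) (fun x => clamp (2 * δ) (u x - c)) < η := fun c => by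
    obtain ⟨δ₀, hδ₀, h⟩ := exists_form_clamp_lt hV hu c hη0
    filter_upwards [Ioc_mem_nhdsGT (half_pos hδ₀)] with δ hδ
    exact h _ (by linarith [hδ.1]) (by linarith [hδ.2])
  have hgap : ∀ c c' : ℝ, ∀ᶠ δ in 𝓝[>] (0 : ℝ), c ≠ c' → 3 * δ ≤ |c - c'| := fun c c' => by
    by_cases h : c = c'
    · exact Eventually.of_forall fun δ hne => absurd h hne
    · have hpos : 0 < |c - c'| / 3 := by have := abs_pos.2 (sub_ne_zero.2 h); positivity
      filter_upwards [Ioc_mem_nhdsGT hpos] with δ hδ _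
      linarith [hδ.2]
  obtain ⟨δ, ⟨hδc, hδg⟩, hδ⟩ := (((T.eventually_all.2 fun c _ => hcl c).and
    (T.eventually_all.2 fun c _ => T.eventually_all.2 fun c' _ => hgap c c')).and
      self_mem_nhdsWithin).exists
  obtain ⟨τ, hτ, hτ1, hτ2, hτL⟩ := hL δ hδ
  have hsub : (u - (fun t => t - ∑ c ∈ T, τ (t - c)) ∘ u) = fun x => ∑ c ∈ T, τ (u x - c) := by
    ext x; simp
  have hmain := form_le_sum_of_increments (E := E) hV T (C := fun _ => K)
    (u := fun x => ∑ c ∈ T, τ (u x - c)) (v := fun c x => clamp (2 * δ) (u x - c))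
    (fun _ _ => hK0) (fun c hc => (hδc c hc).1) fun x y => by
      rw [← Finset.sum_sub_distrib]
      refine sq_sum_le_card_mul_sum_sq.trans ?_
      rw [Finset.mul_sum]
      refine Finset.sum_le_sum fun c _ => ?_
      rw [hK, mul_assoc]
      exact mul_le_mul_of_nonneg_left (hτL _ _) (Nat.cast_nonneg _)
  refine ⟨fun t => t - ∑ c ∈ T, τ (t - c), ?_, fun c hc => ?_, ?_, ?_⟩
  · exact contDiff_id.sub (ContDiff.sum fun c _ => hτ.comp (contDiff_id.sub contDiff_const))
  · filter_upwards [Metric.closedBall_mem_nhds c hδ] with t ht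
    rw [Metric.mem_closedBall, Real.dist_eq] at ht
    rw [Finset.sum_eq_single_of_mem c hc, hτ1 _ ht, sub_sub_cancel]
    intro c' hc' hne
    refine hτ2 _ ?_
    have h3 := hδg c hc c' hc' hne.symm
    have h4 := abs_sub_abs_le_abs_sub (c - c') (c - t)
    rw [sub_sub_sub_cancel_left, abs_sub_comm c t] at h4
    linarith
  · rw [hsub]; exact hmain.1
  · rw [hsub]
    refine hmain.2.trans_lt ?_
    calc ∑ c ∈ T, K * E.form (fun x => clamp (2 * δ) (u x - c)) (fun x => clamp (2 * δ) (u x - c))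
        ≤ ∑ _c ∈ T, K * η :=
          Finset.sum_le_sum fun c hc => mul_le_mul_of_nonneg_left (hδc c hc).2.le hK0
      _ = T.card * K * η := by rw [Finset.sum_const, nsmul_eq_mul, ← mul_assoc]
      _ < ε := by
        rw [hη, mul_div_assoc', div_lt_iff₀ (by positivity)]
        nlinarith

end ResistanceForm

lemma Topology.IsClosedEmbedding.exists_contDiff_comp_eq {F V : Type*} [TopologicalSpace F]
    [NormedAddCommGroup V] [NormedSpace ℝ V] [FiniteDimensional ℝ V] {ψ : F → V}
    (hψ : IsClosedEmbedding ψ) {φ : F → ℝ}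
    (h : ∀ x, ∃ g : V → ℝ, ContDiff ℝ 2 g ∧ ∀ᶠ y in 𝓝 x, φ y = g (ψ y)) :
    ∃ f : V → ℝ, ContDiff ℝ 2 f ∧ f ∘ ψ = φ := by
  obtain ⟨f, hf⟩ := exists_contMDiffMap_forall_mem_convex_of_local (modelWithCornersSelf ℝ V)
    (M := V) (F := ℝ) (n := 2) (t := fun y => {r | ∀ x, ψ x = y → r = φ x}) (fun y => by
      intro a ha b hb s t hs ht hst x hx
      rw [ha x hx, hb x hx, ← add_smul, hst, one_smul]) (fun y => by
      by_cases hy : y ∈ Set.range ψ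
      · obtain ⟨x, rfl⟩ := hy
        obtain ⟨g, hg, hφg⟩ := h x
        rw [hψ.isInducing.nhds_eq_comap] at hφg
        obtain ⟨U, hU, hUg⟩ := hφg
        refine ⟨U, hU, g, hg.contMDiff.contMDiffOn, ?_⟩
        rintro _ hz x' rfl
        exact (hUg hz).symm
      · refine ⟨(Set.range ψ)ᶜ, hψ.isClosed_range.isOpen_compl.mem_nhds hy, 0,
          contMDiffOn_const, fun z hz x hx => absurd ⟨x, hx⟩ hz⟩)
  exact ⟨f, f.contMDiff.contDiff, funext fun x => hf _ x rfl⟩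

namespace FinitelyRamified

variable {F : Type*} [MetricSpace F] [CompactSpace F] {A : Type*} {S : FinitelyRamified F A}
  {E : ResistanceForm S.Vstar}

/-- The functions `f ∘ ψ` are dense. -/
lemma exists_form_sub_comp_coord_lt (hcont : S.HarmonicContinuous E)
    (hWN : S.WeaklyNondegenerate E) (hHC : S.HarmonicCoordinates E) {u : S.Vstar → ℝ}
    (hu : u ∈ E.dom) {ε : ℝ} (hε : 0 < ε) :
    ∃ f : (S.V0 → ℝ) → ℝ, ContDiff ℝ 2 f ∧
      E.form (u - S.res (f ∘ S.coord E)) (u - S.res (f ∘ S.coord E)) < ε := by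
  have hψ := (continuous_coord hcont).isClosedEmbedding hHC.injective
  obtain ⟨n, p, hp, hup⟩ := hWN u hu (ε / 4) (by positivity)
  obtain ⟨P, H, hPc, rfl, hPH⟩ := hp.exists_continuous hcont
  obtain ⟨Φ, hΦ, hΦc, hΦm, hΦε⟩ := ResistanceForm.exists_form_comp_sub_lt (S.exhausts) hp.1
    ((S.Vlvl n).image (S.res P)) (ε := ε / 4) (by positivity)
  obtain ⟨f, hf, hfψ⟩ := hψ.exists_contDiff_comp_eq (φ := Φ ∘ P) fun x => by
    by_cases hx : ∃ v ∈ S.Vlvl n, (v : F) = x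
    · obtain ⟨v, hv, rfl⟩ := hx
      exact ⟨fun _ => P v, contDiff_const,
        hPc.continuousAt.eventually (hΦc (P v) (Finset.mem_image.2 ⟨v, hv, rfl⟩))⟩
    · obtain ⟨α, hα, hxα⟩ := S.exists_cell n x
      refine ⟨fun y => Φ (∑ i : S.V0, S.res (H α) i * y i), ?_, ?_⟩
      · exact hΦ.comp (ContDiff.sum fun i _ => contDiff_const.mul (contDiff_apply ℝ ℝ i))
      · have hclosed : IsClosed (⋃ β ∈ (S.lvl n : Set A) \ {α}, S.cell β) :=
          ((S.lvl n).finite_toSet.sdiff).isClosed_biUnion fun β _ => (S.cell_compact β).isClosed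
        have hxn : x ∈ (⋃ β ∈ (S.lvl n : Set A) \ {α}, S.cell β)ᶜ := by
          simp only [Set.mem_compl_iff, Set.mem_iUnion, not_exists]
          rintro β ⟨hβ, hne⟩ hxβ
          have hv := mem_Vlvl_of_mem_two hα hβ (Ne.symm hne) hxα hxβ
          exact hx ⟨⟨x, mem_Vstar hv⟩, V_subset_Vlvl hα (mem_V.2 hv), rfl⟩
        filter_upwards [hclosed.isOpen_compl.mem_nhds hxn] with y hy
        obtain ⟨β, hβ, hyβ⟩ := S.exists_cell n y
        have hβα : β = α := by
          by_contra hne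
          exact hy (Set.mem_biUnion (x := β) ⟨hβ, hne⟩ hyβ)
        subst hβα
        obtain ⟨hHh, hHc, hHP⟩ := hPH β hβ
        have e : (fun x => ∑ i : S.V0, S.res (H β) i * S.coord E x i) = H β :=
          eq_of_res_eq (continuous_finsetSum _ fun i _ => continuous_const.mul
            (continuous_coord_apply hcont i)) hHc (hHh.exists_continuous hcont)
        change Φ (P y) = _
        rw [hHP y hyβ, ← congrFun e y]
  refine ⟨f, hf, ?_⟩
  rw [hfψ]
  have e : u - S.res (Φ ∘ P) = (u - S.res P) + (S.res P - Φ ∘ S.res P) := by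
    ext x; simp [res]
  rw [e]
  have := E.form_add_self_le (E.dom.sub_mem hu hp.1) hΦm
  linarith

end FinitelyRamified

theorem mainTheorem3 {F : Type*} [MetricSpace F] [CompactSpace F] [MeasurableSpace F] [BorelSpace F]
    {A : Type*} (S : FinitelyRamified F A) (E : ResistanceForm S.Vstar)
    (hlocal : S.IsLocal E)
    (hcont : S.HarmonicContinuous E)
    (hWN : S.WeaklyNondegenerate E)
    (hHC : S.HarmonicCoordinates E)
    (h : Fin (S.V0.card - 1) → S.Vstar → ℝ)
    (hharm : ∀ i, S.IsHarmonic E (h i))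
    (horth : ∀ i j, E.form (h i) (h j) = if i = j then 1 else 0) :
    ∃ ν : Measure F, S.IsKusuokaMeasure E h ν ∧ (∀ ν', S.IsKusuokaMeasure E h ν' → ν' = ν) ∧
      ∃ Z : F → Matrix S.V0 S.V0 ℝ,
        (∀ᵐ x ∂ν, Tendsto (fun n => S.Zlvl E ν n x) atTop (𝓝 (Z x))) ∧
        (∀ f : (S.V0 → ℝ) → ℝ, ContDiff ℝ 2 f →
          (∃ w, S.IsLaplacian E ν (S.res (f ∘ S.coord E)) w) ∧
          ∀ w, S.IsLaplacian E ν (S.res (f ∘ S.coord E)) w →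
            ∀ᵐ x ∂ν, w x = (Z x * hessianMatrix f (S.coord E x)).trace) ∧
        (∀ u w, S.IsLaplacian E ν u w → ∀ ε > 0,
          ∃ f : (S.V0 → ℝ) → ℝ, ContDiff ℝ 2 f ∧
            E.form (u - S.res (f ∘ S.coord E)) (u - S.res (f ∘ S.coord E)) < ε) := by
  obtain ⟨ν, hν, huniq⟩ := FinitelyRamified.existsUnique_isKusuokaMeasure hlocal hcont hharm
  have := hν.isFiniteMeasure
  have := hν.nullSingletonClass
  obtain ⟨Z, hZlim, hZm, ⟨C, hZC⟩, hZ⟩ :=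
    FinitelyRamified.exists_Z hlocal hcont hharm horth hν
  refine ⟨ν, hν, huniq, Z, hZlim, fun f hf => ?_, fun u w hu ε hε =>
    FinitelyRamified.exists_form_sub_comp_coord_lt hcont hWN hHC hu.1 hε⟩
  have hf' := FinitelyRamified.isLaplacian_comp_coord hlocal hcont hWN hharm hν hZm hZC hZ hf
  exact ⟨⟨_, hf'⟩, fun w hw => hw.ae_eq hcont hHC hf'⟩
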